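/- **Theorem (Universality).** Fix $M\ge 2$ and let $\mathbb P=\{0,\dots,M\}$. *Open parity games.* An object is a pair $m=(m^{+},m^{-})$ of natural numbers (numbers of left-to-right and of right-to-left wires). An open parity game $A:m\to n$ consists of a finite set $V$ of internal positions, a subset $V_0\subseteq V$ (Player $0$'s positions; $V_1=V\setminus V_0$ are Player $1$'s), a priority function $\Omega:V\to\mathbb P$, and a relation $E\subseteq(\mathrm{Ent}+V)\times(V+\mathrm{Exit})$, where $\mathrm{Ent}$ consists of the $m^{+}$ left-to-right wires of the domain and the $n^{-}$ right-to-left wires of the codomain, and $\mathrm{Exit}$ of the $m^{-}$ right-to-left wires of the domain and the $n^{+}$ left-to-right wires of the codomain; there is exactly one edge out of each entry and exactly one edge into each exit. *Equivalence.* A play starts at an entry and follows edges until it reaches an exit or a position without successor, or forever; the owner of an internal position chooses the next position, by a strategy that may depend on the history and must choose a successor whenever there is one. A play ending at exit $o$ denotes $(o,k)$, where $k$ is the largest priority met ($k=0$ if no internal position is met). A play ending at an internal position without successor is lost by the owner of that position. An infinite play is won by Player $0$ if the largest priority occurring infinitely often is even, and by Player $1$ otherwise. The semantics of $A$ is the set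 of pairs $(T,i)$, with $T\subseteq\mathrm{Exit}\times\mathbb P$ and $i\in\mathrm{Ent}$, such that Player $0$ has a strategy against which no strategy of Player $1$ makes Player $0$ lose the play from $i$, and such that every $(o,k)$ denoted by a play from $i$ consistent with it lies in $T$. Two games $A,B:m\to n$ are equivalent, $A\simeq B$, if they have the same semantics. *Operations.* For $A:m\to n$ and $B:n\to o$, the composite $A;B:m\to o$ has the disjoint union of the internal positions; the wires of $n$ (exits of one game identified with entries of the other) are hidden, and there is an edge from $s$ to $t$ iff there is a path from $s$ to $t$ in the union of the two graphs all of whose intermediate nodes are hidden wires. The product $A\otimes B$ is juxtaposition. The identity and swap games have no internal positions and join each entry to the corresponding exit. *Diagrams.* Let $d$ range over the morphisms $v\to w$ ($v,w$ words over $\{\blacktriangleright,\blacktriangleleft\}$) of the free two-coloured prop on the finite set of generators $$\text{player-}0,\ \text{player-}1:\blacktriangleright\to\blacktriangleright\blacktriangleright,\quad \text{lose-}0,\ \text{lose-}1:\blacktriangleright\to\varepsilon,\quad \text{merge}:\blacktriangleright\blacktriangleright\to\blacktriangleright,\quad \text{start}:\varepsilon\to\blacktriangleright,$$ $$\text{priority}_p:\blacktriangleright\to\blacktriangleright\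 (p\in\mathbb P),\quad \text{cap}:\blacktriangleleft\blacktriangleright\to\varepsilon,\quad \text{cup}:\varepsilon\to\blacktriangleright\blacktriangleleft .$$ The interpretation $[\![\cdot]\!]$ sends $\blacktriangleright$ to $(1,0)$, $\blacktriangleleft$ to $(0,1)$, concatenation of words to componentwise addition, and composition, product, identities and symmetries of diagrams to those of games. Each generator other than cup and cap is sent to the game with one internal position $x$, an edge from every entry to $x$ and an edge from $x$ to every exit; $x$ belongs to Player $0$ for player-$0$ and lose-$0$ and to Player $1$ otherwise, and has priority $p$ for $\text{priority}_p$ and $0$ otherwise. Cup and cap are sent to the game without internal positions whose single entry is joined to its single exit. *Claim.* For every open parity game $A:m\to n$ and all words $v,w$ with $[\![v]\!]=m$ and $[\![w]\!]=n$ there is a diagram $d:v\to w$ such that $[\![d]\!]\simeq A$. In particular, every open parity game $A:(m,0)\to(n,0)$, with $m,n\in\mathbb N$, is equivalent to the interpretation of a diagram $\blacktriangleright^m\to\blacktriangleright^n$. -/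

import Mathlib

universe u v

namespace ParityGames

/-! ## Open parity games -/

/-- An object is a pair of natural numbers: the number of wires going from left to right and the
number of wires going from right to left. -/
abbrev Obj : Type := ℕ × ℕ

/-- The entry positions of a game `m → n`: the left-to-right wires of its domain, followed by the
right-to-left wires of its codomain. -/
abbrev Entries (m n : Obj) : Type := Fin m.1 ⊕ Fin n.2

/-- The exit positions of a game `m → n`: the right-to-left wires of its domain, followed by the
left-to-right wires of its codomain. -/
abbrev Exits (m n : Obj) : Type := Fin m.2 ⊕ Fin n.1

/-- An open parity game `m → n` with priorities in `{0, …, M}`. -/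
structure OpenParityGame (M : ℕ) (m n : Obj) : Type (u + 1) where
  /-- internal positions -/
  V : Type u
  finite : Finite V
  /-- the internal positions of Player 0; all others belong to Player 1 -/
  V₀ : Set V
  /-- edges -/
  E : Entries m n ⊕ V → V ⊕ Exits m n → Prop
  entry_unique : ∀ e : Entries m n, ∃! t, E (Sum.inl e) t
  exit_unique : ∀ o : Exits m n, ∃! s, E s (Sum.inr o)
  /-- priorities -/
  prio : V → Fin (M + 1)

/-! ### Feedback of a relation along hidden nodes -/

/-- `feedback R s t`: there is an `R`-path from `s` to `t` all of whose intermediate nodes are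
hidden, that is, lie in `H`. -/
def feedback {S T H : Type*} (R : S ⊕ H → T ⊕ H → Prop) (s : S) (t : T) : Prop :=
  R (Sum.inl s) (Sum.inl t) ∨
    ∃ h h' : H, R (Sum.inl s) (Sum.inr h) ∧
      Relation.ReflTransGen (fun a b : H => R (Sum.inr a) (Sum.inr b)) h h' ∧
      R (Sum.inr h') (Sum.inl t)

theorem feedback_flip {S T H : Type*} (R : S ⊕ H → T ⊕ H → Prop) (s : S) (t : T) :
    feedback (fun x y => R y x) t s ↔ feedback R s t := by
  unfold feedback
  refine or_congr Iff.rfl ⟨?_, ?_⟩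
  · rintro ⟨h, h', h1, h2, h3⟩
    exact ⟨h', h, h3, Relation.reflTransGen_swap.1 h2, h1⟩
  · rintro ⟨h, h', h1, h2, h3⟩
    exact ⟨h', h, h3, Relation.reflTransGen_swap.1 h2, h1⟩

theorem feedback_existsUnique {S T H : Type*} [Finite H] (R : S ⊕ H → T ⊕ H → Prop) (s : S)
    (hs : ∃! x, R (Sum.inl s) x) (hout : ∀ h, ∃! x, R (Sum.inr h) x)
    (hin : ∀ h, ∃! x, R x (Sum.inr h)) : ∃! t, feedback R s t := by
  have key : ∀ h h₁ h₂ : H, ∀ t₁ t₂ : T,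
      Relation.ReflTransGen (fun a b : H => R (Sum.inr a) (Sum.inr b)) h h₁ →
      Relation.ReflTransGen (fun a b : H => R (Sum.inr a) (Sum.inr b)) h h₂ →
      R (Sum.inr h₁) (Sum.inl t₁) → R (Sum.inr h₂) (Sum.inl t₂) → t₁ = t₂ := by
    intro h h₁ h₂ t₁ t₂ p₁ p₂ e₁ e₂
    induction p₁ using Relation.ReflTransGen.head_induction_on with
    | refl =>
      rcases Relation.ReflTransGen.cases_head p₂ with rfl | ⟨c, hc, -⟩
      · exact Sum.inl.inj ((hout _).unique e₁ e₂)
      · exact absurd ((hout _).unique e₁ hc) (by simp)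
    | head hab hbc ih =>
      rcases Relation.ReflTransGen.cases_head p₂ with rfl | ⟨c, hc, hc₂⟩
      · exact absurd ((hout _).unique e₂ hab) (by simp)
      · have := Sum.inr.inj ((hout _).unique hab hc)
        subst this
        exact ih hc₂
  have ex : ∃ t, feedback R s t := by
    by_contra hno
    obtain ⟨x, hx, -⟩ := hs
    rcases x with t | h₀
    · exact hno ⟨t, Or.inl hx⟩
    · have nxt : ∀ h : {h : H // Relation.ReflTransGen
          (fun a b : H => R (Sum.inr a) (Sum.inr b)) h₀ h},
          ∃ k : {h : H // Relation.ReflTransGen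
          (fun a b : H => R (Sum.inr a) (Sum.inr b)) h₀ h}, R (Sum.inr h.1) (Sum.inr k.1) := by
        rintro ⟨h, hh⟩
        obtain ⟨y, hy, -⟩ := hout h
        rcases y with t | k
        · exact absurd ⟨t, Or.inr ⟨h₀, h, hx, hh, hy⟩⟩ hno
        · exact ⟨⟨k, hh.tail hy⟩, hy⟩
      choose f hf using nxt
      let q : ℕ → {h : H // Relation.ReflTransGen
          (fun a b : H => R (Sum.inr a) (Sum.inr b)) h₀ h} :=
        fun n => f^[n] ⟨h₀, .refl⟩
      have hq : ∀ n, R (Sum.inr (q n).1) (Sum.inr (q (n + 1)).1) := by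
        intro n
        have := hf (q n)
        rwa [show q (n + 1) = f (q n) from Function.iterate_succ_apply' f n _]
      have inj : ∀ a b, a < b → (q a).1 ≠ (q b).1 := by
        intro a
        induction a with
        | zero =>
          intro b hb heq
          obtain ⟨c, rfl⟩ : ∃ c, b = c + 1 := ⟨b - 1, by omega⟩
          have h1 := hq c
          rw [← heq] at h1
          exact absurd ((hin _).unique hx h1) (by simp)
        | succ a ih =>
          intro b hb heq
          obtain ⟨c, rfl⟩ : ∃ c, b = c + 1 := ⟨b - 1, by omega⟩
          have h1 := hq c
          rw [← heq] at h1
          exact ih c (by omega) (Sum.inr.inj ((hin _).unique (hq a) h1))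
      refine not_injective_infinite_finite (fun n => (q n).1) fun a b hab => ?_
      rcases lt_trichotomy a b with h | h | h
      · exact absurd hab (inj a b h)
      · exact h
      · exact absurd hab.symm (inj b a h)
  obtain ⟨t, ht⟩ := ex
  refine ⟨t, ht, fun t' ht' => ?_⟩
  rcases ht with ht | ⟨h, k, a, b, c⟩ <;> rcases ht' with ht' | ⟨h', k', a', b', c'⟩
  · exact Sum.inl.inj (hs.unique ht' ht)
  · exact absurd (hs.unique ht a') (by simp)
  · exact absurd (hs.unique ht' a) (by simp)
  · have := Sum.inr.inj (hs.unique a a')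
    subst this
    exact key _ _ _ _ _ b' b c' c

namespace OpenParityGame

variable {M : ℕ}

/-- Transport along equalities of objects. -/
def cast {m m' n n' : Obj} (hm : m = m') (hn : n = n') (A : OpenParityGame.{u} M m n) :
    OpenParityGame.{u} M m' n' :=
  hm ▸ hn ▸ A

/-! ### Composition

The wires of the common interface are hidden. They are `Fin n.1 ⊕ Fin n.2`: the left-to-right
ones (exits of the first game, entries of the second) and the right-to-left ones (exits of the
second game, entries of the first). -/

section comp

variable {m n o : Obj} (A : OpenParityGame.{u} M m n) (B : OpenParityGame.{u} M n o)

def compSrcLeft : Entries m n ⊕ A.V → (Entries m o ⊕ (A.V ⊕ B.V)) ⊕ (Fin n.1 ⊕ Fin n.2)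
  | Sum.inl (Sum.inl i) => Sum.inl (Sum.inl (Sum.inl i))
  | Sum.inl (Sum.inr j) => Sum.inr (Sum.inr j)
  | Sum.inr x => Sum.inl (Sum.inr (Sum.inl x))

def compSrcRight : Entries n o ⊕ B.V → (Entries m o ⊕ (A.V ⊕ B.V)) ⊕ (Fin n.1 ⊕ Fin n.2)
  | Sum.inl (Sum.inl i) => Sum.inr (Sum.inl i)
  | Sum.inl (Sum.inr j) => Sum.inl (Sum.inl (Sum.inr j))
  | Sum.inr x => Sum.inl (Sum.inr (Sum.inr x))

def compTgtLeft : A.V ⊕ Exits m n → ((A.V ⊕ B.V) ⊕ Exits m o) ⊕ (Fin n.1 ⊕ Fin n.2)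
  | Sum.inl x => Sum.inl (Sum.inl (Sum.inl x))
  | Sum.inr (Sum.inl j) => Sum.inl (Sum.inr (Sum.inl j))
  | Sum.inr (Sum.inr i) => Sum.inr (Sum.inl i)

def compTgtRight : B.V ⊕ Exits n o → ((A.V ⊕ B.V) ⊕ Exits m o) ⊕ (Fin n.1 ⊕ Fin n.2)
  | Sum.inl x => Sum.inl (Sum.inl (Sum.inr x))
  | Sum.inr (Sum.inl j) => Sum.inr (Sum.inr j)
  | Sum.inr (Sum.inr i) => Sum.inl (Sum.inr (Sum.inr i))

/-- The union of the two edge relations, in which the hidden wires are still nodes. -/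
def compEdge (s : (Entries m o ⊕ (A.V ⊕ B.V)) ⊕ (Fin n.1 ⊕ Fin n.2))
    (t : ((A.V ⊕ B.V) ⊕ Exits m o) ⊕ (Fin n.1 ⊕ Fin n.2)) : Prop :=
  (∃ a b, A.E a b ∧ compSrcLeft A B a = s ∧ compTgtLeft A B b = t) ∨
    (∃ a b, B.E a b ∧ compSrcRight A B a = s ∧ compTgtRight A B b = t)

theorem compSrcLeft_injective : Function.Injective (compSrcLeft A B) := by
  rintro ((a | a) | a) ((b | b) | b) h <;> simp_all [compSrcLeft]

theorem compSrcRight_injective : Function.Injective (compSrcRight A B) := by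
  rintro ((a | a) | a) ((b | b) | b) h <;> simp_all [compSrcRight]

theorem compTgtLeft_injective : Function.Injective (compTgtLeft A B) := by
  rintro (a | (a | a)) (b | (b | b)) h <;> simp_all [compTgtLeft]

theorem compTgtRight_injective : Function.Injective (compTgtRight A B) := by
  rintro (a | (a | a)) (b | (b | b)) h <;> simp_all [compTgtRight]

theorem compSrc_ne (a b) : compSrcLeft A B a ≠ compSrcRight A B b := by
  rcases a with (a | a) | a <;> rcases b with (b | b) | b <;> simp [compSrcLeft, compSrcRight]

theorem compTgt_ne (a b) : compTgtLeft A B a ≠ compTgtRight A B b := by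
  rcases a with a | (a | a) <;> rcases b with b | (b | b) <;> simp [compTgtLeft, compTgtRight]

theorem compEdge_srcLeft (e) : ∃! t, compEdge A B (compSrcLeft A B (Sum.inl e)) t := by
  obtain ⟨t, ht, hu⟩ := A.entry_unique e
  refine ⟨compTgtLeft A B t, Or.inl ⟨_, _, ht, rfl, rfl⟩, ?_⟩
  rintro _ (⟨a, b, hab, h1, rfl⟩ | ⟨a, b, hab, h1, rfl⟩)
  · rw [compSrcLeft_injective A B h1] at hab
    rw [hu b hab]
  · exact absurd h1.symm (compSrc_ne A B _ _)

theorem compEdge_srcRight (e) : ∃! t, compEdge A B (compSrcRight A B (Sum.inl e)) t := by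
  obtain ⟨t, ht, hu⟩ := B.entry_unique e
  refine ⟨compTgtRight A B t, Or.inr ⟨_, _, ht, rfl, rfl⟩, ?_⟩
  rintro _ (⟨a, b, hab, h1, rfl⟩ | ⟨a, b, hab, h1, rfl⟩)
  · exact absurd h1 (compSrc_ne A B _ _)
  · rw [compSrcRight_injective A B h1] at hab
    rw [hu b hab]

theorem compEdge_tgtLeft (e) : ∃! s, compEdge A B s (compTgtLeft A B (Sum.inr e)) := by
  obtain ⟨t, ht, hu⟩ := A.exit_unique e
  refine ⟨compSrcLeft A B t, Or.inl ⟨_, _, ht, rfl, rfl⟩, ?_⟩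
  rintro _ (⟨a, b, hab, rfl, h1⟩ | ⟨a, b, hab, rfl, h1⟩)
  · rw [compTgtLeft_injective A B h1] at hab
    rw [hu a hab]
  · exact absurd h1.symm (compTgt_ne A B _ _)

theorem compEdge_tgtRight (e) : ∃! s, compEdge A B s (compTgtRight A B (Sum.inr e)) := by
  obtain ⟨t, ht, hu⟩ := B.exit_unique e
  refine ⟨compSrcRight A B t, Or.inr ⟨_, _, ht, rfl, rfl⟩, ?_⟩
  rintro _ (⟨a, b, hab, rfl, h1⟩ | ⟨a, b, hab, rfl, h1⟩)
  · exact absurd h1 (compTgt_ne A B _ _)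
  · rw [compTgtRight_injective A B h1] at hab
    rw [hu a hab]

theorem compEdge_hidden_out (h : Fin n.1 ⊕ Fin n.2) : ∃! t, compEdge A B (Sum.inr h) t := by
  rcases h with i | j
  · exact compEdge_srcRight A B (Sum.inl i)
  · exact compEdge_srcLeft A B (Sum.inr j)

theorem compEdge_hidden_in (h : Fin n.1 ⊕ Fin n.2) : ∃! s, compEdge A B s (Sum.inr h) := by
  rcases h with i | j
  · exact compEdge_tgtLeft A B (Sum.inr i)
  · exact compEdge_tgtRight A B (Sum.inl j)

/-- The composite of two games: their internal positions are juxtaposed, and a maximal chain of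
edges through hidden wires becomes a single edge. -/
def comp : OpenParityGame.{u} M m o where
  V := A.V ⊕ B.V
  finite := by
    have := A.finite
    have := B.finite
    infer_instance
  V₀ := {x | Sum.elim (· ∈ A.V₀) (· ∈ B.V₀) x}
  E := feedback (compEdge A B)
  entry_unique := by
    rintro (i | j)
    · exact feedback_existsUnique _ _ (compEdge_srcLeft A B (Sum.inl i))
        (compEdge_hidden_out A B) (compEdge_hidden_in A B)
    · exact feedback_existsUnique _ _ (compEdge_srcRight A B (Sum.inr j))
        (compEdge_hidden_out A B) (compEdge_hidden_in A B)
  exit_unique := by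
    intro x
    have key : ∃! s, feedback (fun p q => compEdge A B q p) (Sum.inr x) s := by
      rcases x with j | i
      · exact feedback_existsUnique _ _ (compEdge_tgtLeft A B (Sum.inl j))
          (compEdge_hidden_in A B) (compEdge_hidden_out A B)
      · exact feedback_existsUnique _ _ (compEdge_tgtRight A B (Sum.inr i))
          (compEdge_hidden_in A B) (compEdge_hidden_out A B)
    simpa only [feedback_flip] using key
  prio := Sum.elim A.prio B.prio

end comp

/-! ### Monoidal product -/

section tensor

variable {m₁ n₁ m₂ n₂ : Obj} (A : OpenParityGame.{u} M m₁ n₁) (B : OpenParityGame.{u} M m₂ n₂)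

def tensorSrcLeft : Entries m₁ n₁ ⊕ A.V → Entries (m₁ + m₂) (n₁ + n₂) ⊕ (A.V ⊕ B.V)
  | Sum.inl (Sum.inl i) => Sum.inl (Sum.inl (Fin.castAdd m₂.1 i))
  | Sum.inl (Sum.inr j) => Sum.inl (Sum.inr (Fin.castAdd n₂.2 j))
  | Sum.inr x => Sum.inr (Sum.inl x)

def tensorSrcRight : Entries m₂ n₂ ⊕ B.V → Entries (m₁ + m₂) (n₁ + n₂) ⊕ (A.V ⊕ B.V)
  | Sum.inl (Sum.inl i) => Sum.inl (Sum.inl (Fin.natAdd m₁.1 i))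
  | Sum.inl (Sum.inr j) => Sum.inl (Sum.inr (Fin.natAdd n₁.2 j))
  | Sum.inr x => Sum.inr (Sum.inr x)

def tensorTgtLeft : A.V ⊕ Exits m₁ n₁ → (A.V ⊕ B.V) ⊕ Exits (m₁ + m₂) (n₁ + n₂)
  | Sum.inl x => Sum.inl (Sum.inl x)
  | Sum.inr (Sum.inl j) => Sum.inr (Sum.inl (Fin.castAdd m₂.2 j))
  | Sum.inr (Sum.inr i) => Sum.inr (Sum.inr (Fin.castAdd n₂.1 i))

def tensorTgtRight : B.V ⊕ Exits m₂ n₂ → (A.V ⊕ B.V) ⊕ Exits (m₁ + m₂) (n₁ + n₂)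
  | Sum.inl x => Sum.inl (Sum.inr x)
  | Sum.inr (Sum.inl j) => Sum.inr (Sum.inl (Fin.natAdd m₁.2 j))
  | Sum.inr (Sum.inr i) => Sum.inr (Sum.inr (Fin.natAdd n₁.1 i))

/-- The disjoint union of the two edge relations. -/
def tensorEdge (s : Entries (m₁ + m₂) (n₁ + n₂) ⊕ (A.V ⊕ B.V))
    (t : (A.V ⊕ B.V) ⊕ Exits (m₁ + m₂) (n₁ + n₂)) : Prop :=
  (∃ a b, A.E a b ∧ tensorSrcLeft A B a = s ∧ tensorTgtLeft A B b = t) ∨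
    (∃ a b, B.E a b ∧ tensorSrcRight A B a = s ∧ tensorTgtRight A B b = t)

theorem castAdd_ne_natAdd {a b : ℕ} (i : Fin a) (j : Fin b) :
    Fin.castAdd b i ≠ Fin.natAdd a j := by
  intro h
  have := congrArg Fin.val h
  simp at this
  omega

theorem tensorSrcLeft_injective : Function.Injective (tensorSrcLeft A B) := by
  rintro ((a | a) | a) ((b | b) | b) h <;>
    simp only [tensorSrcLeft, Sum.inl.injEq, Sum.inr.injEq, reduceCtorEq] at h ⊢
  · exact Fin.castAdd_injective _ _ h
  · exact Fin.castAdd_injective _ _ h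
  · exact h

theorem tensorSrcRight_injective : Function.Injective (tensorSrcRight A B) := by
  rintro ((a | a) | a) ((b | b) | b) h <;>
    simp only [tensorSrcRight, Sum.inl.injEq, Sum.inr.injEq, reduceCtorEq] at h ⊢
  · exact Fin.natAdd_injective _ _ h
  · exact Fin.natAdd_injective _ _ h
  · exact h

theorem tensorTgtLeft_injective : Function.Injective (tensorTgtLeft A B) := by
  rintro (a | (a | a)) (b | (b | b)) h <;>
    simp only [tensorTgtLeft, Sum.inl.injEq, Sum.inr.injEq, reduceCtorEq] at h ⊢
  · exact h
  · exact Fin.castAdd_injective _ _ h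
  · exact Fin.castAdd_injective _ _ h

theorem tensorTgtRight_injective : Function.Injective (tensorTgtRight A B) := by
  rintro (a | (a | a)) (b | (b | b)) h <;>
    simp only [tensorTgtRight, Sum.inl.injEq, Sum.inr.injEq, reduceCtorEq] at h ⊢
  · exact h
  · exact Fin.natAdd_injective _ _ h
  · exact Fin.natAdd_injective _ _ h

theorem tensorSrc_ne (a b) : tensorSrcLeft A B a ≠ tensorSrcRight A B b := by
  intro h
  rcases a with (a | a) | a <;> rcases b with (b | b) | b <;>
    simp only [tensorSrcLeft, tensorSrcRight, Sum.inl.injEq, Sum.inr.injEq, reduceCtorEq] at h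
  · exact castAdd_ne_natAdd _ _ h
  · exact castAdd_ne_natAdd _ _ h

theorem tensorTgt_ne (a b) : tensorTgtLeft A B a ≠ tensorTgtRight A B b := by
  intro h
  rcases a with a | (a | a) <;> rcases b with b | (b | b) <;>
    simp only [tensorTgtLeft, tensorTgtRight, Sum.inl.injEq, Sum.inr.injEq, reduceCtorEq] at h
  · exact castAdd_ne_natAdd _ _ h
  · exact castAdd_ne_natAdd _ _ h

theorem tensorEdge_srcLeft (e) : ∃! t, tensorEdge A B (tensorSrcLeft A B (Sum.inl e)) t := by
  obtain ⟨t, ht, hu⟩ := A.entry_unique e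
  refine ⟨tensorTgtLeft A B t, Or.inl ⟨_, _, ht, rfl, rfl⟩, ?_⟩
  rintro _ (⟨a, b, hab, h1, rfl⟩ | ⟨a, b, hab, h1, rfl⟩)
  · rw [tensorSrcLeft_injective A B h1] at hab
    rw [hu b hab]
  · exact absurd h1.symm (tensorSrc_ne A B _ _)

theorem tensorEdge_srcRight (e) : ∃! t, tensorEdge A B (tensorSrcRight A B (Sum.inl e)) t := by
  obtain ⟨t, ht, hu⟩ := B.entry_unique e
  refine ⟨tensorTgtRight A B t, Or.inr ⟨_, _, ht, rfl, rfl⟩, ?_⟩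
  rintro _ (⟨a, b, hab, h1, rfl⟩ | ⟨a, b, hab, h1, rfl⟩)
  · exact absurd h1 (tensorSrc_ne A B _ _)
  · rw [tensorSrcRight_injective A B h1] at hab
    rw [hu b hab]

theorem tensorEdge_tgtLeft (e) : ∃! s, tensorEdge A B s (tensorTgtLeft A B (Sum.inr e)) := by
  obtain ⟨t, ht, hu⟩ := A.exit_unique e
  refine ⟨tensorSrcLeft A B t, Or.inl ⟨_, _, ht, rfl, rfl⟩, ?_⟩
  rintro _ (⟨a, b, hab, rfl, h1⟩ | ⟨a, b, hab, rfl, h1⟩)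
  · rw [tensorTgtLeft_injective A B h1] at hab
    rw [hu a hab]
  · exact absurd h1.symm (tensorTgt_ne A B _ _)

theorem tensorEdge_tgtRight (e) : ∃! s, tensorEdge A B s (tensorTgtRight A B (Sum.inr e)) := by
  obtain ⟨t, ht, hu⟩ := B.exit_unique e
  refine ⟨tensorSrcRight A B t, Or.inr ⟨_, _, ht, rfl, rfl⟩, ?_⟩
  rintro _ (⟨a, b, hab, rfl, h1⟩ | ⟨a, b, hab, rfl, h1⟩)
  · exact absurd h1 (tensorTgt_ne A B _ _)
  · rw [tensorTgtRight_injective A B h1] at hab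
    rw [hu a hab]

/-- The monoidal product of two games: juxtaposition, the wires of the second game being numbered
after those of the first game in each of the four groups of wires. -/
def tensor : OpenParityGame.{u} M (m₁ + m₂) (n₁ + n₂) where
  V := A.V ⊕ B.V
  finite := by
    have := A.finite
    have := B.finite
    infer_instance
  V₀ := {x | Sum.elim (· ∈ A.V₀) (· ∈ B.V₀) x}
  E := tensorEdge A B
  entry_unique := by
    rintro (i | j)
    · refine Fin.addCases (m := m₁.1) (n := m₂.1) (fun i => ?_) (fun i => ?_) i
      · exact tensorEdge_srcLeft A B (Sum.inl i)
      · exact tensorEdge_srcRight A B (Sum.inl i)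
    · refine Fin.addCases (m := n₁.2) (n := n₂.2) (fun j => ?_) (fun j => ?_) j
      · exact tensorEdge_srcLeft A B (Sum.inr j)
      · exact tensorEdge_srcRight A B (Sum.inr j)
  exit_unique := by
    rintro (j | i)
    · refine Fin.addCases (m := m₁.2) (n := m₂.2) (fun j => ?_) (fun j => ?_) j
      · exact tensorEdge_tgtLeft A B (Sum.inl j)
      · exact tensorEdge_tgtRight A B (Sum.inl j)
    · refine Fin.addCases (m := n₁.1) (n := n₂.1) (fun i => ?_) (fun i => ?_) i
      · exact tensorEdge_tgtLeft A B (Sum.inr i)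
      · exact tensorEdge_tgtRight A B (Sum.inr i)
  prio := Sum.elim A.prio B.prio

end tensor

/-! ### Elementary games -/

/-- The game without internal positions in which entry `e` is joined to exit `f e`. -/
def wiring (M : ℕ) {m n : Obj} (f : Entries m n ≃ Exits m n) : OpenParityGame.{0} M m n where
  V := Empty
  finite := inferInstance
  V₀ := ∅
  E := fun s t =>
    match s, t with
    | Sum.inl e, Sum.inr o => f e = o
    | _, _ => False
  entry_unique := fun e => ⟨Sum.inr (f e), rfl, by
    rintro (t | t) h
    · exact t.elim
    · exact congrArg Sum.inr (Eq.symm h)⟩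
  exit_unique := fun o => ⟨Sum.inl (f.symm o), f.apply_symm_apply o, by
    rintro (s | s) h
    · exact congrArg Sum.inl ((Equiv.eq_symm_apply f).2 h)
    · exact s.elim⟩
  prio := Empty.elim

/-- The identity game. -/
def idGame (M : ℕ) (m : Obj) : OpenParityGame.{0} M m m :=
  wiring M (Equiv.sumComm (Fin m.1) (Fin m.2))

/-- The swap game. `finAddFlip : Fin (a + b) ≃ Fin (b + a)` exchanges the first `a` and the last
`b` elements, preserving the order inside each of the two blocks. -/
def swapGame (M : ℕ) (m n : Obj) : OpenParityGame.{0} M (m + n) (n + m) :=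
  wiring M (((finAddFlip (m := m.1) (n := n.1)).sumCongr
    (finAddFlip (m := n.2) (n := m.2))).trans (Equiv.sumComm _ _))

/-- The game with one internal position `v`, of priority `p`, with an edge from each of its `a`
entry positions to `v` and an edge from `v` to each of its `b` exit positions. -/
def node {M : ℕ} (owner : Set Unit) (p : Fin (M + 1)) (a b : ℕ) :
    OpenParityGame.{0} M (a, 0) (b, 0) where
  V := Unit
  finite := inferInstance
  V₀ := owner
  E := fun s t =>
    match s, t with
    | Sum.inl _, Sum.inl _ => True
    | Sum.inr _, Sum.inr _ => True
    | _, _ => False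
  entry_unique := fun e => ⟨Sum.inl (), trivial, by
    rintro (t | t) h
    · rfl
    · exact h.elim⟩
  exit_unique := fun o => ⟨Sum.inr (), trivial, by
    rintro (t | t) h
    · exact h.elim
    · rfl⟩
  prio := fun _ => p

/-! ## Semantics of open parity games -/

section semantics

variable {m n : Obj} (A : OpenParityGame.{u} M m n)

/-- All positions of a game: entry, internal and exit positions. -/
abbrev Position : Type u := (Entries m n ⊕ A.V) ⊕ Exits m n

/-- The end point of an edge, as a position. -/
def toPosition : A.V ⊕ Exits m n → A.Position
  | Sum.inl x => Sum.inl (Sum.inr x)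
  | Sum.inr o => Sum.inr o

/-- A (history-dependent) strategy for the player owning the internal positions in `P`. Here
`move h x` is the move after the positions in the list `h` have been visited, in this order,
followed by `x`. Only its values at positions `x ∈ P` which have a successor matter. -/
structure Strategy (P : Set A.V) where
  move : List (Entries m n ⊕ A.V) → A.V → A.V ⊕ Exits m n
  legal : ∀ h, ∀ x ∈ P, (∃ t, A.E (Sum.inr x) t) → A.E (Sum.inr x) (move h x)

/-- The target of the unique edge out of an entry position. -/
noncomputable def entryTarget (e : Entries m n) : A.V ⊕ Exits m n :=
  (A.entry_unique e).choose

theorem entryTarget_eq_iff (e : Entries m n) (t : A.V ⊕ Exits m n) :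
    A.entryTarget e = t ↔ A.E (Sum.inl e) t :=
  ⟨fun h => h ▸ (A.entry_unique e).choose_spec.1,
    fun h => (A.entry_unique e).unique (A.entry_unique e).choose_spec.1 h⟩

variable {A}

open Classical in
/-- The successor of the last position of `h ++ [s]`, if there is one: the unique successor of
an entry position, and the choice of its owner for an internal position. -/
noncomputable def nextMove (σ₀ : A.Strategy A.V₀) (σ₁ : A.Strategy A.V₀ᶜ)
    (h : List (Entries m n ⊕ A.V)) : Entries m n ⊕ A.V → Option (A.V ⊕ Exits m n)
  | Sum.inl e => some (A.entryTarget e)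
  | Sum.inr x =>
    if ∃ t, A.E (Sum.inr x) t then
      some (if x ∈ A.V₀ then σ₀.move h x else σ₁.move h x)
    else none

/-- The play induced by two strategies from entry `i`: the value at `k` is the `k`-th position
(counted from 0) together with the list of all earlier positions, or `none` if the play has ended
before. -/
noncomputable def playWithHistory (σ₀ : A.Strategy A.V₀) (σ₁ : A.Strategy A.V₀ᶜ)
    (i : Entries m n) : ℕ → Option (List (Entries m n ⊕ A.V) × A.Position)
  | 0 => some ([], Sum.inl (Sum.inl i))
  | k + 1 =>
    (playWithHistory σ₀ σ₁ i k).bind fun hp =>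
      match hp with
      | (_, Sum.inr _) => none
      | (h, Sum.inl s) => (nextMove σ₀ σ₁ h s).map fun t => (h ++ [s], A.toPosition t)

/-- The sequence of positions of the play induced by two strategies from entry `i`. -/
noncomputable def play (σ₀ : A.Strategy A.V₀) (σ₁ : A.Strategy A.V₀ᶜ) (i : Entries m n)
    (k : ℕ) : Option A.Position :=
  (playWithHistory σ₀ σ₁ i k).map Prod.snd

/-- The possible outcomes of a play. -/
inductive Outcome (M : ℕ) (m n : Obj) : Type
  | exit (o : Exits m n) (k : Fin (M + 1))
  | win
  | lose

/-- The `j`-th position of `p` is an internal position of priority `c`. -/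
def HasPriorityAt (p : ℕ → Option A.Position) (j : ℕ) (c : Fin (M + 1)) : Prop :=
  ∃ x : A.V, p j = some (Sum.inl (Sum.inr x)) ∧ A.prio x = c

/-- `p` is infinite, and `c` is the maximal priority that occurs infinitely often. -/
def IsInfiniteWithLimsup (p : ℕ → Option A.Position) (c : Fin (M + 1)) : Prop :=
  (∀ j, p j ≠ none) ∧
    IsGreatest {c' : Fin (M + 1) | ∃ᶠ j in Filter.atTop, HasPriorityAt p j c'} c

/-- `p` is finite and ends at position `q`. -/
def EndsAt (p : ℕ → Option A.Position) (q : A.Position) : Prop :=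
  ∃ j, p j = some q ∧ p (j + 1) = none

/-- The denotation of a play. A play ending at exit `o` denotes `o` and the maximal priority met
(`0` if it meets no internal position). All other plays are won or lost by Player 0: by the
parity condition if they are infinite, and because the owner of the last position is stuck if they
are finite. -/
def Denotes (p : ℕ → Option A.Position) : Outcome M m n → Prop
  | Outcome.exit o k =>
    EndsAt p (Sum.inr o) ∧ IsLUB {c : Fin (M + 1) | ∃ j, HasPriorityAt p j c} k
  | Outcome.win =>
    (∃ x, x ∉ A.V₀ ∧ EndsAt p (Sum.inl (Sum.inr x))) ∨
      ∃ c, IsInfiniteWithLimsup p c ∧ Even (c : ℕ)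
  | Outcome.lose =>
    (∃ x, x ∈ A.V₀ ∧ EndsAt p (Sum.inl (Sum.inr x))) ∨
      ∃ c, IsInfiniteWithLimsup p c ∧ Odd (c : ℕ)

/-- Some strategy of Player 1 beats the strategy `σ₀` from entry `i`. -/
def Loses (i : Entries m n) (σ₀ : A.Strategy A.V₀) : Prop :=
  ∃ σ₁ : A.Strategy A.V₀ᶜ, Denotes (play σ₀ σ₁ i) Outcome.lose

/-- The pairs (exit, maximal priority) which Player 1 can reach against `σ₀` from entry `i`. -/
def denotation (i : Entries m n) (σ₀ : A.Strategy A.V₀) : Set (Exits m n × Fin (M + 1)) :=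
  {ok | ∃ σ₁ : A.Strategy A.V₀ᶜ, Denotes (play σ₀ σ₁ i) (Outcome.exit ok.1 ok.2)}

variable (A)

/-- The semantics of an open parity game. -/
def semantics : Set (Set (Exits m n × Fin (M + 1)) × Entries m n) :=
  {Ti | ∃ σ₀ : A.Strategy A.V₀, ¬ Loses Ti.2 σ₀ ∧ denotation Ti.2 σ₀ ⊆ Ti.1}

variable {A}

/-- Two games with the same domain and codomain are equivalent if they have the same semantics. -/
def Equivalent (A : OpenParityGame.{u} M m n) (B : OpenParityGame.{v} M m n) : Prop :=
  A.semantics = B.semantics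

end semantics

end OpenParityGame

/-! ## Diagrams -/

/-- The two generating objects `▶` and `◀`. -/
inductive Dir : Type
  | right
  | left

/-- The interpretation of a generating object. -/
def Dir.obj : Dir → Obj
  | Dir.right => (1, 0)
  | Dir.left => (0, 1)

/-- The interpretation of a word of generating objects. -/
def interp : List Dir → Obj
  | [] => 0
  | d :: w => d.obj + interp w

theorem interp_append (w w' : List Dir) : interp (w ++ w') = interp w + interp w' := by
  induction w with
  | nil => simp [interp]
  | cons d w ih => simp [interp, ih, add_assoc]

/-- Every object is the interpretation of some word, and `▶ⁿ` is interpreted as `(n, 0)`. -/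
theorem interp_replicate (a b : ℕ) :
    interp (List.replicate a Dir.right ++ List.replicate b Dir.left) = (a, b) := by
  have h1 : ∀ a, interp (List.replicate a Dir.right) = (a, 0) := by
    intro a
    induction a with
    | zero => rfl
    | succ a ih => simp [List.replicate_succ, interp, ih, Dir.obj, add_comm]
  have h2 : ∀ a, interp (List.replicate a Dir.left) = (0, a) := by
    intro a
    induction a with
    | zero => rfl
    | succ a ih => simp [List.replicate_succ, interp, ih, Dir.obj, add_comm]
  simp [interp_append, h1, h2]

/-- The generating morphisms. -/
inductive Generator (M : ℕ) : List Dir → List Dir → Type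
  | player0 : Generator M [Dir.right] [Dir.right, Dir.right]
  | lose0 : Generator M [Dir.right] []
  | player1 : Generator M [Dir.right] [Dir.right, Dir.right]
  | lose1 : Generator M [Dir.right] []
  | merge : Generator M [Dir.right, Dir.right] [Dir.right]
  | start : Generator M [] [Dir.right]
  | priority (p : Fin (M + 1)) : Generator M [Dir.right] [Dir.right]
  | cap : Generator M [Dir.left, Dir.right] []
  | cup : Generator M [] [Dir.right, Dir.left]

/-- Diagrams, as terms for the morphisms of the free prop on the generators. -/
inductive Diagram (M : ℕ) : List Dir → List Dir → Type
  | gen {v w : List Dir} (g : Generator M v w) : Diagram M v w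
  | id (w : List Dir) : Diagram M w w
  | swap (v w : List Dir) : Diagram M (v ++ w) (w ++ v)
  | comp {u v w : List Dir} (c : Diagram M u v) (d : Diagram M v w) : Diagram M u w
  | tensor {v₁ w₁ v₂ w₂ : List Dir} (c : Diagram M v₁ w₁) (d : Diagram M v₂ w₂) :
      Diagram M (v₁ ++ v₂) (w₁ ++ w₂)

open OpenParityGame in
/-- The interpretation of the generators. -/
def Generator.sem {M : ℕ} : {v w : List Dir} → Generator M v w →
    OpenParityGame.{0} M (interp v) (interp w)
  | _, _, player0 => node Set.univ 0 1 2
  | _, _, lose0 => node Set.univ 0 1 0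
  | _, _, player1 => node ∅ 0 1 2
  | _, _, lose1 => node ∅ 0 1 0
  | _, _, merge => node ∅ 0 2 1
  | _, _, start => node ∅ 0 0 1
  | _, _, priority p => node ∅ p 1 1
  | _, _, cap => wiring M (m := (1, 1)) (n := (0, 0)) (Equiv.refl (Fin 1 ⊕ Fin 0))
  | _, _, cup => wiring M (m := (0, 0)) (n := (1, 1)) (Equiv.refl (Fin 0 ⊕ Fin 1))

/-- The interpretation of a diagram as an open parity game. -/
def Diagram.sem {M : ℕ} : {v w : List Dir} → Diagram M v w →
    OpenParityGame.{0} M (interp v) (interp w)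
  | _, _, gen g => g.sem
  | _, _, id w => OpenParityGame.idGame M (interp w)
  | _, _, swap v w =>
    (OpenParityGame.swapGame M (interp v) (interp w)).cast
      (interp_append v w).symm (interp_append w v).symm
  | _, _, comp c d => c.sem.comp d.sem
  | _, _, @tensor _ v₁ w₁ v₂ w₂ c d =>
    (c.sem.tensor d.sem).cast (interp_append v₁ v₂).symm (interp_append w₁ w₂).symm

end ParityGames

open ParityGames

/-! The proof has a game-theoretic half and a graph-theoretic half, which meet in the expansion of
`A`.

In the expansion every internal position `x` becomes a chain: a start, one merge per incoming edge,
a position carrying the priority of `x`, one binary choice per outgoing edge, and a losing position.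
The choices and the losing position belong to the owner of `x`. Walking along the choices amounts to
choosing an outgoing edge; an owner who declines all of them is stuck and loses, which happens at
once if `x` has no successor. The added positions have priority 0, which affects neither a maximum
nor whether a limit superior is odd, and chains are finite, so no infinite play avoids the priority
positions forever. Hence `expansion_equivalent`. Both inclusions transfer strategy trees, that is,
sets of configurations closed under all moves of Player 1 and under some move of Player 0; by
`exists_isStrategyTree` and `IsStrategyTree.mem_semantics` such trees determine the semantics.

In the expansion every port carries exactly one edge, so the edges form a bijection from output
ports to input ports, and every position has the shape of a generator. The second half shows that
each such net is, up to renaming of positions, the interpretation of a diagram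
(`Diagram.realizable_net`). Cups allow wires to be bent (`Diagram.exists_bend`), so that the net may
be assumed to have empty codomain and each generator empty domain. Positions are then plugged in one
at a time (`Diagram.exists_plug`), the ports of the removed position becoming part of the domain of
a smaller net. A net without positions and with empty codomain is a bijection from the left-to-right
to the right-to-left wires of its domain, and symmetries and caps realise it
(`Diagram.isMatching_of_injective`). Edges of composites are defined by paths through hidden wires;
`comp_E_iff` computes them once the final target of every hidden wire has been named.

Since isomorphic games are equivalent (`Iso.equivalent`), the diagram obtained for the expansion
also serves `A`. -/

namespace ParityGames

namespace OpenParityGame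

variable {M : ℕ} {m n : Obj}

/-! ## Strategy trees -/

/-- The list of the first `n` values of `ρ`, the most recent one first. -/
def prefixRev {α : Type*} (ρ : ℕ → α) : ℕ → List α
  | 0 => []
  | n + 1 => ρ n :: prefixRev ρ n

theorem length_prefixRev {α : Type*} (ρ : ℕ → α) (n : ℕ) : (prefixRev ρ n).length = n := by
  induction n with
  | zero => rfl
  | succ n ih => simp [prefixRev, ih]

/-- The maximal value taken infinitely often is odd. -/
def OddLimsup (q : ℕ → Fin (M + 1)) : Prop :=
  ∃ c, IsGreatest {c | ∃ᶠ n in Filter.atTop, q n = c} c ∧ Odd (c : ℕ)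

/-- The priority of a position, where entry positions are given priority `0`. -/
def srcPrio (A : OpenParityGame.{u} M m n) : Entries m n ⊕ A.V → Fin (M + 1) :=
  Sum.elim (fun _ => 0) A.prio

/-- The maximal priority met in a history. -/
def maxPrio (A : OpenParityGame.{u} M m n) (h : List (Entries m n ⊕ A.V)) : Fin (M + 1) :=
  h.foldr (fun s k => max (A.srcPrio s) k) 0

/-- A set of configurations (a reversed history together with the current position) which
describes a nondeterministic strategy of Player 0 that is winning from `i` with target `T`. -/
structure IsStrategyTree (A : OpenParityGame.{u} M m n) (T : Set (Exits m n × Fin (M + 1)))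
    (i : Entries m n) (S : Set (List (Entries m n ⊕ A.V) × A.Position)) : Prop where
  init : ([], Sum.inl (Sum.inl i)) ∈ S
  entry : ∀ {h e t}, (h, Sum.inl (Sum.inl e)) ∈ S → A.E (Sum.inl e) t →
    (Sum.inl e :: h, A.toPosition t) ∈ S
  zero : ∀ {h x}, (h, Sum.inl (Sum.inr x)) ∈ S → x ∈ A.V₀ →
    ∃ t, A.E (Sum.inr x) t ∧ (Sum.inr x :: h, A.toPosition t) ∈ S
  one : ∀ {h x t}, (h, Sum.inl (Sum.inr x)) ∈ S → x ∉ A.V₀ → A.E (Sum.inr x) t →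
    (Sum.inr x :: h, A.toPosition t) ∈ S
  exit : ∀ {h o}, (h, Sum.inr o) ∈ S → (o, A.maxPrio h) ∈ T
  inf : ∀ ρ : ℕ → Entries m n ⊕ A.V, (∀ k, (prefixRev ρ k, Sum.inl (ρ k)) ∈ S) →
    (∀ k, ∃ t, A.E (ρ k) t ∧ Sum.inl (ρ (k + 1)) = A.toPosition t) →
    ¬ OddLimsup (fun k => A.srcPrio (ρ k))

section

variable {A : OpenParityGame.{u} M m n}

theorem toPosition_injective : Function.Injective A.toPosition := by
  rintro (a | a) (b | b) h <;> simp_all [toPosition]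

/-- Entries and the empty history contribute 0, the bottom of `Fin (M + 1)`, so the fold agrees with
the least upper bound used in `Denotes`. -/
theorem isLUB_maxPrio (h : List (Entries m n ⊕ A.V)) :
    IsLUB {c : Fin (M + 1) | ∃ x : A.V, Sum.inr x ∈ h ∧ A.prio x = c} (A.maxPrio h) := by
  induction h with
  | nil =>
    refine ⟨?_, fun c _ => Fin.zero_le c⟩
    rintro c ⟨x, hx, -⟩
    simp at hx
  | cons s h ih =>
    change IsLUB _ (max (A.srcPrio s) (A.maxPrio h))
    constructor
    · rintro c ⟨x, hx, rfl⟩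
      rcases List.mem_cons.1 hx with rfl | hx
      · exact le_max_left _ _
      · exact le_max_of_le_right (ih.1 ⟨x, hx, rfl⟩)
    · intro c hc
      refine max_le ?_ (ih.2 ?_)
      · rcases s with e | x
        · exact Fin.zero_le c
        · exact hc ⟨x, List.mem_cons_self, rfl⟩
      · rintro d ⟨x, hx, rfl⟩
        exact hc ⟨x, List.mem_cons_of_mem _ hx, rfl⟩

/-- Plays store their history forwards, configurations backwards; this lets the maximum pass from
one to the other. -/
theorem maxPrio_congr_mem {h h' : List (Entries m n ⊕ A.V)} (H : ∀ s, s ∈ h ↔ s ∈ h') :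
    A.maxPrio h = A.maxPrio h' := by
  refine (isLUB_maxPrio h).unique ?_
  simpa only [H] using isLUB_maxPrio h'

/-! ### Plays and their histories -/

variable (σ₀ : A.Strategy A.V₀) (σ₁ : A.Strategy A.V₀ᶜ) (i : Entries m n)

theorem playWithHistory_succ_none {k : ℕ} (hk : playWithHistory σ₀ σ₁ i k = none) :
    playWithHistory σ₀ σ₁ i (k + 1) = none := by
  simp [playWithHistory, hk]

theorem playWithHistory_succ_exit {k : ℕ} {h o}
    (hk : playWithHistory σ₀ σ₁ i k = some (h, Sum.inr o)) :
    playWithHistory σ₀ σ₁ i (k + 1) = none := by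
  simp [playWithHistory, hk]

theorem playWithHistory_succ {k : ℕ} {h s}
    (hk : playWithHistory σ₀ σ₁ i k = some (h, Sum.inl s)) :
    playWithHistory σ₀ σ₁ i (k + 1) =
      (nextMove σ₀ σ₁ h s).map fun t => (h ++ [s], A.toPosition t) := by
  simp [playWithHistory, hk]

theorem playWithHistory_none_of_le {k l : ℕ} (hkl : k ≤ l)
    (hk : playWithHistory σ₀ σ₁ i k = none) : playWithHistory σ₀ σ₁ i l = none := by
  induction hkl with
  | refl => exact hk
  | step _ ih => exact playWithHistory_succ_none _ _ _ ih

theorem playWithHistory_succ_eq_some {k : ℕ} {h p}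
    (hk : playWithHistory σ₀ σ₁ i (k + 1) = some (h, p)) :
    ∃ h' s t, playWithHistory σ₀ σ₁ i k = some (h', Sum.inl s) ∧
      nextMove σ₀ σ₁ h' s = some t ∧ h = h' ++ [s] ∧ p = A.toPosition t := by
  rcases hq : playWithHistory σ₀ σ₁ i k with _ | ⟨h', s | o⟩
  · rw [playWithHistory_succ_none _ _ _ hq] at hk
    simp at hk
  · rw [playWithHistory_succ _ _ _ hq] at hk
    obtain ⟨t, ht, heq⟩ := Option.map_eq_some_iff.1 hk
    simp only [Prod.mk.injEq] at heq
    exact ⟨h', s, t, rfl, ht, heq.1.symm, heq.2.symm⟩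
  · rw [playWithHistory_succ_exit _ _ _ hq] at hk
    simp at hk

theorem mem_history_iff {k : ℕ} : ∀ {h p}, playWithHistory σ₀ σ₁ i k = some (h, p) →
    ∀ s, s ∈ h ↔ ∃ j < k, play σ₀ σ₁ i j = some (Sum.inl s) := by
  induction k with
  | zero =>
    intro h p hk s
    simp only [playWithHistory, Option.some.injEq, Prod.mk.injEq] at hk
    simp [← hk.1]
  | succ k ih =>
    intro h p hk s
    obtain ⟨h', s', t, hk', -, rfl, -⟩ := playWithHistory_succ_eq_some _ _ _ hk
    rw [List.mem_append, ih hk', List.mem_singleton]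
    have hp : play σ₀ σ₁ i k = some (Sum.inl s') := by simp [play, hk']
    constructor
    · rintro (⟨j, hj, h1⟩ | rfl)
      · exact ⟨j, by omega, h1⟩
      · exact ⟨k, by omega, hp⟩
    · rintro ⟨j, hj, h1⟩
      rcases Nat.lt_succ_iff_lt_or_eq.1 hj with hj | rfl
      · exact Or.inl ⟨j, hj, h1⟩
      · rw [hp] at h1
        simp only [Option.some.injEq, Sum.inl.injEq] at h1
        exact Or.inr h1.symm

/-- An exit is the last position of a play, so the history attached to it already contains every
priority met. -/
theorem denotes_exit_iff (o : Exits m n) (c : Fin (M + 1)) :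
    Denotes (play σ₀ σ₁ i) (Outcome.exit o c) ↔
      ∃ k h, playWithHistory σ₀ σ₁ i k = some (h, Sum.inr o) ∧ c = A.maxPrio h := by
  have key : ∀ k h, playWithHistory σ₀ σ₁ i k = some (h, Sum.inr o) →
      {c : Fin (M + 1) | ∃ j, HasPriorityAt (play σ₀ σ₁ i) j c} =
        {c : Fin (M + 1) | ∃ x : A.V, Sum.inr x ∈ h ∧ A.prio x = c} := by
    intro k h hk
    -- At time `k` the play is at an exit, and afterwards it is over.
    have hlt : ∀ j s, play σ₀ σ₁ i j = some (Sum.inl s) → j < k := by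
      intro j s hj
      by_contra hkj
      rcases Nat.lt_or_eq_of_le (not_lt.1 hkj) with hlt | rfl
      · have := playWithHistory_none_of_le _ _ _ (Nat.succ_le_of_lt hlt)
          (playWithHistory_succ_exit _ _ _ hk)
        simp [play, this] at hj
      · simp [play, hk] at hj
    ext c
    constructor
    · rintro ⟨j, x, hj, hx⟩
      exact ⟨x, (mem_history_iff _ _ _ hk _).2 ⟨j, hlt _ _ hj, hj⟩, hx⟩
    · rintro ⟨x, hx, hc⟩
      obtain ⟨j, -, hj⟩ := (mem_history_iff _ _ _ hk _).1 hx
      exact ⟨j, x, hj, hc⟩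
  constructor
  · rintro ⟨⟨k, hk, -⟩, hc⟩
    obtain ⟨⟨h, p⟩, hk, rfl⟩ := Option.map_eq_some_iff.1 hk
    refine ⟨k, h, hk, ?_⟩
    rw [key k h hk] at hc
    exact hc.unique (isLUB_maxPrio h)
  · rintro ⟨k, h, hk, rfl⟩
    refine ⟨⟨k, by simp [play, hk], ?_⟩, ?_⟩
    · simp [play, playWithHistory_succ_exit _ _ _ hk]
    · rw [key k h hk]
      exact isLUB_maxPrio h

theorem nextMove_eq_none_iff (h) (s) :
    nextMove σ₀ σ₁ h s = none ↔ ∃ x, s = Sum.inr x ∧ ¬ ∃ t, A.E (Sum.inr x) t := by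
  rcases s with e | x
  · simp [nextMove]
  · by_cases hx : ∃ t, A.E (Sum.inr x) t
    · simp only [nextMove, if_pos hx, reduceCtorEq, false_iff]
      rintro ⟨y, hy, hn⟩
      cases hy
      exact hn hx
    · simp only [nextMove, if_neg hx, true_iff]
      exact ⟨x, rfl, hx⟩

theorem nextMove_legal {h s t} (hn : nextMove σ₀ σ₁ h s = some t) : A.E s t := by
  classical
  rcases s with e | x
  · simp only [nextMove, Option.some.injEq] at hn
    exact (A.entryTarget_eq_iff e t).1 hn
  · by_cases hx : ∃ t, A.E (Sum.inr x) t
    · simp only [nextMove, if_pos hx, Option.some.injEq] at hn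
      split_ifs at hn with h0
      · exact hn ▸ σ₀.legal h x h0 hx
      · exact hn ▸ σ₁.legal h x h0 hx
    · simp only [nextMove, if_neg hx, reduceCtorEq] at hn

/-- An infinite play seen as a sequence of positions. -/
theorem exists_run_of_infinite (hinf : ∀ k, play σ₀ σ₁ i k ≠ none) :
    ∃ ρ : ℕ → Entries m n ⊕ A.V, ∀ k,
      playWithHistory σ₀ σ₁ i k = some ((prefixRev ρ k).reverse, Sum.inl (ρ k)) := by
  have h1 : ∀ k, ∃ s h, playWithHistory σ₀ σ₁ i k = some (h, Sum.inl s) := by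
    intro k
    rcases hq : playWithHistory σ₀ σ₁ i k with _ | ⟨h', s | o⟩
    · exact absurd (by simp [play, hq]) (hinf k)
    · exact ⟨s, h', rfl⟩
    · exact absurd (by simp [play, playWithHistory_succ_exit _ _ _ hq]) (hinf (k + 1))
  choose ρ hist hρ using h1
  have h2 : ∀ k, hist k = (prefixRev ρ k).reverse := by
    intro k
    induction k with
    | zero =>
      have := hρ 0
      simp only [playWithHistory, Option.some.injEq, Prod.mk.injEq] at this
      simp [← this.1, prefixRev]
    | succ k ih =>
      obtain ⟨h', s, t, hk, -, h3, -⟩ := playWithHistory_succ_eq_some _ _ _ (hρ (k + 1))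
      rw [hρ k] at hk
      simp only [Option.some.injEq, Prod.mk.injEq, Sum.inl.injEq] at hk
      simp [prefixRev, h3, ← hk.1, ← hk.2, ih]
  exact ⟨ρ, fun k => by rw [hρ k, h2 k]⟩

theorem ne_zero_of_odd {c : Fin (M + 1)} (hc : Odd (c : ℕ)) : c ≠ 0 := by
  rintro rfl
  simp at hc

/-- `srcPrio` also gives entries a priority, namely 0. This is harmless: an odd priority is nonzero,
and 0 lies below every candidate for the maximum. -/
theorem isInfiniteWithLimsup_odd_iff {ρ : ℕ → Entries m n ⊕ A.V}
    (hρ : ∀ k, playWithHistory σ₀ σ₁ i k = some ((prefixRev ρ k).reverse, Sum.inl (ρ k))) :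
    (∃ c, IsInfiniteWithLimsup (play σ₀ σ₁ i) c ∧ Odd (c : ℕ)) ↔
      OddLimsup (fun k => A.srcPrio (ρ k)) := by
  have hp : ∀ k, play σ₀ σ₁ i k = some (Sum.inl (ρ k)) := fun k => by simp [play, hρ k]
  have h1 : ∀ k c, HasPriorityAt (play σ₀ σ₁ i) k c → A.srcPrio (ρ k) = c := by
    rintro k c ⟨x, hx, rfl⟩
    rw [hp k] at hx
    simp only [Option.some.injEq, Sum.inl.injEq] at hx
    rw [hx]
    rfl
  have h2 : ∀ k c, c ≠ 0 → A.srcPrio (ρ k) = c → HasPriorityAt (play σ₀ σ₁ i) k c := by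
    rintro k c hc rfl
    rcases hs : ρ k with e | x
    · simp [hs, srcPrio] at hc
    · exact ⟨x, by rw [hp k, hs], rfl⟩
  constructor
  · rintro ⟨c, ⟨-, hc1, hc2⟩, hc⟩
    refine ⟨c, ⟨hc1.mono fun k => h1 k c, fun c' hc' => ?_⟩, hc⟩
    by_cases h0 : c' = 0
    · exact h0 ▸ Fin.zero_le c
    · exact hc2 (Filter.Frequently.mono hc' fun k => h2 k c' h0)
  · rintro ⟨c, ⟨hc1, hc2⟩, hc⟩
    refine ⟨c, ⟨fun k => by simp [hp k], hc1.mono fun k => h2 k c (ne_zero_of_odd hc),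
      fun c' hc' => hc2 (Filter.Frequently.mono hc' fun k => h1 k c')⟩, hc⟩

/-! ### From a strategy of Player 0 to a strategy tree -/

/-- The configurations which can be reached against the strategy `σ₀`. -/
def Reach : List (Entries m n ⊕ A.V) → A.Position → Prop
  | [], p => p = Sum.inl (Sum.inl i)
  | s :: h, p => Reach h (Sum.inl s) ∧ ∃ t, A.E s t ∧ p = A.toPosition t ∧
      ∀ x ∈ A.V₀, s = Sum.inr x → t = σ₀.move h.reverse x

open Classical in
/-- The strategy of Player 1 which stays inside a given set of configurations. -/
noncomputable def follow (C : Set (List (Entries m n ⊕ A.V) × A.Position)) :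
    A.Strategy A.V₀ᶜ where
  move h x :=
    -- Strategies read histories forwards, hence the reversal. The final default `Sum.inl x` is used
    -- only where `x` has no successor, and there legality asks nothing.
    if hC : ∃ t, A.E (Sum.inr x) t ∧ (Sum.inr x :: h.reverse, A.toPosition t) ∈ C then hC.choose
    else if ht : ∃ t, A.E (Sum.inr x) t then ht.choose else Sum.inl x
  legal h x _ ht := by
    split_ifs with hC
    · exact hC.choose_spec.1
    · exact ht.choose_spec

/-- The set `C` is a single branch: it has at most one position per history and contains all
predecessors. Along it Player 0's moves are forced by `Reach`, Player 1's by uniqueness of the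
position. -/
theorem playWithHistory_follow (C : Set (List (Entries m n ⊕ A.V) × A.Position))
    (hreach : ∀ h p, (h, p) ∈ C → Reach σ₀ i h p)
    (hfun : ∀ h p p', (h, p) ∈ C → (h, p') ∈ C → p = p')
    (hsuf : ∀ s h p, (s :: h, p) ∈ C → (h, Sum.inl s) ∈ C) :
    ∀ h p, (h, p) ∈ C → playWithHistory σ₀ (follow C) i h.length = some (h.reverse, p) := by
  classical
  intro h
  induction h with
  | nil =>
    intro p hp
    have : p = _ := hreach _ _ hp
    simp [playWithHistory, this]
  | cons s h ih =>
    intro p hp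
    obtain ⟨-, t, ht, rfl, hmove⟩ := hreach _ _ hp
    have h1 := ih _ (hsuf _ _ _ hp)
    rw [List.length_cons, playWithHistory_succ _ _ _ h1]
    have h2 : nextMove σ₀ (follow C) h.reverse s = some t := by
      rcases s with e | x
      · exact congrArg some ((A.entryTarget_eq_iff e t).2 ht)
      · have hx : ∃ t, A.E (Sum.inr x) t := ⟨t, ht⟩
        simp only [nextMove, if_pos hx, Option.some.injEq]
        split_ifs with h0
        · exact (hmove x h0 rfl).symm
        · have hC : ∃ t, A.E (Sum.inr x) t ∧
              (Sum.inr x :: h.reverse.reverse, A.toPosition t) ∈ C :=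
            ⟨t, ht, by rwa [List.reverse_reverse]⟩
          simp only [follow, dif_pos hC]
          refine toPosition_injective (hfun _ _ _ hC.choose_spec.2 ?_)
          rwa [List.reverse_reverse]
    simp [h2]

theorem Reach.suffix {g h : List (Entries m n ⊕ A.V)} {s} {p} (hr : Reach σ₀ i h p)
    (hs : (s :: g) <:+ h) : Reach σ₀ i g (Sum.inl s) := by
  induction h generalizing p with
  | nil => simp at hs
  | cons a h ih =>
    rcases List.suffix_cons_iff.1 hs with heq | hs
    · cases heq
      exact hr.1
    · exact ih hr.1 hs

/-- The branch consists of the configuration and its predecessors. Two of its histories of equal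
length are suffixes of the same list, hence equal. -/
theorem Reach.exists_play {h p} (hr : Reach σ₀ i h p) :
    ∃ σ₁ : A.Strategy A.V₀ᶜ, playWithHistory σ₀ σ₁ i h.length = some (h.reverse, p) := by
  refine ⟨follow {c | c = (h, p) ∨ ∃ s, c.2 = Sum.inl s ∧ (s :: c.1) <:+ h},
    playWithHistory_follow σ₀ i _ ?_ ?_ ?_ _ _ (Or.inl rfl)⟩
  · rintro h' p' (heq | ⟨s, rfl, hs⟩)
    · cases heq
      exact hr
    · exact hr.suffix _ _ hs
  · rintro h' p' p'' (heq | ⟨s, rfl, hs⟩) (heq' | ⟨s', rfl, hs'⟩)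
    · cases heq
      cases heq'
      rfl
    · cases heq
      simpa using hs'.length_le
    · cases heq'
      simpa using hs.length_le
    · have := (List.suffix_of_suffix_length_le hs hs' (by simp)).eq_of_length (by simp)
      simp only [List.cons.injEq, and_true] at this
      rw [this]
  · rintro s h' p' (heq | ⟨s', rfl, hs⟩)
    · cases heq
      exact Or.inr ⟨s, rfl, List.suffix_refl _⟩
    · exact Or.inr ⟨s, rfl, (List.suffix_cons _ _).trans hs⟩

/-- The infinite branch is followed by one strategy of Player 1, since histories of different
lengths never compete for the same move. -/
theorem exists_play_of_run (ρ : ℕ → Entries m n ⊕ A.V)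
    (hr : ∀ k, Reach σ₀ i (prefixRev ρ k) (Sum.inl (ρ k))) :
    ∃ σ₁ : A.Strategy A.V₀ᶜ, ∀ k,
      playWithHistory σ₀ σ₁ i k = some ((prefixRev ρ k).reverse, Sum.inl (ρ k)) := by
  refine ⟨follow {c | ∃ k, c = (prefixRev ρ k, Sum.inl (ρ k))}, fun k => ?_⟩
  have := playWithHistory_follow σ₀ i {c | ∃ k, c = (prefixRev ρ k, Sum.inl (ρ k))} ?_ ?_ ?_
    (prefixRev ρ k) _ ⟨k, rfl⟩
  · rwa [length_prefixRev] at this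
  · rintro h p ⟨k, heq⟩
    cases heq
    exact hr k
  · rintro h p p' ⟨k, heq⟩ ⟨k', heq'⟩
    simp only [Prod.mk.injEq] at heq heq'
    have : k = k' := by
      rw [← length_prefixRev ρ k, ← length_prefixRev ρ k', ← heq.1, ← heq'.1]
    rw [heq.2, heq'.2, this]
  · rintro s h p ⟨k, heq⟩
    rcases k with _ | k
    · simp [prefixRev] at heq
    · simp only [prefixRev, Prod.mk.injEq, List.cons.injEq] at heq
      exact ⟨k, by rw [heq.1.1, heq.1.2]⟩

/-- Every reachable configuration and every infinite run of such configurations is realised by some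
strategy of Player 1. A violation of a tree condition therefore becomes a play lost by Player 0 or a
denoted pair outside `T`. -/
theorem isStrategyTree_reach {T : Set (Exits m n × Fin (M + 1))} (hl : ¬ Loses i σ₀)
    (hT : denotation i σ₀ ⊆ T) : IsStrategyTree A T i {c | Reach σ₀ i c.1 c.2} where
  init := rfl
  entry := fun h1 h2 => ⟨h1, _, h2, rfl, fun x _ h => by simp at h⟩
  zero := by
    classical
    intro h x hr hx
    by_cases ht : ∃ t, A.E (Sum.inr x) t
    · refine ⟨_, σ₀.legal h.reverse x hx ht, hr, _, σ₀.legal h.reverse x hx ht, rfl, ?_⟩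
      intro y _ hy
      cases hy
      rfl
    -- If Player 0 were stuck here, the strategy of Player 1 leading to this configuration would
    -- beat `σ₀`.
    · obtain ⟨σ₁, h1⟩ := hr.exists_play
      refine absurd ⟨σ₁, Or.inl ⟨x, hx, h.length, by simp [play, h1], ?_⟩⟩ hl
      simp [play, playWithHistory_succ _ _ _ h1,
        (nextMove_eq_none_iff σ₀ σ₁ h.reverse (Sum.inr x)).2 ⟨x, rfl, ht⟩]
  one := fun h1 h2 h3 => ⟨h1, _, h3, rfl, fun y hy heq => by
    cases heq
    exact absurd hy h2⟩
  exit := by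
    intro h o hr
    obtain ⟨σ₁, h1⟩ := hr.exists_play
    exact hT ⟨σ₁, (denotes_exit_iff _ _ _ _ _).2
      ⟨_, _, h1, maxPrio_congr_mem fun s => List.mem_reverse.symm⟩⟩
  inf := by
    intro ρ hr _ hodd
    obtain ⟨σ₁, h1⟩ := exists_play_of_run σ₀ i ρ hr
    exact hl ⟨σ₁, Or.inr ((isInfiniteWithLimsup_odd_iff _ _ _ h1).2 hodd)⟩

end

/-! ### From a strategy tree to a strategy of Player 0 -/

open Classical in
/-- The strategy of Player 0 which stays inside a given set of configurations. -/
noncomputable def stay {A : OpenParityGame.{u} M m n}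
    (C : Set (List (Entries m n ⊕ A.V) × A.Position)) : A.Strategy A.V₀ where
  move h x :=
    if hC : ∃ t, A.E (Sum.inr x) t ∧ (Sum.inr x :: h.reverse, A.toPosition t) ∈ C then hC.choose
    else if ht : ∃ t, A.E (Sum.inr x) t then ht.choose else Sum.inl x
  legal h x _ ht := by
    split_ifs with hC
    · exact hC.choose_spec.1
    · exact ht.choose_spec

theorem IsStrategyTree.mem_of_play {A : OpenParityGame.{u} M m n}
    {T : Set (Exits m n × Fin (M + 1))} {i : Entries m n} {S} (hS : IsStrategyTree A T i S)
    (σ₁ : A.Strategy A.V₀ᶜ) (k : ℕ) : ∀ h p,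
    playWithHistory (stay S) σ₁ i k = some (h, p) → (h.reverse, p) ∈ S := by
  classical
  induction k with
  | zero =>
    intro h p hk
    simp only [playWithHistory, Option.some.injEq, Prod.mk.injEq] at hk
    rw [← hk.1, ← hk.2]
    exact hS.init
  | succ k ih =>
    intro h p hk
    obtain ⟨h', s, t, hk', hn, rfl, rfl⟩ := playWithHistory_succ_eq_some _ _ _ hk
    have h1 := ih _ _ hk'
    have h2 := nextMove_legal _ _ hn
    rw [List.reverse_append, List.reverse_singleton, List.singleton_append]
    rcases s with e | x
    · exact hS.entry h1 h2
    · by_cases hx : x ∈ A.V₀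
      · have hC := hS.zero h1 hx
        simp only [nextMove, if_pos (⟨t, h2⟩ : ∃ t, A.E (Sum.inr x) t), if_pos hx,
          Option.some.injEq, stay, dif_pos hC] at hn
        rw [← hn]
        exact hC.choose_spec.2
      · exact hS.one h1 hx h2

/-- A tree may allow Player 0 several moves; `stay` picks one of them. All plays then remain in the
tree, whose conditions exclude each way of losing and bound the denotation. -/
theorem IsStrategyTree.mem_semantics {A : OpenParityGame.{u} M m n}
    {T : Set (Exits m n × Fin (M + 1))} {i : Entries m n} {S} (hS : IsStrategyTree A T i S) :
    (T, i) ∈ A.semantics := by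
  refine ⟨stay S, ?_, ?_⟩
  · rintro ⟨σ₁, ⟨x, hx, k, hk, hk'⟩ | hinf⟩
    · obtain ⟨⟨h, p⟩, hk, rfl⟩ := Option.map_eq_some_iff.1 hk
      obtain ⟨t, ht, -⟩ := hS.zero (hS.mem_of_play σ₁ k _ _ hk) hx
      simp only [play, Option.map_eq_none_iff, playWithHistory_succ _ _ _ hk,
        nextMove_eq_none_iff] at hk'
      obtain ⟨y, hy, hy'⟩ := hk'
      cases hy
      exact hy' ⟨t, ht⟩
    · have hinf' := hinf
      obtain ⟨c, ⟨h1, -⟩, -⟩ := hinf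
      obtain ⟨ρ, hρ⟩ := exists_run_of_infinite _ _ _ h1
      refine hS.inf ρ (fun k => ?_) (fun k => ?_) ((isInfiniteWithLimsup_odd_iff _ _ _ hρ).1 hinf')
      · simpa using hS.mem_of_play σ₁ k _ _ (hρ k)
      · obtain ⟨h', s, t, hk, hn, -, ht⟩ := playWithHistory_succ_eq_some _ _ _ (hρ (k + 1))
        rw [hρ k] at hk
        cases hk
        exact ⟨t, nextMove_legal _ _ hn, ht⟩
  · rintro ⟨o, c⟩ ⟨σ₁, h1⟩
    obtain ⟨k, h, hk, rfl⟩ := (denotes_exit_iff _ _ _ _ _).1 h1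
    have := hS.exit (hS.mem_of_play σ₁ k _ _ hk)
    rwa [maxPrio_congr_mem fun s => List.mem_reverse] at this

/-- The extra clause, closure under predecessors, is not part of `IsStrategyTree`; it is needed when
a run has to be recovered from its histories. -/
theorem exists_isStrategyTree {A : OpenParityGame.{u} M m n}
    {T : Set (Exits m n × Fin (M + 1))} {i : Entries m n} (h : (T, i) ∈ A.semantics) :
    ∃ S, IsStrategyTree A T i S ∧ ∀ s h p, (s :: h, p) ∈ S →
      (h, Sum.inl s) ∈ S ∧ ∃ t, A.E s t ∧ p = A.toPosition t := by
  obtain ⟨σ₀, hl, hT⟩ := h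
  exact ⟨_, isStrategyTree_reach σ₀ i hl hT,
    fun s h p hr => ⟨hr.1, hr.2.choose, hr.2.choose_spec.1, hr.2.choose_spec.2.1⟩⟩

/-! ## Isomorphic games -/

/-- Two games with the same interface are isomorphic if they agree up to renaming of internal
positions. -/
def Iso (A : OpenParityGame.{u} M m n) (B : OpenParityGame.{v} M m n) : Prop :=
  ∃ φ : A.V ≃ B.V, (∀ x, x ∈ A.V₀ ↔ φ x ∈ B.V₀) ∧ (∀ x, A.prio x = B.prio (φ x)) ∧
    ∀ s t, A.E s t ↔ B.E (Sum.map id φ s) (Sum.map φ id t)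

theorem Iso.symm {A : OpenParityGame.{u} M m n} {B : OpenParityGame.{v} M m n} (h : Iso A B) :
    Iso B A := by
  obtain ⟨φ, h1, h2, h3⟩ := h
  refine ⟨φ.symm, fun x => by simp [h1], fun x => by simp [h2], fun s t => ?_⟩
  rw [h3]
  simp [Sum.map_map]

theorem prefixRev_map {α β : Type*} (f : α → β) (ρ : ℕ → α) (k : ℕ) :
    (prefixRev ρ k).map f = prefixRev (fun j => f (ρ j)) k := by
  induction k with
  | zero => rfl
  | succ k ih => simp [prefixRev, ih]

/-- A strategy tree of `B` is pulled back along the renaming of histories and positions, hence the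
reversed direction of the inclusion. -/
theorem Iso.semantics_subset {A : OpenParityGame.{u} M m n} {B : OpenParityGame.{v} M m n}
    (h : Iso A B) : B.semantics ⊆ A.semantics := by
  obtain ⟨φ, h1, h2, h3⟩ := h
  rintro ⟨T, i⟩ hT
  obtain ⟨S, hS, -⟩ := exists_isStrategyTree hT
  have hpos : ∀ t, B.toPosition (Sum.map φ id t) =
      Sum.map (Sum.map id φ) id (A.toPosition t) := by
    rintro (t | t) <;> rfl
  have hprio : ∀ s, A.srcPrio s = B.srcPrio (Sum.map id φ s) := by
    rintro (s | s)
    · rfl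
    · exact h2 s
  have hmax : ∀ h, A.maxPrio h = B.maxPrio (h.map (Sum.map id φ)) := by
    intro h
    induction h with
    | nil => rfl
    | cons s h ih =>
      change max _ (A.maxPrio h) = max _ (B.maxPrio _)
      rw [ih, hprio]
  refine IsStrategyTree.mem_semantics
    (S := {c | (c.1.map (Sum.map id φ), Sum.map (Sum.map id φ) id c.2) ∈ S}) ⟨hS.init, ?_, ?_,
      ?_, ?_, ?_⟩
  · intro h e t ha hb
    have := hS.entry ha ((h3 _ _).1 hb)
    rwa [hpos] at this
  · intro h x ha hb
    obtain ⟨t, ht, ht'⟩ := hS.zero ha ((h1 x).1 hb)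
    refine ⟨Sum.map φ.symm id t, (h3 _ _).2 (by simpa [Sum.map_map] using ht), ?_⟩
    simp only [Set.mem_ofPred_eq, ← hpos]
    simpa [Sum.map_map] using ht'
  · intro h x t ha hb hc
    have := hS.one ha (fun hx => hb ((h1 x).2 hx)) ((h3 _ _).1 hc)
    rwa [hpos] at this
  · intro h o ha
    have := hS.exit ha
    rwa [← hmax] at this
  · intro ρ ha hb hodd
    refine hS.inf (fun k => Sum.map id φ (ρ k)) (fun k => ?_) (fun k => ?_) ?_
    · rw [← prefixRev_map]
      exact ha k
    · obtain ⟨t, ht, heq⟩ := hb k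
      refine ⟨_, (h3 _ _).1 ht, ?_⟩
      rw [hpos, ← heq]
      rfl
    · simpa only [hprio] using hodd

theorem Iso.equivalent {A : OpenParityGame.{u} M m n} {B : OpenParityGame.{v} M m n}
    (h : Iso A B) : Equivalent A B :=
  Set.Subset.antisymm h.symm.semantics_subset h.semantics_subset

end OpenParityGame

namespace OpenParityGame

variable {M : ℕ} {m n : Obj}

/-! ## Nets -/

/-- The edges obtained from a bijection between output ports and input ports. -/
def netEdge {I O V : Type*} {out inn : V → Type}
    (φ : I ⊕ (Σ x, out x) ≃ O ⊕ (Σ x, inn x)) (s : I ⊕ V) (t : V ⊕ O) : Prop :=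
  ∃ p, Sum.map id Sigma.fst p = s ∧ Sum.elim Sum.inr (Sum.inl ∘ Sigma.fst) (φ p) = t

/-- The game whose edges are given by a bijection between the output ports and the input ports of
its positions and of its interface. -/
abbrev netGame {V : Type u} [hV : Finite V] (out inn : V → Type)
    (φ : Entries m n ⊕ (Σ x, out x) ≃ Exits m n ⊕ (Σ x, inn x)) (own : Set V)
    (pr : V → Fin (M + 1)) : OpenParityGame.{u} M m n where
  V := V
  finite := hV
  V₀ := own
  E := netEdge φ
  entry_unique e := by
    refine ⟨_, ⟨Sum.inl e, rfl, rfl⟩, ?_⟩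
    rintro t ⟨p | p, hp, rfl⟩
    · cases hp
      rfl
    · cases hp
  exit_unique o := by
    refine ⟨_, ⟨φ.symm (Sum.inl o), rfl, by simp⟩, ?_⟩
    rintro s ⟨p, rfl, hp⟩
    rcases hq : φ p with q | q
    · rw [hq] at hp
      cases hp
      rw [← hq, Equiv.symm_apply_apply]
    · rw [hq] at hp
      cases hp
  prio := pr

/-! ## Expansion into elementary positions -/

section expansion

variable (A : OpenParityGame.{u} M m n)

instance finite_entries_sum : Finite (Entries m n ⊕ A.V) := by
  have := A.finite
  infer_instance

instance finite_sum_exits : Finite (A.V ⊕ Exits m n) := by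
  have := A.finite
  infer_instance

/-- The number of edges into an internal position. -/
noncomputable def inDeg (x : A.V) : ℕ := Nat.card {s // A.E s (Sum.inl x)}

/-- The number of edges out of an internal position. -/
noncomputable def outDeg (x : A.V) : ℕ := Nat.card {t // A.E (Sum.inr x) t}

/-- An enumeration of the edges into an internal position. -/
noncomputable def inEdge (x : A.V) : {s // A.E s (Sum.inl x)} ≃ Fin (A.inDeg x) :=
  Finite.equivFin _

/-- An enumeration of the edges out of an internal position. -/
noncomputable def outEdge (x : A.V) : {t // A.E (Sum.inr x) t} ≃ Fin (A.outDeg x) :=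
  Finite.equivFin _

/-- The positions of the expansion of `A`. Every position of `A` is replaced by a chain
consisting of a start position, one merging position per incoming edge, a position carrying the
priority, one binary choice per outgoing edge, and a losing position. -/
inductive XNode : Type u
  | start (x : A.V)
  | merge (x : A.V) (j : Fin (A.inDeg x))
  | prio (x : A.V)
  | player (x : A.V) (j : Fin (A.outDeg x))
  | lose (x : A.V)

namespace XNode

variable {A}

/-- The output ports of a position of the expansion. -/
def Out : XNode A → Type
  | start _ => Unit
  | merge _ _ => Unit
  | prio _ => Unit
  | player _ _ => Bool
  | lose _ => Empty

/-- The input ports of a position of the expansion. -/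
def In : XNode A → Type
  | start _ => Empty
  | merge _ _ => Bool
  | prio _ => Unit
  | player _ _ => Unit
  | lose _ => Unit

/-- The `k`-th position of the incoming half of a chain. -/
noncomputable def chainIn (x : A.V) (k : Fin (A.inDeg x + 1)) : XNode A :=
  Fin.lastCases (prio x) (fun j => merge x j) k

/-- The `k`-th position of the outgoing half of a chain. -/
noncomputable def chainOut (x : A.V) (k : Fin (A.outDeg x + 1)) : XNode A :=
  Fin.lastCases (lose x) (fun j => player x j) k

@[simp] theorem chainIn_last (x : A.V) : chainIn x (Fin.last _) = prio x := by simp [chainIn]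

@[simp] theorem chainIn_castSucc (x : A.V) (j) : chainIn x (Fin.castSucc j) = merge x j := by
  simp [chainIn]

@[simp] theorem chainOut_last (x : A.V) : chainOut x (Fin.last _) = lose x := by simp [chainOut]

@[simp] theorem chainOut_castSucc (x : A.V) (j) : chainOut x (Fin.castSucc j) = player x j := by
  simp [chainOut]

/-- The positions belonging to Player 0. -/
def IsZero : XNode A → Prop
  | start _ => False
  | merge _ _ => False
  | prio _ => False
  | player x _ => x ∈ A.V₀
  | lose x => x ∈ A.V₀

/-- The priority of a position of the expansion. -/
def prioOf : XNode A → Fin (M + 1)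
  | prio x => A.prio x
  | _ => 0

/-- The position of `A` represented by a position of the expansion, if any. -/
def vis : Entries m n ⊕ XNode A → Option (Entries m n ⊕ A.V)
  | Sum.inl e => some (Sum.inl e)
  | Sum.inr (prio x) => some (Sum.inr x)
  | Sum.inr _ => none

variable (A)

/-- The edges of the expansion: those of `A` and those inside the chains. -/
abbrev Edge : Type u :=
  {st : (Entries m n ⊕ A.V) × (A.V ⊕ Exits m n) // A.E st.1 st.2} ⊕
    ((Σ x : A.V, Fin (A.inDeg x + 1)) ⊕ (Σ x : A.V, Fin (A.outDeg x + 1)))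

variable {A}

/-- The port `true` carries an edge of `A`, the port `false` continues the chain. Link `k` of a half
chain leaves its head if `k = 0` and its member `j` if `k = j + 1`; in `edgeTgt` it enters member
`k`, or the end of the half chain if `k` is last. -/
noncomputable def edgeSrc : Edge A → Entries m n ⊕ (Σ y : XNode A, y.Out)
  | Sum.inl ⟨(Sum.inl e, _), _⟩ => Sum.inl e
  | Sum.inl ⟨(Sum.inr x, t), h⟩ => Sum.inr ⟨player x (A.outEdge x ⟨t, h⟩), true⟩
  | Sum.inr (Sum.inl ⟨x, k⟩) => Sum.inr (Fin.cases (motive := fun _ => Σ y : XNode A, y.Out)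
      ⟨start x, ()⟩ (fun j => ⟨merge x j, ()⟩) k)
  | Sum.inr (Sum.inr ⟨x, k⟩) => Sum.inr (Fin.cases (motive := fun _ => Σ y : XNode A, y.Out)
      ⟨prio x, ()⟩ (fun j => ⟨player x j, false⟩) k)

noncomputable def edgeTgt : Edge A → Exits m n ⊕ (Σ y : XNode A, y.In)
  | Sum.inl ⟨(_, Sum.inr o), _⟩ => Sum.inl o
  | Sum.inl ⟨(s, Sum.inl x), h⟩ => Sum.inr ⟨merge x (A.inEdge x ⟨s, h⟩), true⟩
  | Sum.inr (Sum.inl ⟨x, k⟩) => Sum.inr (Fin.lastCases (motive := fun _ => Σ y : XNode A, y.In)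
      ⟨prio x, ()⟩ (fun j => ⟨merge x j, false⟩) k)
  | Sum.inr (Sum.inr ⟨x, k⟩) => Sum.inr (Fin.lastCases (motive := fun _ => Σ y : XNode A, y.In)
      ⟨lose x, ()⟩ (fun j => ⟨player x j, ()⟩) k)

noncomputable def edgeOfSrc : Entries m n ⊕ (Σ y : XNode A, y.Out) → Edge A
  | Sum.inl e => Sum.inl ⟨(Sum.inl e, A.entryTarget e), (A.entryTarget_eq_iff e _).1 rfl⟩
  | Sum.inr ⟨start x, _⟩ => Sum.inr (Sum.inl ⟨x, 0⟩)
  | Sum.inr ⟨merge x j, _⟩ => Sum.inr (Sum.inl ⟨x, j.succ⟩)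
  | Sum.inr ⟨prio x, _⟩ => Sum.inr (Sum.inr ⟨x, 0⟩)
  | Sum.inr ⟨player x j, true⟩ =>
    Sum.inl ⟨(Sum.inr x, ((A.outEdge x).symm j).1), ((A.outEdge x).symm j).2⟩
  | Sum.inr ⟨player x j, false⟩ => Sum.inr (Sum.inr ⟨x, j.succ⟩)

noncomputable def edgeOfTgt : Exits m n ⊕ (Σ y : XNode A, y.In) → Edge A
  | Sum.inl o => Sum.inl ⟨((A.exit_unique o).choose, Sum.inr o), (A.exit_unique o).choose_spec.1⟩
  | Sum.inr ⟨merge x j, true⟩ =>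
    Sum.inl ⟨(((A.inEdge x).symm j).1, Sum.inl x), ((A.inEdge x).symm j).2⟩
  | Sum.inr ⟨merge x j, false⟩ => Sum.inr (Sum.inl ⟨x, j.castSucc⟩)
  | Sum.inr ⟨prio x, _⟩ => Sum.inr (Sum.inl ⟨x, Fin.last _⟩)
  | Sum.inr ⟨player x j, _⟩ => Sum.inr (Sum.inr ⟨x, j.castSucc⟩)
  | Sum.inr ⟨lose x, _⟩ => Sum.inr (Sum.inr ⟨x, Fin.last _⟩)

/-- Each output port carries exactly one edge: for entries by `entry_unique`, for choices by the
enumeration `outEdge`. Together with `tgtEquiv` this makes the expansion a net. -/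
noncomputable def srcEquiv : Edge A ≃ Entries m n ⊕ (Σ y : XNode A, y.Out) where
  toFun := edgeSrc
  invFun := edgeOfSrc
  left_inv := by
    rintro (⟨⟨e | x, t⟩, h⟩ | ⟨x, k⟩ | ⟨x, k⟩)
    · have := (A.entryTarget_eq_iff e t).2 h
      subst this
      rfl
    · simp [edgeSrc, edgeOfSrc]
    · refine Fin.cases ?_ (fun j => ?_) k <;> simp [edgeSrc, edgeOfSrc]
    · refine Fin.cases ?_ (fun j => ?_) k <;> simp [edgeSrc, edgeOfSrc]
  right_inv := by
    rintro (e | ⟨x | ⟨x, j⟩ | x | ⟨x, j⟩ | x, p⟩)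
    · rfl
    · rfl
    · rfl
    · rfl
    · rcases p with _ | _
      · rfl
      · exact congrArg (fun k => (Sum.inr ⟨player x k, true⟩ : Entries m n ⊕ (Σ y : XNode A, y.Out)))
          ((A.outEdge x).apply_symm_apply j)
    · exact p.elim

noncomputable def tgtEquiv : Edge A ≃ Exits m n ⊕ (Σ y : XNode A, y.In) where
  toFun := edgeTgt
  invFun := edgeOfTgt
  left_inv := by
    rintro (⟨⟨s, x | o⟩, h⟩ | ⟨x, k⟩ | ⟨x, k⟩)
    · simp [edgeTgt, edgeOfTgt]
    · have := (A.exit_unique o).choose_spec.2 s h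
      subst this
      rfl
    · refine Fin.lastCases ?_ (fun j => ?_) k <;> simp [edgeTgt, edgeOfTgt]
    · refine Fin.lastCases ?_ (fun j => ?_) k <;> simp [edgeTgt, edgeOfTgt]
  right_inv := by
    rintro (e | ⟨x | ⟨x, j⟩ | x | ⟨x, j⟩ | x, p⟩)
    · rfl
    · exact p.elim
    · rcases p with _ | _
      · simp [edgeTgt, edgeOfTgt]
      · exact congrArg (fun k => (Sum.inr ⟨merge x k, true⟩ : Exits m n ⊕ (Σ y : XNode A, y.In)))
          ((A.inEdge x).apply_symm_apply j)
    · simp only [edgeTgt, edgeOfTgt, Fin.lastCases_last]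
      rfl
    · simp only [edgeTgt, edgeOfTgt, Fin.lastCases_castSucc]
      rfl
    · simp only [edgeTgt, edgeOfTgt, Fin.lastCases_last]
      rfl

instance : Finite (XNode A) := by
  have := A.finite
  refine Finite.of_injective
    (β := (A.V ⊕ (Σ x : A.V, Fin (A.inDeg x))) ⊕ (A.V ⊕ (Σ x : A.V, Fin (A.outDeg x))) ⊕ A.V)
    (fun y => match y with
      | start x => Sum.inl (Sum.inl x)
      | merge x j => Sum.inl (Sum.inr ⟨x, j⟩)
      | prio x => Sum.inr (Sum.inl (Sum.inl x))
      | player x j => Sum.inr (Sum.inl (Sum.inr ⟨x, j⟩))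
      | lose x => Sum.inr (Sum.inr x)) ?_
  rintro (x | ⟨x, j⟩ | x | ⟨x, j⟩ | x) (y | ⟨y, k⟩ | y | ⟨y, k⟩ | y) h <;> simp_all

/-- The end point, in the expansion, of an edge of `A`. -/
noncomputable def cross (s : Entries m n ⊕ A.V) :
    (t : A.V ⊕ Exits m n) → A.E s t → XNode A ⊕ Exits m n
  | Sum.inl y, h => Sum.inl (merge y (A.inEdge y ⟨s, h⟩))
  | Sum.inr o, _ => Sum.inr o

end XNode

/-- The expansion of a game into a net of elementary positions. -/
noncomputable abbrev expansion : OpenParityGame.{u} M m n :=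
  netGame XNode.Out XNode.In (XNode.srcEquiv.symm.trans XNode.tgtEquiv)
    {y : XNode A | y.IsZero} XNode.prioOf

variable {A}

/-! ### Edges out of the positions of the expansion -/

open XNode

theorem edgeTgt_cross (s t) (h : A.E s t) :
    Sum.elim Sum.inr (Sum.inl ∘ Sigma.fst) (edgeTgt (Sum.inl ⟨(s, t), h⟩)) = cross s t h := by
  rcases t with y | o <;> rfl

theorem edgeTgt_chainIn (x : A.V) (k) :
    Sum.elim Sum.inr (Sum.inl ∘ Sigma.fst) (edgeTgt (Sum.inr (Sum.inl ⟨x, k⟩))) =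
      (Sum.inl (chainIn x k) : XNode A ⊕ Exits m n) := by
  refine Fin.lastCases ?_ (fun j => ?_) k <;> simp [edgeTgt]

theorem edgeTgt_chainOut (x : A.V) (k) :
    Sum.elim Sum.inr (Sum.inl ∘ Sigma.fst) (edgeTgt (Sum.inr (Sum.inr ⟨x, k⟩))) =
      (Sum.inl (chainOut x k) : XNode A ⊕ Exits m n) := by
  refine Fin.lastCases ?_ (fun j => ?_) k <;> simp [edgeTgt]

theorem expansion_E_iff_edgeOfSrc (s : Entries m n ⊕ XNode A) (t : XNode A ⊕ Exits m n) :
    A.expansion.E s t ↔ ∃ p, Sum.map id Sigma.fst p = s ∧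
      Sum.elim Sum.inr (Sum.inl ∘ Sigma.fst) (edgeTgt (edgeOfSrc p)) = t :=
  Iff.rfl

theorem expansion_entry (e : Entries m n) (t' : XNode A ⊕ Exits m n) :
    A.expansion.E (Sum.inl e) t' ↔ ∃ t, ∃ h : A.E (Sum.inl e) t, t' = cross _ t h := by
  rw [expansion_E_iff_edgeOfSrc]
  constructor
  · rintro ⟨p | p, hp, rfl⟩
    · cases hp
      exact ⟨_, _, edgeTgt_cross _ _ _⟩
    · cases hp
  · rintro ⟨t, h, rfl⟩
    have := (A.entryTarget_eq_iff e t).2 h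
    subst this
    exact ⟨Sum.inl e, rfl, edgeTgt_cross _ _ _⟩

theorem expansion_start (x : A.V) (t' : XNode A ⊕ Exits m n) :
    A.expansion.E (Sum.inr (start x)) t' ↔ t' = Sum.inl (chainIn x 0) := by
  rw [expansion_E_iff_edgeOfSrc]
  constructor
  · rintro ⟨p | ⟨y, p⟩, hp, rfl⟩ <;> cases hp
    exact edgeTgt_chainIn _ _
  · rintro rfl
    exact ⟨Sum.inr ⟨start x, ()⟩, rfl, edgeTgt_chainIn _ _⟩

theorem expansion_merge (x : A.V) (j) (t' : XNode A ⊕ Exits m n) :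
    A.expansion.E (Sum.inr (merge x j)) t' ↔ t' = Sum.inl (chainIn x j.succ) := by
  rw [expansion_E_iff_edgeOfSrc]
  constructor
  · rintro ⟨p | ⟨y, p⟩, hp, rfl⟩ <;> cases hp
    exact edgeTgt_chainIn _ _
  · rintro rfl
    exact ⟨Sum.inr ⟨merge x j, ()⟩, rfl, edgeTgt_chainIn _ _⟩

theorem expansion_prio (x : A.V) (t' : XNode A ⊕ Exits m n) :
    A.expansion.E (Sum.inr (XNode.prio x)) t' ↔ t' = Sum.inl (chainOut x 0) := by
  rw [expansion_E_iff_edgeOfSrc]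
  constructor
  · rintro ⟨p | ⟨y, p⟩, hp, rfl⟩ <;> cases hp
    exact edgeTgt_chainOut _ _
  · rintro rfl
    exact ⟨Sum.inr ⟨XNode.prio x, ()⟩, rfl, edgeTgt_chainOut _ _⟩

theorem expansion_player (x : A.V) (j) (t' : XNode A ⊕ Exits m n) :
    A.expansion.E (Sum.inr (player x j)) t' ↔ t' = Sum.inl (chainOut x j.succ) ∨
      t' = cross (Sum.inr x) ((A.outEdge x).symm j).1 ((A.outEdge x).symm j).2 := by
  rw [expansion_E_iff_edgeOfSrc]
  constructor
  · rintro ⟨p | ⟨y, p⟩, hp, rfl⟩ <;> cases hp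
    rcases p with _ | _
    · exact Or.inl (edgeTgt_chainOut _ _)
    · exact Or.inr (edgeTgt_cross _ _ _)
  · rintro (rfl | rfl)
    · exact ⟨Sum.inr ⟨player x j, false⟩, rfl, edgeTgt_chainOut _ _⟩
    · exact ⟨Sum.inr ⟨player x j, true⟩, rfl, edgeTgt_cross _ _ _⟩

theorem expansion_lose (x : A.V) (t' : XNode A ⊕ Exits m n) :
    ¬ A.expansion.E (Sum.inr (lose x)) t' := by
  rw [expansion_E_iff_edgeOfSrc]
  rintro ⟨p | ⟨y, p⟩, hp, -⟩ <;> cases hp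
  exact p.elim

end expansion

end OpenParityGame

namespace OpenParityGame

variable {M : ℕ} {m n : Obj}

/-! ## A game is equivalent to its expansion -/

/-- Interspersing zeros can only add 0 to the values taken infinitely often. As 0 is minimal and
even, an odd maximum neither appears nor disappears. -/
theorem OddLimsup.iff_of_sparse {q q' : ℕ → Fin (M + 1)} {τ : ℕ → ℕ} (hτ : StrictMono τ)
    (h : ∀ k, q' (τ k) = q k) (h0 : ∀ l, (∀ k, τ k ≠ l) → q' l = 0) :
    OddLimsup q ↔ OddLimsup q' := by
  have h1 : ∀ c, (∃ᶠ k in Filter.atTop, q k = c) → ∃ᶠ l in Filter.atTop, q' l = c := by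
    intro c hc
    exact hτ.tendsto_atTop.frequently (hc.mono fun k hk => (h k).trans hk)
  have h2 : ∀ c, c ≠ 0 → (∃ᶠ l in Filter.atTop, q' l = c) → ∃ᶠ k in Filter.atTop, q k = c := by
    intro c hc hf
    rw [Filter.frequently_atTop] at hf ⊢
    intro N
    obtain ⟨l, hl, hlc⟩ := hf (τ N)
    by_cases hk : ∃ k, τ k = l
    · obtain ⟨k, rfl⟩ := hk
      exact ⟨k, hτ.le_iff_le.1 hl, (h k).symm.trans hlc⟩
    · push Not at hk
      exact absurd (hlc.symm.trans (h0 l hk)) hc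
  constructor
  · rintro ⟨c, ⟨hc1, hc2⟩, hc⟩
    refine ⟨c, ⟨h1 c hc1, fun c' hc' => ?_⟩, hc⟩
    by_cases hz : c' = 0
    · exact hz ▸ Fin.zero_le c
    · exact hc2 (h2 c' hz hc')
  · rintro ⟨c, ⟨hc1, hc2⟩, hc⟩
    exact ⟨c, ⟨h2 c (ne_zero_of_odd hc) hc1, fun c' hc' => hc2 (h1 c' hc')⟩, hc⟩

/-! ### Finite prefixes of infinite sequences -/

theorem eq_of_prefixRev_eq {α : Type*} {ρ : ℕ → α} {l : List α} {s : α} :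
    ∀ {N : ℕ} {g : List α}, prefixRev ρ N = g ++ s :: l → s = ρ l.length := by
  intro N
  induction N with
  | zero =>
    intro g h
    simp [prefixRev] at h
  | succ N ih =>
    intro g h
    rcases g with _ | ⟨a, g⟩
    · simp only [prefixRev, List.nil_append, List.cons.injEq] at h
      rw [← h.2, length_prefixRev, h.1]
    · simp only [prefixRev, List.cons_append, List.cons.injEq] at h
      exact ih h.2

theorem mem_of_prefixRev_eq {α : Type*} {ρ : ℕ → α} {l : List α} {k : ℕ} (hk : l.length ≤ k) :
    ∀ {N : ℕ} {g : List α}, prefixRev ρ N = g ++ l → k < N → ρ k ∈ g := by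
  intro N
  induction N with
  | zero =>
    intro g h hN
    omega
  | succ N ih =>
    intro g h hN
    rcases g with _ | ⟨a, g⟩
    · have := congrArg List.length h
      rw [length_prefixRev, List.nil_append] at this
      omega
    · simp only [prefixRev, List.cons_append, List.cons.injEq] at h
      rcases Nat.lt_succ_iff_lt_or_eq.1 hN with hN | rfl
      · exact List.mem_cons_of_mem _ (ih h.2 hN)
      · rw [h.1]
        exact List.mem_cons_self

theorem prefixRev_suffix {α : Type*} (ρ : ℕ → α) {k N : ℕ} (h : k ≤ N) :
    prefixRev ρ k <:+ prefixRev ρ N := by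
  induction h with
  | refl => exact List.suffix_refl _
  | step _ ih => exact ih.trans (List.suffix_cons _ _)

theorem prefixRev_eq_of_getElem {α : Type*} (ρ : ℕ → α) (l : List α)
    (h : ∀ k < l.length, l.reverse[k]? = some (ρ k)) : prefixRev ρ l.length = l := by
  induction l with
  | nil => rfl
  | cons a l ih =>
    have h1 := h l.length (by simp)
    simp only [List.reverse_cons, List.length_reverse, le_refl, List.getElem?_append_right,
      Nat.sub_self, List.getElem?_cons_zero, Option.some.injEq] at h1
    rw [List.length_cons, prefixRev, ← h1, ih]
    intro k hk
    have h2 := h k (by simp; omega)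
    rwa [List.reverse_cons, List.getElem?_append_left (by simpa using hk)] at h2

/-- An increasing sequence of histories is the sequence of histories of an infinite run. -/
theorem exists_prefixRev_eq {α : Type*} (H : ℕ → List α) (hH : ∀ k, H k <:+ H (k + 1))
    (hlen : StrictMono fun k => (H k).length) : ∃ ρ : ℕ → α, ∀ k, prefixRev ρ (H k).length = H k := by
  have hmono : ∀ k l, k ≤ l → H k <:+ H l := by
    intro k l hkl
    induction hkl with
    | refl => exact List.suffix_refl _
    | step _ ih => exact ih.trans (hH _)
  have hlt : ∀ k, k < (H (k + 1)).reverse.length := by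
    intro k
    rw [List.length_reverse]
    exact hlen.le_apply (x := k + 1)
  have hsame : ∀ a b k, k < (H a).length → k < (H b).length →
      (H a).reverse[k]? = (H b).reverse[k]? := by
    have aux : ∀ a b k, a ≤ b → k < (H a).length → (H a).reverse[k]? = (H b).reverse[k]? := by
      intro a b k hab hk
      obtain ⟨t, ht⟩ := hmono a b hab
      rw [← ht, List.reverse_append, List.getElem?_append_left (by simpa using hk)]
    intro a b k ha hb
    rcases le_total a b with h | h
    · exact aux a b k h ha
    · exact (aux b a k h hb).symm
  refine ⟨fun k => (H (k + 1)).reverse[k]'(hlt k), fun k => prefixRev_eq_of_getElem _ _ ?_⟩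
  intro l hl
  rw [hsame k (l + 1) l hl (by simpa using hlt l)]
  exact List.getElem?_eq_getElem (hlt l)

/-! ### Visible positions of the expansion -/

section expansion

open XNode

variable {A : OpenParityGame.{u} M m n}

theorem srcPrio_expansion_of_vis {s : Entries m n ⊕ XNode A} {t} (h : vis s = some t) :
    A.expansion.srcPrio s = A.srcPrio t := by
  rcases s with e | (x | ⟨x, j⟩ | x | ⟨x, j⟩ | x) <;> cases h <;> rfl

theorem srcPrio_expansion_of_not_vis {s : Entries m n ⊕ XNode A} (h : vis s = none) :
    A.expansion.srcPrio s = 0 := by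
  rcases s with e | (x | ⟨x, j⟩ | x | ⟨x, j⟩ | x) <;> first | rfl | cases h

/-- Invisible positions have priority 0. -/
theorem maxPrio_expansion (h : List (Entries m n ⊕ XNode A)) :
    A.expansion.maxPrio h = A.maxPrio (h.filterMap vis) := by
  induction h with
  | nil => rfl
  | cons s h ih =>
    change max (A.expansion.srcPrio s) (A.expansion.maxPrio h) = _
    rw [ih]
    rcases hs : vis s with _ | t
    · rw [List.filterMap_cons_none hs, srcPrio_expansion_of_not_vis hs]
      exact max_eq_right (Fin.zero_le _)
    · rw [List.filterMap_cons_some hs, srcPrio_expansion_of_vis hs]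
      rfl

theorem isStrategyTree_mem_of_suffix {S : Set (List (Entries m n ⊕ A.V) × A.Position)}
    (hS : ∀ s h p, (s :: h, p) ∈ S → (h, Sum.inl s) ∈ S ∧ ∃ t, A.E s t ∧ p = A.toPosition t)
    {s g} : ∀ {h p}, (h, p) ∈ S → (s :: g) <:+ h → (g, Sum.inl s) ∈ S := by
  intro h
  induction h with
  | nil =>
    intro p _ hs
    simp at hs
  | cons a h ih =>
    intro p hp hs
    rcases List.suffix_cons_iff.1 hs with heq | hs
    · cases heq
      exact (hS _ _ _ hp).1
    · exact ih (hS _ _ _ hp).1 hs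

/-! ### From a game to its expansion -/

/-- The condition on a configuration of the expansion, with visible history `g`, to follow a
strategy tree of the original game. -/
def Tracks (S : Set (List (Entries m n ⊕ A.V) × A.Position)) (g : List (Entries m n ⊕ A.V)) :
    (Entries m n ⊕ XNode A) ⊕ Exits m n → Prop
  | Sum.inl (Sum.inl e) => (g, Sum.inl (Sum.inl e)) ∈ S
  | Sum.inl (Sum.inr (start _)) => False
  | Sum.inl (Sum.inr (merge x _)) => (g, Sum.inl (Sum.inr x)) ∈ S
  | Sum.inl (Sum.inr (XNode.prio x)) => (g, Sum.inl (Sum.inr x)) ∈ S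
  -- At a choice, `x` has already been visited, so it heads the visible history. If Player 0 owns
  -- `x`, an edge approved by `S` must still lie ahead in the chain; this is why the losing position
  -- can be reached only when Player 1 owns `x`.
  | Sum.inl (Sum.inr (player x j)) => (∃ g', g = Sum.inr x :: g' ∧ (g', Sum.inl (Sum.inr x)) ∈ S) ∧
      (x ∈ A.V₀ → ∃ j', j ≤ j' ∧ (g, A.toPosition ((A.outEdge x).symm j').1) ∈ S)
  | Sum.inl (Sum.inr (lose x)) => x ∉ A.V₀
  | Sum.inr o => (g, Sum.inr o) ∈ S

variable {S : Set (List (Entries m n ⊕ A.V) × A.Position)} {g : List (Entries m n ⊕ A.V)}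

theorem tracks_chainIn {x : A.V} {k} (h : (g, Sum.inl (Sum.inr x)) ∈ S) :
    Tracks S g (Sum.inl (Sum.inr (chainIn x k))) := by
  refine Fin.lastCases ?_ (fun j => ?_) k
  · rw [chainIn_last]
    exact h
  · rw [chainIn_castSucc]
    exact h

theorem tracks_chainOut {x : A.V} {k}
    (h : ∃ g', g = Sum.inr x :: g' ∧ (g', Sum.inl (Sum.inr x)) ∈ S)
    (h' : x ∈ A.V₀ → ∃ j', k ≤ Fin.castSucc j' ∧
      (g, A.toPosition ((A.outEdge x).symm j').1) ∈ S) :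
    Tracks S g (Sum.inl (Sum.inr (chainOut x k))) := by
  revert h'
  refine Fin.lastCases (fun h' => ?_) (fun j h' => ?_) k
  · rw [chainOut_last]
    intro hx
    obtain ⟨j', hj, -⟩ := h' hx
    exact absurd (Fin.castSucc_lt_last j') (not_lt.2 hj)
  · rw [chainOut_castSucc]
    exact ⟨h, h'⟩

theorem tracks_cross {s t} (hst : A.E s t) (h : (g, A.toPosition t) ∈ S) :
    Tracks S g (A.expansion.toPosition (cross s t hst)) := by
  rcases t with y | o
  · exact h
  · exact h

/-- Every step along the incoming half gets closer to the priority position, so the induction runs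
backwards from the end of the chain. -/
theorem exists_vis_of_chainIn {ρ : ℕ → Entries m n ⊕ XNode A}
    (hρ : ∀ k, ∃ t, A.expansion.E (ρ k) t ∧ Sum.inl (ρ (k + 1)) = A.expansion.toPosition t)
    (x : A.V) (k) : ∀ l, ρ l = Sum.inr (chainIn x k) → ∃ l' ≥ l, vis (ρ l') ≠ none := by
  refine Fin.reverseInduction ?_ (fun j ih => ?_) k
  · intro l hl
    refine ⟨l, le_rfl, ?_⟩
    rw [hl, chainIn_last]
    simp [vis]
  · intro l hl
    obtain ⟨t, ht, heq⟩ := hρ l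
    rw [hl, chainIn_castSucc, expansion_merge] at ht
    subst ht
    obtain ⟨l', h1, h2⟩ := ih (l + 1) (Sum.inl_injective heq)
    exact ⟨l', by omega, h2⟩

/-- An infinite run cannot end in the losing position or at an exit, so it leaves the outgoing half
for the incoming half of some chain. -/
theorem exists_vis_of_chainOut {ρ : ℕ → Entries m n ⊕ XNode A}
    (hρ : ∀ k, ∃ t, A.expansion.E (ρ k) t ∧ Sum.inl (ρ (k + 1)) = A.expansion.toPosition t)
    (x : A.V) (k) : ∀ l, ρ l = Sum.inr (chainOut x k) → ∃ l' ≥ l, vis (ρ l') ≠ none := by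
  refine Fin.reverseInduction ?_ (fun j ih => ?_) k
  · intro l hl
    obtain ⟨t, ht, heq⟩ := hρ l
    rw [hl, chainOut_last] at ht
    exact absurd ht (expansion_lose _ _)
  · intro l hl
    obtain ⟨t, ht, heq⟩ := hρ l
    rw [hl, chainOut_castSucc, expansion_player] at ht
    rcases ht with rfl | rfl
    · obtain ⟨l', h1, h2⟩ := ih (l + 1) (Sum.inl_injective heq)
      exact ⟨l', by omega, h2⟩
    · generalize (A.outEdge x).symm j = t at heq
      obtain ⟨y | o, ht⟩ := t
      · have h1 : ρ (l + 1) = Sum.inr (merge y _) := Sum.inl_injective heq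
        rw [← chainIn_castSucc] at h1
        obtain ⟨l', h1, h2⟩ := exists_vis_of_chainIn hρ _ _ _ h1
        exact ⟨l', by omega, h2⟩
      · cases heq

theorem exists_vis {ρ : ℕ → Entries m n ⊕ XNode A}
    (hρ : ∀ k, ∃ t, A.expansion.E (ρ k) t ∧ Sum.inl (ρ (k + 1)) = A.expansion.toPosition t)
    (l : ℕ) : ∃ l' ≥ l, vis (ρ l') ≠ none := by
  rcases hl : ρ l with e | (x | ⟨x, j⟩ | x | ⟨x, j⟩ | x)
  · exact ⟨l, le_rfl, by simp [hl, vis]⟩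
  · obtain ⟨t, ht, heq⟩ := hρ l
    rw [hl, expansion_start] at ht
    subst ht
    obtain ⟨l', h1, h2⟩ := exists_vis_of_chainIn hρ _ _ (l + 1) (Sum.inl_injective heq)
    exact ⟨l', by omega, h2⟩
  · rw [← chainIn_castSucc] at hl
    exact exists_vis_of_chainIn hρ _ _ l hl
  · rw [← chainIn_last] at hl
    exact exists_vis_of_chainIn hρ _ _ l hl
  · rw [← chainOut_castSucc] at hl
    exact exists_vis_of_chainOut hρ _ _ l hl
  · rw [← chainOut_last] at hl
    exact exists_vis_of_chainOut hρ _ _ l hl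

/-- The visible part of an infinite run of the expansion. -/
theorem exists_visible_run {ρ : ℕ → Entries m n ⊕ XNode A}
    (hρ : ∀ k, ∃ t, A.expansion.E (ρ k) t ∧ Sum.inl (ρ (k + 1)) = A.expansion.toPosition t) :
    ∃ (τ : ℕ → ℕ) (ρ' : ℕ → Entries m n ⊕ A.V), StrictMono τ ∧
      (∀ k, vis (ρ (τ k)) = some (ρ' k)) ∧ (∀ l, (∀ k, τ k ≠ l) → vis (ρ l) = none) ∧
      ∀ k, (prefixRev ρ (τ k)).filterMap vis = prefixRev ρ' k := by
  classical
  let p : ℕ → Prop := fun l => vis (ρ l) ≠ none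
  have hinf : (Set.ofPred p).Infinite := by
    rw [Set.infinite_iff_exists_gt]
    intro l
    obtain ⟨l', h1, h2⟩ := exists_vis hρ (l + 1)
    exact ⟨l', h2, by omega⟩
  have hmem : ∀ k, ∃ s, vis (ρ (Nat.nth p k)) = some s := fun k =>
    Option.ne_none_iff_exists'.1 (Nat.nth_mem_of_infinite hinf k)
  choose ρ' hρ' using hmem
  have hcount : ∀ l, (prefixRev ρ l).filterMap vis = prefixRev ρ' (Nat.count p l) := by
    intro l
    induction l with
    | zero => simp [prefixRev]
    | succ l ih =>
      rw [Nat.count_succ]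
      by_cases hl : p l
      · have h1 := hρ' (Nat.count p l)
        rw [Nat.nth_count hl] at h1
        rw [if_pos hl, prefixRev, prefixRev, List.filterMap_cons_some h1, ih]
      · rw [if_neg hl, prefixRev, List.filterMap_cons_none (not_not.1 hl), ih, Nat.add_zero]
  refine ⟨Nat.nth p, ρ', Nat.nth_strictMono hinf, hρ', fun l hl => ?_, fun k => ?_⟩
  · by_contra h
    exact hl (Nat.count p l) (Nat.nth_count h)
  · rw [hcount, Nat.count_nth_of_infinite hinf]

theorem semantics_subset_expansion (A : OpenParityGame.{u} M m n) :
    A.semantics ⊆ A.expansion.semantics := by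
  rintro ⟨T, i⟩ hT
  obtain ⟨S, hS, hclosed⟩ := exists_isStrategyTree hT
  refine IsStrategyTree.mem_semantics (S := {c | Tracks S (c.1.filterMap vis) c.2})
    ⟨hS.init, ?_, ?_, ?_, ?_, ?_⟩
  · intro h e t' h1 h2
    obtain ⟨t, ht, rfl⟩ := (expansion_entry e t').1 h2
    exact tracks_cross ht (hS.entry h1 ht)
  · rintro h (x | ⟨x, j⟩ | x | ⟨x, j⟩ | x) h1 h2
    · exact h2.elim
    · exact h2.elim
    · exact h2.elim
    · have h2 : x ∈ A.V₀ := h2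
      obtain ⟨h3, h4⟩ := h1
      obtain ⟨j', hj, hj'⟩ := h4 h2
      -- Player 0 leaves the chain exactly at the choice belonging to the approved edge, and
      -- declines before.
      rcases hj.eq_or_lt with rfl | hlt
      · exact ⟨_, (expansion_player x j _).2 (Or.inr rfl), tracks_cross _ hj'⟩
      · exact ⟨_, (expansion_player x j _).2 (Or.inl rfl), tracks_chainOut h3 fun _ =>
          ⟨j', Fin.succ_le_castSucc_iff.2 hlt, hj'⟩⟩
    · exact absurd h2 h1
  · rintro h (x | ⟨x, j⟩ | x | ⟨x, j⟩ | x) t' h1 h2 h3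
    · exact h1.elim
    · obtain rfl := (expansion_merge x j t').1 h3
      exact tracks_chainIn h1
    · obtain rfl := (expansion_prio x t').1 h3
      refine tracks_chainOut ⟨_, rfl, h1⟩ fun hx => ?_
      obtain ⟨t, ht, ht'⟩ := hS.zero h1 hx
      -- The whole chain lies ahead, so the index of the edge approved by `S` is a valid witness.
      refine ⟨A.outEdge x ⟨t, ht⟩, Fin.zero_le _, ?_⟩
      rw [Equiv.symm_apply_apply]
      exact ht'
    · have h2 : x ∉ A.V₀ := h2
      obtain ⟨⟨g', h4, h5⟩, -⟩ := h1
      rcases (expansion_player x j t').1 h3 with rfl | rfl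
      · exact tracks_chainOut ⟨g', h4, h5⟩ fun hx => absurd hx h2
      · refine tracks_cross _ ?_
        have := hS.one h5 h2 ((A.outEdge x).symm j).2
        rw [← h4] at this
        exact this
    · exact absurd h3 (expansion_lose x t')
  · intro h o h1
    have := hS.exit h1
    rwa [← maxPrio_expansion] at this
  · intro ρ h1 h2 hodd
    -- The visible part of a run of the expansion is a run in `S` with the same odd limit superior,
    -- if any.
    obtain ⟨τ, ρ', hτ, hvis, hnot, hpre⟩ := exists_visible_run h2
    have h3 : ∀ k, (prefixRev ρ' k, Sum.inl (ρ' k)) ∈ S := by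
      intro k
      have h4 : Tracks S ((prefixRev ρ (τ k)).filterMap vis) (Sum.inl (ρ (τ k))) := h1 (τ k)
      rw [hpre] at h4
      have h5 := hvis k
      generalize ρ (τ k) = s at h4 h5
      rcases s with e | (x | ⟨x, j⟩ | x | ⟨x, j⟩ | x) <;>
        simp only [vis, reduceCtorEq, Option.some.injEq] at h5
      · rw [← h5]
        exact h4
      · rw [← h5]
        exact h4
    refine hS.inf ρ' h3 (fun k => ?_) ?_
    · exact (hclosed _ _ _ (h3 (k + 1))).2
    · refine (OddLimsup.iff_of_sparse hτ (fun k => ?_) fun l hl => ?_).2 hodd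
      · exact srcPrio_expansion_of_vis (hvis k)
      · exact srcPrio_expansion_of_not_vis (hnot l hl)

/-! ### From the expansion to the game -/

/-- The position of the expansion representing a position of the original game. -/
def embSrc : Entries m n ⊕ A.V → Entries m n ⊕ XNode A := Sum.map id XNode.prio

theorem vis_embSrc (s : Entries m n ⊕ A.V) : vis (embSrc s) = some s := by
  rcases s with s | s <;> rfl

/-- The position of the expansion representing a position of the original game. -/
def embPos : A.Position → (Entries m n ⊕ XNode A) ⊕ Exits m n := Sum.map embSrc id

/-- A configuration in `S'` with position `p` and history `h'` is reached after passing only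
through invisible positions. -/
def LeadsTo (S' : Set (List (Entries m n ⊕ XNode A) × A.expansion.Position))
    (h' : List (Entries m n ⊕ XNode A)) (p : A.Position) : Prop :=
  ∃ g : List (Entries m n ⊕ XNode A), (∀ s ∈ g, vis s = none) ∧ (g ++ h', embPos p) ∈ S'

theorem LeadsTo.cons {S' : Set (List (Entries m n ⊕ XNode A) × A.expansion.Position)} {h' p s}
    (h : LeadsTo S' (s :: h') p) (hs : vis s = none) : LeadsTo S' h' p := by
  obtain ⟨g, h1, h2⟩ := h
  refine ⟨g ++ [s], ?_, by simpa using h2⟩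
  intro a ha
  rcases List.mem_append.1 ha with ha | ha
  · exact h1 a ha
  · rwa [List.mem_singleton.1 ha]

section

variable {T : Set (Exits m n × Fin (M + 1))} {i : Entries m n}
  {S' : Set (List (Entries m n ⊕ XNode A) × A.expansion.Position)}
  (hS : IsStrategyTree A.expansion T i S')

include hS

/-- The incoming half has no branching, so the tree must contain its end. -/
theorem leadsTo_of_chainIn (y : A.V) (k) : ∀ h', (h', Sum.inl (Sum.inr (chainIn y k))) ∈ S' →
    LeadsTo S' h' (Sum.inl (Sum.inr y)) := by
  refine Fin.reverseInduction ?_ (fun j ih => ?_) k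
  · intro h' h1
    rw [chainIn_last] at h1
    exact ⟨[], by simp, h1⟩
  · intro h' h1
    rw [chainIn_castSucc] at h1
    -- A merge belongs to Player 1: ownership by Player 0 unfolds to `False`, and `id` refutes it.
    exact (ih _ (hS.one h1 id ((expansion_merge y j _).2 rfl))).cons rfl

theorem leadsTo_of_cross {s t} (hst : A.E s t) {h'}
    (h1 : (h', A.expansion.toPosition (cross s t hst)) ∈ S') :
    LeadsTo S' h' (A.toPosition t) := by
  rcases t with y | o
  · refine leadsTo_of_chainIn hS y (A.inEdge y ⟨s, hst⟩).castSucc h' ?_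
    rw [chainIn_castSucc]
    exact h1
  · exact ⟨[], by simp, h1⟩

/-- The tree cannot contain a losing position of Player 0, since it would have to offer a move
there; so it takes one of the remaining edges. -/
theorem leadsTo_of_chainOut_zero {x : A.V} (hx : x ∈ A.V₀) (k) :
    ∀ h', (h', Sum.inl (Sum.inr (chainOut x k))) ∈ S' →
    ∃ t, A.E (Sum.inr x) t ∧ LeadsTo S' h' (A.toPosition t) := by
  refine Fin.reverseInduction ?_ (fun j ih => ?_) k
  · intro h' h1
    rw [chainOut_last] at h1
    obtain ⟨t, ht, -⟩ := hS.zero h1 hx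
    exact absurd ht (expansion_lose x t)
  · intro h' h1
    rw [chainOut_castSucc] at h1
    obtain ⟨t, ht, h2⟩ := hS.zero h1 hx
    rcases (expansion_player x j t).1 ht with rfl | rfl
    · obtain ⟨t, h3, h4⟩ := ih _ h2
      exact ⟨t, h3, h4.cons rfl⟩
    · exact ⟨_, ((A.outEdge x).symm j).2, (leadsTo_of_cross hS _ h2).cons rfl⟩

/-- Player 1 may decline until choice `j` comes up, and the tree is closed under all of Player 1's
moves. -/
theorem leadsTo_of_chainOut_one {x : A.V} (hx : x ∉ A.V₀) (k) :
    ∀ h', (h', Sum.inl (Sum.inr (chainOut x k))) ∈ S' → ∀ j, k ≤ Fin.castSucc j →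
    LeadsTo S' h' (A.toPosition ((A.outEdge x).symm j).1) := by
  refine Fin.reverseInduction ?_ (fun j' ih => ?_) k
  · intro h' h1 j hj
    exact absurd (Fin.castSucc_lt_last j) (not_lt.2 hj)
  · intro h' h1 j hj
    rw [chainOut_castSucc] at h1
    rcases (Fin.castSucc_le_castSucc_iff.1 hj).eq_or_lt with rfl | hlt
    · exact (leadsTo_of_cross hS _
        (hS.one h1 hx ((expansion_player x j' _).2 (Or.inr rfl)))).cons rfl
    · exact (ih _ (hS.one h1 hx ((expansion_player x j' _).2 (Or.inl rfl))) j
        (Fin.succ_le_castSucc_iff.2 hlt)).cons rfl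

theorem leadsTo_entry {h' e t} (h1 : (h', Sum.inl (Sum.inl e)) ∈ S')
    (ht : A.E (Sum.inl e) t) : LeadsTo S' (Sum.inl e :: h') (A.toPosition t) :=
  leadsTo_of_cross hS ht (hS.entry h1 ((expansion_entry e _).2 ⟨t, ht, rfl⟩))

theorem leadsTo_zero {h'} {x : A.V} (h1 : (h', Sum.inl (Sum.inr (XNode.prio x))) ∈ S')
    (hx : x ∈ A.V₀) : ∃ t, A.E (Sum.inr x) t ∧
      LeadsTo S' (Sum.inr (XNode.prio x) :: h') (A.toPosition t) :=
  leadsTo_of_chainOut_zero hS hx 0 _ (hS.one h1 id ((expansion_prio x _).2 rfl))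

theorem leadsTo_one {h'} {x : A.V} {t} (h1 : (h', Sum.inl (Sum.inr (XNode.prio x))) ∈ S')
    (hx : x ∉ A.V₀) (ht : A.E (Sum.inr x) t) :
    LeadsTo S' (Sum.inr (XNode.prio x) :: h') (A.toPosition t) := by
  have := leadsTo_of_chainOut_one hS hx 0 _ (hS.one h1 id ((expansion_prio x _).2 rfl))
    (A.outEdge x ⟨t, ht⟩) (Fin.zero_le _)
  rwa [Equiv.symm_apply_apply] at this

end

open Classical in
/-- A history of the expansion, inside `S'`, corresponding to a history of the original game. -/
noncomputable def lift (S' : Set (List (Entries m n ⊕ XNode A) × A.expansion.Position)) :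
    List (Entries m n ⊕ A.V) → A.Position → List (Entries m n ⊕ XNode A)
  | [], _ => []
  | s :: h, p =>
    -- The lift of a longer history extends the lift already chosen for the shorter one; this
    -- coherence makes infinite runs liftable.
    if H : LeadsTo S' (embSrc s :: lift S' h (Sum.inl s)) p then
      H.choose ++ embSrc s :: lift S' h (Sum.inl s) else []

/-- The configurations which lift to `S'`. -/
def liftTree (S' : Set (List (Entries m n ⊕ XNode A) × A.expansion.Position)) :
    Set (List (Entries m n ⊕ A.V) × A.Position) :=
  {c | (lift S' c.1 c.2, embPos c.2) ∈ S' ∧ (lift S' c.1 c.2).filterMap vis = c.1}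

theorem lift_cons {S' : Set (List (Entries m n ⊕ XNode A) × A.expansion.Position)} {s h p}
    (H : LeadsTo S' (embSrc s :: lift S' h (Sum.inl s)) p) :
    ∃ g, (∀ s ∈ g, vis s = none) ∧ lift S' (s :: h) p = g ++ embSrc s :: lift S' h (Sum.inl s) ∧
      (lift S' (s :: h) p, embPos p) ∈ S' := by
  have h1 : lift S' (s :: h) p = H.choose ++ embSrc s :: lift S' h (Sum.inl s) := by
    rw [lift, dif_pos H]
  refine ⟨H.choose, H.choose_spec.1, h1, ?_⟩
  rw [h1]
  exact H.choose_spec.2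

theorem cons_mem_liftTree {S' : Set (List (Entries m n ⊕ XNode A) × A.expansion.Position)}
    {s h p} (h1 : (h, Sum.inl s) ∈ liftTree S')
    (H : LeadsTo S' (embSrc s :: lift S' h (Sum.inl s)) p) : (s :: h, p) ∈ liftTree S' := by
  obtain ⟨g, h2, h3, h4⟩ := lift_cons H
  refine ⟨h4, ?_⟩
  have h5 : (lift S' h (Sum.inl s)).filterMap vis = h := h1.2
  rw [show (lift S' (s :: h, p).1 (s :: h, p).2) = _ from h3, List.filterMap_append,
    List.filterMap_eq_nil_iff.2 h2, List.filterMap_cons_some (vis_embSrc s), h5]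
  rfl

/-- The default value `[]` of `lift` has empty visible part, so the visibility condition in
`liftTree` excludes it for nonempty histories. -/
theorem leadsTo_of_cons_mem_liftTree
    {S' : Set (List (Entries m n ⊕ XNode A) × A.expansion.Position)} {s h p}
    (h1 : (s :: h, p) ∈ liftTree S') :
    LeadsTo S' (embSrc s :: lift S' h (Sum.inl s)) p := by
  by_contra H
  have h2 : (lift S' (s :: h) p).filterMap vis = s :: h := h1.2
  rw [lift, dif_neg H] at h2
  simp at h2

theorem expansion_semantics_subset (A : OpenParityGame.{u} M m n) :
    A.expansion.semantics ⊆ A.semantics := by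
  rintro ⟨T, i⟩ hT
  obtain ⟨S', hS, hclosed⟩ := exists_isStrategyTree hT
  refine IsStrategyTree.mem_semantics (S := liftTree S') ⟨⟨hS.init, rfl⟩, ?_, ?_, ?_, ?_, ?_⟩
  · intro h e t h1 ht
    exact cons_mem_liftTree h1 (leadsTo_entry hS h1.1 ht)
  · intro h x h1 hx
    obtain ⟨t, ht, h2⟩ := leadsTo_zero hS h1.1 hx
    exact ⟨t, ht, cons_mem_liftTree h1 h2⟩
  · intro h x t h1 hx ht
    exact cons_mem_liftTree h1 (leadsTo_one hS h1.1 hx ht)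
  · rintro h o ⟨h1, h2⟩
    have := hS.exit h1
    rw [maxPrio_expansion] at this
    rwa [show (lift S' h (Sum.inr o)).filterMap vis = h from h2] at this
  · intro ρ h1 _ hodd
    -- The lifts of the finite prefixes are nested and strictly growing, so they glue to a run `ρ'`
    -- of the expansion, in which `ρ k` sits at index `(H k).length`.
    let H : ℕ → List (Entries m n ⊕ XNode A) := fun k => lift S' (prefixRev ρ k) (Sum.inl (ρ k))
    have hstep : ∀ k, ∃ g, (∀ s ∈ g, vis s = none) ∧ H (k + 1) = g ++ embSrc (ρ k) :: H k := by
      intro k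
      obtain ⟨g, h2, h3, -⟩ := lift_cons (leadsTo_of_cons_mem_liftTree (h1 (k + 1)))
      exact ⟨g, h2, h3⟩
    have hlen : StrictMono fun k => (H k).length := by
      refine strictMono_nat_of_lt_succ fun k => ?_
      obtain ⟨g, -, h2⟩ := hstep k
      simp only [h2, List.length_append, List.length_cons]
      omega
    obtain ⟨ρ', hρ'⟩ := exists_prefixRev_eq H (fun k => by
      obtain ⟨g, -, h2⟩ := hstep k
      rw [h2]
      exact (List.suffix_cons _ _).trans (List.suffix_append _ _)) hlen
    have hval : ∀ k, ρ' (H k).length = embSrc (ρ k) := by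
      intro k
      obtain ⟨g, -, h2⟩ := hstep k
      exact (eq_of_prefixRev_eq ((hρ' (k + 1)).trans h2)).symm
    have hmem : ∀ l, (prefixRev ρ' l, Sum.inl (ρ' l)) ∈ S' := by
      intro l
      have h2 : (H (l + 1), embPos (Sum.inl (ρ (l + 1)))) ∈ S' := (h1 (l + 1)).1
      refine isStrategyTree_mem_of_suffix hclosed h2 ?_
      rw [← hρ' (l + 1)]
      exact prefixRev_suffix ρ' (k := l + 1) (hlen.le_apply (x := l + 1))
    have hoff : ∀ l, (∀ k, (H k).length ≠ l) → vis (ρ' l) = none := by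
      classical
      intro l hl
      have hex : ∃ k, l < (H k).length := ⟨l + 1, hlen.le_apply (x := l + 1)⟩
      -- The first lift longer than `l` is not the empty `H 0`. Its predecessor `H k` has length
      -- less than `l`, so index `l` falls into the invisible segment between the two.
      obtain ⟨k, hk⟩ : ∃ k, Nat.find hex = k + 1 := by
        refine Nat.exists_eq_succ_of_ne_zero fun h0 => ?_
        have := Nat.find_spec hex
        rw [h0] at this
        simp [H, prefixRev, lift] at this
      have h2 := Nat.find_spec hex
      rw [hk] at h2
      have h3 : ¬ l < (H k).length := Nat.find_min hex (by omega)
      have h4 := hl k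
      obtain ⟨g, hg, h5⟩ := hstep k
      refine hg _ (mem_of_prefixRev_eq (l := embSrc (ρ k) :: H k) (N := (H (k + 1)).length) ?_
        ((hρ' (k + 1)).trans h5) h2)
      rw [List.length_cons]
      omega
    refine hS.inf ρ' hmem (fun k => (hclosed _ _ _ (hmem (k + 1))).2) ?_
    refine (OddLimsup.iff_of_sparse hlen (fun k => ?_) fun l hl => ?_).1 hodd
    · rw [hval k]
      exact srcPrio_expansion_of_vis (vis_embSrc _)
    · exact srcPrio_expansion_of_not_vis (hoff l hl)

theorem expansion_equivalent (A : OpenParityGame.{u} M m n) : Equivalent A.expansion A :=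
  Set.Subset.antisymm (expansion_semantics_subset A) (semantics_subset_expansion A)

end expansion

end OpenParityGame

/-! ## Computing composites -/

/-- A function `K` constant along hidden paths must give their end point. Conversely a path entered
from outside does reach an end, as `H` is finite and hidden nodes have in-degree one. On closed
hidden loops the value of `K` is immaterial. -/
theorem feedback_iff_of_invariant {S T H : Type*} [Finite H] (R : S ⊕ H → T ⊕ H → Prop)
    (hout : ∀ h, ∃! x, R (Sum.inr h) x) (hin : ∀ h, ∃! x, R x (Sum.inr h)) (K : H → T)
    (hK : ∀ h y, R (Sum.inr h) y → Sum.elim id K y = K h) (s : S) (t : T) :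
    feedback R s t ↔ ∃ y, R (Sum.inl s) y ∧ Sum.elim id K y = t := by
  have hpath : ∀ h h' t, Relation.ReflTransGen (fun a b : H => R (Sum.inr a) (Sum.inr b)) h h' →
      R (Sum.inr h') (Sum.inl t) → K h = t := by
    intro h h' t p e
    induction p using Relation.ReflTransGen.head_induction_on with
    | refl => exact (hK _ _ e).symm
    | head hab _ ih => exact (hK _ _ hab).symm.trans ih
  constructor
  · rintro (h | ⟨h, h', h1, h2, h3⟩)
    · exact ⟨_, h, rfl⟩
    · exact ⟨_, h1, hpath h h' t h2 h3⟩
  · rintro ⟨y | h, hy, rfl⟩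
    · exact Or.inl hy
    -- A source in `S` may have many successors, whereas `feedback_existsUnique` wants one; so each
    -- edge out of `S` is made a source of its own.
    · let R' : {p : S × (T ⊕ H) // R (Sum.inl p.1) p.2} ⊕ H → T ⊕ H → Prop :=
        fun x y => Sum.elim (fun p => y = p.1.2) (fun k => R (Sum.inr k) y) x
      obtain ⟨t, ht, -⟩ := feedback_existsUnique R' ⟨(s, Sum.inr h), hy⟩ ⟨_, rfl, fun _ h => h⟩
        hout (fun k => by
          obtain ⟨x, hx, hu⟩ := hin k
          rcases x with s' | k'
          · refine ⟨Sum.inl ⟨(s', Sum.inr k), hx⟩, rfl, ?_⟩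
            rintro (⟨⟨s'', y⟩, hy⟩ | k'') hx'
            · obtain rfl : Sum.inr k = y := hx'
              cases hu _ hy
              rfl
            · cases hu _ hx'
          · refine ⟨Sum.inr k', hx, ?_⟩
            rintro (⟨⟨s'', y⟩, hy⟩ | k'') hx'
            · obtain rfl : Sum.inr k = y := hx'
              cases hu _ hy
            · exact congrArg Sum.inr (Sum.inr_injective (hu _ hx')))
      rcases ht with ht | ⟨h0, h', h1, h2, h3⟩
      · cases ht
      · cases h1
        have := hpath _ _ _ h2 h3
        change feedback R s (K h)
        rw [this]
        exact Or.inr ⟨_, h', hy, h2, h3⟩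

namespace OpenParityGame

variable {M : ℕ} {m n o : Obj}

section comp

variable (A : OpenParityGame.{u} M m n) (B : OpenParityGame.{u} M n o)

theorem compEdge_srcLeft_iff (a t) :
    compEdge A B (compSrcLeft A B a) t ↔ ∃ y, A.E a y ∧ compTgtLeft A B y = t := by
  constructor
  · rintro (⟨a', y, h1, h2, h3⟩ | ⟨a', y, h1, h2, h3⟩)
    · cases compSrcLeft_injective A B h2
      exact ⟨y, h1, h3⟩
    · exact absurd h2.symm (compSrc_ne A B _ _)
  · rintro ⟨y, h1, h2⟩
    exact Or.inl ⟨a, y, h1, rfl, h2⟩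

theorem compEdge_srcRight_iff (b t) :
    compEdge A B (compSrcRight A B b) t ↔ ∃ y, B.E b y ∧ compTgtRight A B y = t := by
  constructor
  · rintro (⟨a', y, h1, h2, h3⟩ | ⟨a', y, h1, h2, h3⟩)
    · exact absurd h2 (compSrc_ne A B _ _)
    · cases compSrcRight_injective A B h2
      exact ⟨y, h1, h3⟩
  · rintro ⟨y, h1, h2⟩
    exact Or.inr ⟨b, y, h1, rfl, h2⟩

/-- The edges of a composite, from functions `KA` and `KB` giving the final target of an edge of
each of the two games. -/
theorem comp_E_iff (KA : A.V ⊕ Exits m n → (A.V ⊕ B.V) ⊕ Exits m o)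
    (KB : B.V ⊕ Exits n o → (A.V ⊕ B.V) ⊕ Exits m o)
    (hA1 : ∀ x, KA (Sum.inl x) = Sum.inl (Sum.inl x))
    (hA2 : ∀ j, KA (Sum.inr (Sum.inl j)) = Sum.inr (Sum.inl j))
    (hB1 : ∀ x, KB (Sum.inl x) = Sum.inl (Sum.inr x))
    (hB2 : ∀ i, KB (Sum.inr (Sum.inr i)) = Sum.inr (Sum.inr i))
    (hAB : ∀ i t, B.E (Sum.inl (Sum.inl i)) t → KB t = KA (Sum.inr (Sum.inr i)))
    (hBA : ∀ j t, A.E (Sum.inl (Sum.inr j)) t → KA t = KB (Sum.inr (Sum.inl j))) :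
    (∀ i t, (A.comp B).E (Sum.inl (Sum.inl i)) t ↔
      ∃ y, A.E (Sum.inl (Sum.inl i)) y ∧ KA y = t) ∧
    (∀ j t, (A.comp B).E (Sum.inl (Sum.inr j)) t ↔
      ∃ y, B.E (Sum.inl (Sum.inr j)) y ∧ KB y = t) ∧
    (∀ x t, (A.comp B).E (Sum.inr (Sum.inl x)) t ↔ ∃ y, A.E (Sum.inr x) y ∧ KA y = t) ∧
    (∀ x t, (A.comp B).E (Sum.inr (Sum.inr x)) t ↔ ∃ y, B.E (Sum.inr x) y ∧ KB y = t) := by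
  -- A hidden wire is an exit of one of the two games, and `KA` or `KB` names its final target
  -- there.
  let K : Fin n.1 ⊕ Fin n.2 → (A.V ⊕ B.V) ⊕ Exits m o :=
    Sum.elim (fun i => KA (Sum.inr (Sum.inr i))) fun j => KB (Sum.inr (Sum.inl j))
  have hl : ∀ y, Sum.elim id K (compTgtLeft A B y) = KA y := by
    rintro (x | j | i)
    · exact (hA1 x).symm
    · exact (hA2 j).symm
    · rfl
  have hr : ∀ y, Sum.elim id K (compTgtRight A B y) = KB y := by
    rintro (x | j | i)
    · exact (hB1 x).symm
    · rfl
    · exact (hB2 i).symm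
  have hK : ∀ h y, compEdge A B (Sum.inr h) y → Sum.elim id K y = K h := by
    rintro (i | j) y h
    · obtain ⟨t, h1, rfl⟩ := (compEdge_srcRight_iff A B (Sum.inl (Sum.inl i)) y).1 h
      rw [hr]
      exact hAB i t h1
    · obtain ⟨t, h1, rfl⟩ := (compEdge_srcLeft_iff A B (Sum.inl (Sum.inr j)) y).1 h
      rw [hl]
      exact hBA j t h1
  have key := feedback_iff_of_invariant (compEdge A B) (compEdge_hidden_out A B)
    (compEdge_hidden_in A B) K hK
  have keyl : ∀ a t, (∃ y, compEdge A B (compSrcLeft A B a) y ∧ Sum.elim id K y = t) ↔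
      ∃ y, A.E a y ∧ KA y = t := by
    intro a t
    simp only [compEdge_srcLeft_iff]
    constructor
    · rintro ⟨_, ⟨y, h1, rfl⟩, h2⟩
      exact ⟨y, h1, (hl y).symm.trans h2⟩
    · rintro ⟨y, h1, h2⟩
      exact ⟨_, ⟨y, h1, rfl⟩, (hl y).trans h2⟩
  have keyr : ∀ a t, (∃ y, compEdge A B (compSrcRight A B a) y ∧ Sum.elim id K y = t) ↔
      ∃ y, B.E a y ∧ KB y = t := by
    intro a t
    simp only [compEdge_srcRight_iff]
    constructor
    · rintro ⟨_, ⟨y, h1, rfl⟩, h2⟩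
      exact ⟨y, h1, (hr y).symm.trans h2⟩
    · rintro ⟨y, h1, h2⟩
      exact ⟨_, ⟨y, h1, rfl⟩, (hr y).trans h2⟩
  exact ⟨fun i t => (key _ t).trans (keyl (Sum.inl (Sum.inl i)) t),
    fun j t => (key _ t).trans (keyr (Sum.inl (Sum.inr j)) t),
    fun x t => (key _ t).trans (keyl (Sum.inr x) t),
    fun x t => (key _ t).trans (keyr (Sum.inr x) t)⟩

variable {A B}

theorem comp_E_right {i k r} (h1 : A.E (Sum.inl (Sum.inl i)) (Sum.inr (Sum.inr k)))
    (h2 : B.E (Sum.inl (Sum.inl k)) (Sum.inr (Sum.inr r))) :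
    (A.comp B).E (Sum.inl (Sum.inl i)) (Sum.inr (Sum.inr r)) :=
  Or.inr ⟨Sum.inl k, Sum.inl k, Or.inl ⟨_, _, h1, rfl, rfl⟩, .refl, Or.inr ⟨_, _, h2, rfl, rfl⟩⟩

theorem comp_E_left {j k l} (h1 : B.E (Sum.inl (Sum.inr j)) (Sum.inr (Sum.inl k)))
    (h2 : A.E (Sum.inl (Sum.inr k)) (Sum.inr (Sum.inl l))) :
    (A.comp B).E (Sum.inl (Sum.inr j)) (Sum.inr (Sum.inl l)) :=
  Or.inr ⟨Sum.inr k, Sum.inr k, Or.inr ⟨_, _, h1, rfl, rfl⟩, .refl, Or.inl ⟨_, _, h2, rfl, rfl⟩⟩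

/-- The wire crosses `A`, is turned round in `B` and crosses `A` backwards; this is how a matching
extends along a permutation. -/
theorem comp_E_turn {i k l j} (h1 : A.E (Sum.inl (Sum.inl i)) (Sum.inr (Sum.inr k)))
    (h2 : B.E (Sum.inl (Sum.inl k)) (Sum.inr (Sum.inl l)))
    (h3 : A.E (Sum.inl (Sum.inr l)) (Sum.inr (Sum.inl j))) :
    (A.comp B).E (Sum.inl (Sum.inl i)) (Sum.inr (Sum.inl j)) :=
  Or.inr ⟨Sum.inl k, Sum.inr l, Or.inl ⟨_, _, h1, rfl, rfl⟩,
    .single (Or.inr ⟨_, _, h2, rfl, rfl⟩), Or.inl ⟨_, _, h3, rfl, rfl⟩⟩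

theorem comp_E_direct {i j} (h1 : A.E (Sum.inl (Sum.inl i)) (Sum.inr (Sum.inl j))) :
    (A.comp B).E (Sum.inl (Sum.inl i)) (Sum.inr (Sum.inl j)) :=
  Or.inl (Or.inl ⟨_, _, h1, rfl, rfl⟩)

end comp

/-! ### Edges of a product, and transport of games -/

section tensor

variable {m₁ n₁ m₂ n₂ : Obj} (A : OpenParityGame.{u} M m₁ n₁) (B : OpenParityGame.{u} M m₂ n₂)

theorem tensorEdge_srcLeft_iff (a t) :
    tensorEdge A B (tensorSrcLeft A B a) t ↔ ∃ y, A.E a y ∧ tensorTgtLeft A B y = t := by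
  constructor
  · rintro (⟨a', y, h1, h2, h3⟩ | ⟨a', y, h1, h2, h3⟩)
    · cases tensorSrcLeft_injective A B h2
      exact ⟨y, h1, h3⟩
    · exact absurd h2.symm (tensorSrc_ne A B _ _)
  · rintro ⟨y, h1, h2⟩
    exact Or.inl ⟨a, y, h1, rfl, h2⟩

theorem tensorEdge_srcRight_iff (b t) :
    tensorEdge A B (tensorSrcRight A B b) t ↔ ∃ y, B.E b y ∧ tensorTgtRight A B y = t := by
  constructor
  · rintro (⟨a', y, h1, h2, h3⟩ | ⟨a', y, h1, h2, h3⟩)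
    · exact absurd h2 (tensorSrc_ne A B _ _)
    · cases tensorSrcRight_injective A B h2
      exact ⟨y, h1, h3⟩
  · rintro ⟨y, h1, h2⟩
    exact Or.inr ⟨b, y, h1, rfl, h2⟩

end tensor

/-- Transport only renumbers wires. The existential `φ` avoids computing the positions of a
transported game. -/
theorem cast_spec {m m' n n' : Obj} (hm : m = m') (hn : n = n') (A : OpenParityGame.{u} M m n) :
    ∃ φ : (A.cast hm hn).V ≃ A.V, (∀ x, x ∈ (A.cast hm hn).V₀ ↔ φ x ∈ A.V₀) ∧
      (∀ x, (A.cast hm hn).prio x = A.prio (φ x)) ∧ ∀ s t, (A.cast hm hn).E s t ↔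
        A.E (Sum.map (Sum.map (finCongr (by rw [hm])) (finCongr (by rw [hn]))) φ s)
          (Sum.map φ (Sum.map (finCongr (by rw [hm])) (finCongr (by rw [hn]))) t) := by
  subst hm hn
  refine ⟨Equiv.refl _, fun _ => Iff.rfl, fun _ => rfl, fun s t => ?_⟩
  rcases s with (s | s) | s <;> rcases t with t | t | t <;> exact Iff.rfl

end OpenParityGame

/-! ## Wires of a concatenation of words -/

/-- The left-to-right wires of a word. -/
abbrev RW (v : List Dir) : Type := Fin (interp v).1

/-- The right-to-left wires of a word. -/
abbrev LW (v : List Dir) : Type := Fin (interp v).2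

def appR (v w : List Dir) : RW v ⊕ RW w ≃ RW (v ++ w) :=
  finSumFinEquiv.trans (finCongr (by rw [interp_append]; rfl))

def appL (v w : List Dir) : LW v ⊕ LW w ≃ LW (v ++ w) :=
  finSumFinEquiv.trans (finCongr (by rw [interp_append]; rfl))

theorem val_appR_inr (v w : List Dir) (i : RW w) :
    (appR v w (Sum.inr i)).val = (interp v).1 + i.val := rfl

theorem val_appL_inr (v w : List Dir) (i : LW w) :
    (appL v w (Sum.inr i)).val = (interp v).2 + i.val := rfl

theorem appR_nil (v : List Dir) (i : RW v) : appR [] v (Sum.inr i) = i := by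
  apply Fin.ext
  rw [val_appR_inr]
  exact Nat.zero_add _

theorem appL_nil (v : List Dir) (i : LW v) : appL [] v (Sum.inr i) = i := by
  apply Fin.ext
  rw [val_appL_inr]
  exact Nat.zero_add _

namespace Diagram

open OpenParityGame

variable {M : ℕ}

/-- The sources of edges of a product which lie in the first factor. -/
def srcFst {v₁ w₁ v₂ w₂ : List Dir} {V₁ V₂ V : Type*} (φ : V ≃ V₁ ⊕ V₂) :
    Entries (interp v₁) (interp w₁) ⊕ V₁ → Entries (interp (v₁ ++ v₂)) (interp (w₁ ++ w₂)) ⊕ V :=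
  Sum.map (Sum.map (fun i => appR v₁ v₂ (Sum.inl i)) fun j => appL w₁ w₂ (Sum.inl j))
    fun x => φ.symm (Sum.inl x)

def srcSnd {v₁ w₁ v₂ w₂ : List Dir} {V₁ V₂ V : Type*} (φ : V ≃ V₁ ⊕ V₂) :
    Entries (interp v₂) (interp w₂) ⊕ V₂ → Entries (interp (v₁ ++ v₂)) (interp (w₁ ++ w₂)) ⊕ V :=
  Sum.map (Sum.map (fun i => appR v₁ v₂ (Sum.inr i)) fun j => appL w₁ w₂ (Sum.inr j))
    fun x => φ.symm (Sum.inr x)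

def tgtFst {v₁ w₁ v₂ w₂ : List Dir} {V₁ V₂ V : Type*} (φ : V ≃ V₁ ⊕ V₂) :
    V₁ ⊕ Exits (interp v₁) (interp w₁) → V ⊕ Exits (interp (v₁ ++ v₂)) (interp (w₁ ++ w₂)) :=
  Sum.map (fun x => φ.symm (Sum.inl x))
    (Sum.map (fun j => appL v₁ v₂ (Sum.inl j)) fun i => appR w₁ w₂ (Sum.inl i))

def tgtSnd {v₁ w₁ v₂ w₂ : List Dir} {V₁ V₂ V : Type*} (φ : V ≃ V₁ ⊕ V₂) :
    V₂ ⊕ Exits (interp v₂) (interp w₂) → V ⊕ Exits (interp (v₁ ++ v₂)) (interp (w₁ ++ w₂)) :=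
  Sum.map (fun x => φ.symm (Sum.inr x))
    (Sum.map (fun j => appL v₁ v₂ (Sum.inr j)) fun i => appR w₁ w₂ (Sum.inr i))

/-- The transport along `interp_append` is absorbed here once and for all: `appR` and `appL` number
the wires of the two blocks as the product of games does. -/
theorem tensor_spec {v₁ w₁ v₂ w₂ : List Dir} (c : Diagram M v₁ w₁) (d : Diagram M v₂ w₂) :
    ∃ φ : (c.tensor d).sem.V ≃ c.sem.V ⊕ d.sem.V,
      (∀ x, x ∈ (c.tensor d).sem.V₀ ↔ Sum.elim (· ∈ c.sem.V₀) (· ∈ d.sem.V₀) (φ x)) ∧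
      (∀ x, (c.tensor d).sem.prio x = Sum.elim c.sem.prio d.sem.prio (φ x)) ∧
      (∀ a t, (c.tensor d).sem.E (srcFst φ a) t ↔ ∃ y, c.sem.E a y ∧ tgtFst φ y = t) ∧
      (∀ a t, (c.tensor d).sem.E (srcSnd φ a) t ↔ ∃ y, d.sem.E a y ∧ tgtSnd φ y = t) := by
  obtain ⟨φ, h1, h2, h3⟩ : ∃ φ : (c.tensor d).sem.V ≃ c.sem.V ⊕ d.sem.V, _ :=
    cast_spec (interp_append v₁ v₂).symm (interp_append w₁ w₂).symm (c.sem.tensor d.sem)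
  refine ⟨φ, h1, h2, fun a t => ?_, fun a t => ?_⟩
  · have e1 : Sum.map (Sum.map (finCongr (congrArg Prod.fst (interp_append v₁ v₂)))
        (finCongr (congrArg Prod.snd (interp_append w₁ w₂)))) φ (srcFst φ a) =
        tensorSrcLeft c.sem d.sem a := by
      rcases a with (a | a) | a
      · rfl
      · rfl
      · exact congrArg Sum.inr (φ.apply_symm_apply _)
    have e2 : ∀ y, tensorTgtLeft c.sem d.sem y =
        Sum.map φ (Sum.map (finCongr (congrArg Prod.snd (interp_append v₁ v₂)))
          (finCongr (congrArg Prod.fst (interp_append w₁ w₂)))) (tgtFst φ y) := by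
      rintro (y | y | y)
      · exact congrArg Sum.inl (φ.apply_symm_apply _).symm
      · rfl
      · rfl
    refine ((h3 _ _).trans (iff_of_eq (congrArg (fun s => (c.sem.tensor d.sem).E s _) e1))).trans
      ((tensorEdge_srcLeft_iff _ _ _ _).trans (exists_congr fun y => and_congr_right fun _ => ?_))
    rw [e2]
    exact (Function.Injective.sumMap φ.injective
      (Function.Injective.sumMap (Equiv.injective _) (Equiv.injective _))).eq_iff
  · have e1 : Sum.map (Sum.map (finCongr (congrArg Prod.fst (interp_append v₁ v₂)))
        (finCongr (congrArg Prod.snd (interp_append w₁ w₂)))) φ (srcSnd φ a) =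
        tensorSrcRight c.sem d.sem a := by
      rcases a with (a | a) | a
      · rfl
      · rfl
      · exact congrArg Sum.inr (φ.apply_symm_apply _)
    have e2 : ∀ y, tensorTgtRight c.sem d.sem y =
        Sum.map φ (Sum.map (finCongr (congrArg Prod.snd (interp_append v₁ v₂)))
          (finCongr (congrArg Prod.fst (interp_append w₁ w₂)))) (tgtSnd φ y) := by
      rintro (y | y | y)
      · exact congrArg Sum.inl (φ.apply_symm_apply _).symm
      · rfl
      · rfl
    refine ((h3 _ _).trans (iff_of_eq (congrArg (fun s => (c.sem.tensor d.sem).E s _) e1))).trans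
      ((tensorEdge_srcRight_iff _ _ _ _).trans (exists_congr fun y => and_congr_right fun _ => ?_))
    rw [e2]
    exact (Function.Injective.sumMap φ.injective
      (Function.Injective.sumMap (Equiv.injective _) (Equiv.injective _))).eq_iff

end Diagram

namespace Diagram

open OpenParityGame

variable {M : ℕ}

/-! ## Wirings -/

theorem tensor_E_fst {v₁ w₁ v₂ w₂ : List Dir} {c : Diagram M v₁ w₁} (d : Diagram M v₂ w₂) {e o}
    (h : c.sem.E (Sum.inl e) (Sum.inr o)) : (c.tensor d).sem.E
      (Sum.inl (Sum.map (fun i => appR v₁ v₂ (Sum.inl i)) (fun j => appL w₁ w₂ (Sum.inl j)) e))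
      (Sum.inr (Sum.map (fun j => appL v₁ v₂ (Sum.inl j)) (fun i => appR w₁ w₂ (Sum.inl i)) o)) := by
  obtain ⟨φ, -, -, h1, -⟩ := tensor_spec c d
  exact (h1 (Sum.inl e) _).2 ⟨_, h, rfl⟩

theorem tensor_E_snd {v₁ w₁ v₂ w₂ : List Dir} (c : Diagram M v₁ w₁) {d : Diagram M v₂ w₂} {e o}
    (h : d.sem.E (Sum.inl e) (Sum.inr o)) : (c.tensor d).sem.E
      (Sum.inl (Sum.map (fun i => appR v₁ v₂ (Sum.inr i)) (fun j => appL w₁ w₂ (Sum.inr j)) e))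
      (Sum.inr (Sum.map (fun j => appL v₁ v₂ (Sum.inr j)) (fun i => appR w₁ w₂ (Sum.inr i)) o)) := by
  obtain ⟨φ, -, -, -, h1⟩ := tensor_spec c d
  exact (h1 (Sum.inl e) _).2 ⟨_, h, rfl⟩

theorem isEmpty_tensor {v₁ w₁ v₂ w₂ : List Dir} (c : Diagram M v₁ w₁) (d : Diagram M v₂ w₂)
    [hc : IsEmpty c.sem.V] [hd : IsEmpty d.sem.V] : IsEmpty (c.tensor d).sem.V := by
  obtain ⟨φ, -⟩ := tensor_spec c d
  exact φ.isEmpty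

theorem isEmpty_comp {u v w : List Dir} (c : Diagram M u v) (d : Diagram M v w)
    [hc : IsEmpty c.sem.V] [hd : IsEmpty d.sem.V] : IsEmpty (c.comp d).sem.V :=
  inferInstanceAs (IsEmpty (c.sem.V ⊕ d.sem.V))

instance isEmpty_id (w : List Dir) : IsEmpty (Diagram.id (M := M) w).sem.V :=
  inferInstanceAs (IsEmpty Empty)

theorem id_E_right (w : List Dir) (i : RW w) :
    (Diagram.id (M := M) w).sem.E (Sum.inl (Sum.inl i)) (Sum.inr (Sum.inr i)) :=
  show Equiv.sumComm _ _ (Sum.inl i) = Sum.inr i from rfl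

theorem id_E_left (w : List Dir) (j : LW w) :
    (Diagram.id (M := M) w).sem.E (Sum.inl (Sum.inr j)) (Sum.inr (Sum.inl j)) :=
  show Equiv.sumComm _ _ (Sum.inr j) = Sum.inl j from rfl

theorem swap_spec (v w : List Dir) : IsEmpty (Diagram.swap (M := M) v w).sem.V ∧
    (∀ i, (Diagram.swap (M := M) v w).sem.E (Sum.inl (Sum.inl (appR v w i)))
      (Sum.inr (Sum.inr (appR w v i.swap)))) ∧
    ∀ j, (Diagram.swap (M := M) v w).sem.E (Sum.inl (Sum.inr (appL w v j)))
      (Sum.inr (Sum.inl (appL v w j.swap))) := by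
  obtain ⟨φ, -, -, h⟩ := cast_spec (interp_append v w).symm (interp_append w v).symm
    (swapGame M (interp v) (interp w))
  refine ⟨(φ.isEmpty_congr).2 (inferInstanceAs (IsEmpty Empty)), fun i => ?_, fun j => ?_⟩
  · refine (h _ _).2 ?_
    change Sum.swap (Sum.inl (finAddFlip _)) = Sum.inr _
    refine congrArg Sum.inr ?_
    rcases i with i | i
    · exact finAddFlip_apply_castAdd _ _
    · exact finAddFlip_apply_natAdd _ _
  · refine (h _ _).2 ?_
    change Sum.swap (Sum.inr (finAddFlip _)) = Sum.inl _
    refine congrArg Sum.inl ?_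
    rcases j with j | j
    · exact finAddFlip_apply_castAdd _ _
    · exact finAddFlip_apply_natAdd _ _

/-! ### Permutations of wires -/

/-- Some diagram without internal positions joins the wires of `v` to those of `v'`. -/
def IsPerm (M : ℕ) (v v' : List Dir) (ρ : RW v ≃ RW v') (μ : LW v' ≃ LW v) : Prop :=
  ∃ X : Diagram M v v', IsEmpty X.sem.V ∧
    (∀ i, X.sem.E (Sum.inl (Sum.inl i)) (Sum.inr (Sum.inr (ρ i)))) ∧
    ∀ j, X.sem.E (Sum.inl (Sum.inr j)) (Sum.inr (Sum.inl (μ j)))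

theorem IsPerm.refl (v : List Dir) : IsPerm M v v (Equiv.refl _) (Equiv.refl _) :=
  ⟨Diagram.id v, inferInstance, id_E_right v, id_E_left v⟩

theorem IsPerm.trans {v v' v'' : List Dir} {ρ μ ρ' μ'} (h : IsPerm M v v' ρ μ)
    (h' : IsPerm M v' v'' ρ' μ') : IsPerm M v v'' (ρ.trans ρ') (μ'.trans μ) := by
  obtain ⟨X, h0, h1, h2⟩ := h
  obtain ⟨X', h0', h1', h2'⟩ := h'
  exact ⟨X.comp X', isEmpty_comp X X', fun i => comp_E_right (h1 i) (h1' _),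
    fun j => comp_E_left (h2' j) (h2 _)⟩

theorem IsPerm.swap (v w : List Dir) : IsPerm M (v ++ w) (w ++ v)
    ((appR v w).symm.trans ((Equiv.sumComm _ _).trans (appR w v)))
    ((appL w v).symm.trans ((Equiv.sumComm _ _).trans (appL v w))) := by
  obtain ⟨h0, h1, h2⟩ := swap_spec (M := M) v w
  refine ⟨Diagram.swap v w, h0, fun i => ?_, fun j => ?_⟩
  · obtain ⟨i, rfl⟩ := (appR v w).surjective i
    simpa using h1 i
  · obtain ⟨j, rfl⟩ := (appL w v).surjective j
    simpa using h2 j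

theorem IsPerm.tensor {v v' w w' : List Dir} {ρ μ ρ' μ'} (h : IsPerm M v v' ρ μ)
    (h' : IsPerm M w w' ρ' μ') : IsPerm M (v ++ w) (v' ++ w')
    ((appR v w).symm.trans ((ρ.sumCongr ρ').trans (appR v' w')))
    ((appL v' w').symm.trans ((μ.sumCongr μ').trans (appL v w))) := by
  obtain ⟨X, h0, h1, h2⟩ := h
  obtain ⟨X', h0', h1', h2'⟩ := h'
  refine ⟨X.tensor X', isEmpty_tensor X X', fun i => ?_, fun j => ?_⟩
  · obtain ⟨i | i, rfl⟩ := (appR v w).surjective i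
    · simpa using tensor_E_fst X' (h1 i)
    · simpa using tensor_E_snd X (h1' i)
  · obtain ⟨j | j, rfl⟩ := (appL v' w').surjective j
    · simpa using tensor_E_fst X' (h2 j)
    · simpa using tensor_E_snd X (h2' j)

/-- A wire in the tail is first moved to the front of the tail, then swapped past the head letter.
-/
theorem exists_perm_right (v : List Dir) : ∀ r : RW v, ∃ v' ρ μ,
    IsPerm M v ([Dir.right] ++ v') ρ μ ∧ ρ r = appR [Dir.right] v' (Sum.inl (0 : Fin 1)) := by
  induction v with
  | nil => exact fun r => r.elim0
  | cons c v ih =>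
    intro r
    obtain ⟨r | r, rfl⟩ := (appR [c] v).surjective r
    · cases c
      · refine ⟨v, _, _, IsPerm.refl _, ?_⟩
        obtain rfl : r = (0 : Fin 1) := Subsingleton.elim (α := Fin 1) _ _
        rfl
      · exact Fin.elim0 r
    · obtain ⟨v', ρ, μ, h1, h2⟩ := ih r
      refine ⟨[c] ++ v', _, _, ((IsPerm.refl [c]).tensor h1).trans
        ((IsPerm.swap [c] [Dir.right]).tensor (IsPerm.refl v')), ?_⟩
      -- The same wire of the same word, read in the two bracketings used by the two permutations
      -- being composed.
      have h3 : appR [c] ([Dir.right] ++ v') (Sum.inr (appR [Dir.right] v' (Sum.inl (0 : Fin 1)))) =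
          appR ([c] ++ [Dir.right]) v' (Sum.inl (appR [c] [Dir.right] (Sum.inr (0 : Fin 1)))) := by
        apply Fin.ext
        rfl
      simp only [Equiv.trans_apply, Equiv.symm_apply_apply, Equiv.sumCongr_apply, Sum.map_inr, h2]
      refine (congrArg _ (congrArg _ (congrArg _ h3))).trans ?_
      simp
      rfl

theorem exists_perm_left (v : List Dir) : ∀ l : LW v, ∃ v' ρ μ,
    IsPerm M v ([Dir.left] ++ v') ρ μ ∧ μ (appL [Dir.left] v' (Sum.inl (0 : Fin 1))) = l := by
  induction v with
  | nil => exact fun r => r.elim0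
  | cons c v ih =>
    intro r
    obtain ⟨r | r, rfl⟩ := (appL [c] v).surjective r
    · cases c
      · exact Fin.elim0 r
      · refine ⟨v, _, _, IsPerm.refl _, ?_⟩
        obtain rfl : r = (0 : Fin 1) := Subsingleton.elim (α := Fin 1) _ _
        rfl
    · obtain ⟨v', ρ, μ, h1, h2⟩ := ih r
      refine ⟨[c] ++ v', _, _, ((IsPerm.refl [c]).tensor h1).trans
        ((IsPerm.swap [c] [Dir.left]).tensor (IsPerm.refl v')), ?_⟩
      have h3 : appL [c] ([Dir.left] ++ v') (Sum.inr (appL [Dir.left] v' (Sum.inl (0 : Fin 1)))) =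
          appL ([c] ++ [Dir.left]) v' (Sum.inl (appL [c] [Dir.left] (Sum.inr (0 : Fin 1)))) := by
        apply Fin.ext
        rfl
      have h4 : appL [Dir.left] ([c] ++ v') (Sum.inl (0 : Fin 1)) =
          appL ([Dir.left] ++ [c]) v' (Sum.inl (appL [Dir.left] [c] (Sum.inl (0 : Fin 1)))) := by
        apply Fin.ext
        rfl
      rw [Equiv.trans_apply]
      refine (congrArg _ ((congrArg _ h4).trans ?_)).trans
        ((congrArg _ h3.symm).trans ?_)
      · simp only [Equiv.trans_apply, Equiv.symm_apply_apply, Equiv.sumCongr_apply, Sum.map_inl]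
        rfl
      · simp only [Equiv.trans_apply, Equiv.symm_apply_apply, Equiv.sumCongr_apply, Sum.map_inr, h2]

/-! ### Matchings closed by caps -/

/-- Some diagram without internal positions joins the left-to-right wires of `v` to its
right-to-left wires as prescribed by `f`. -/
def IsMatching (M : ℕ) (v : List Dir) (f : RW v → LW v) : Prop :=
  ∃ X : Diagram M v [], IsEmpty X.sem.V ∧
    ∀ i, X.sem.E (Sum.inl (Sum.inl i)) (Sum.inr (Sum.inl (f i)))

theorem IsPerm.isMatching {v v' : List Dir} {ρ μ} (h : IsPerm M v v' ρ μ) {f : RW v → LW v}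
    (h' : IsMatching M v' fun i => μ.symm (f (ρ.symm i))) : IsMatching M v f := by
  obtain ⟨X, h0, h1, h2⟩ := h
  obtain ⟨Y, h0', h1'⟩ := h'
  refine ⟨X.comp Y, isEmpty_comp X Y, fun i => ?_⟩
  have h3 := h2 (μ.symm (f (ρ.symm (ρ i))))
  rw [Equiv.apply_symm_apply, Equiv.symm_apply_apply] at h3
  have h4 := h1' (ρ i)
  simp only [Equiv.symm_apply_apply] at h4 h3
  exact comp_E_turn (h1 i) h4 h3

/-- A cap joins the first two wires, and the identity carries the others to the remaining matching.
-/
theorem isMatching_cap {v : List Dir} {f : RW ([Dir.left, Dir.right] ++ v) →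
    LW ([Dir.left, Dir.right] ++ v)} {g : RW v → LW v}
    (h0 : f (appR [Dir.left, Dir.right] v (Sum.inl (0 : Fin 1))) =
      appL [Dir.left, Dir.right] v (Sum.inl (0 : Fin 1)))
    (h1 : ∀ i, f (appR [Dir.left, Dir.right] v (Sum.inr i)) =
      appL [Dir.left, Dir.right] v (Sum.inr (g i)))
    (hg : IsMatching M v g) : IsMatching M ([Dir.left, Dir.right] ++ v) f := by
  obtain ⟨Y, hY, hE⟩ := hg
  let c : Diagram M [Dir.left, Dir.right] [] := Diagram.gen Generator.cap
  have hc : IsEmpty c.sem.V := inferInstanceAs (IsEmpty Empty)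
  have := isEmpty_tensor c (Diagram.id v)
  refine ⟨(c.tensor (Diagram.id v)).comp Y, isEmpty_comp (c.tensor (Diagram.id v)) Y, fun i => ?_⟩
  obtain ⟨i | i, rfl⟩ := (appR [Dir.left, Dir.right] v).surjective i
  · obtain rfl : i = (0 : Fin 1) := Subsingleton.elim (α := Fin 1) _ _
    rw [h0]
    have h2 : c.sem.E (Sum.inl (Sum.inl (0 : Fin 1))) (Sum.inr (Sum.inl (0 : Fin 1))) :=
      show Equiv.refl (Fin 1 ⊕ Fin 0) (Sum.inl 0) = Sum.inl 0 from rfl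
    exact comp_E_direct (tensor_E_fst (Diagram.id v) h2)
  · rw [h1]
    have h2 := tensor_E_snd c (id_E_right (M := M) v i)
    have h3 := tensor_E_snd c (id_E_left (M := M) v (g i))
    refine comp_E_turn h2 ?_ h3
    change Y.sem.E (Sum.inl (Sum.inl (appR [] v (Sum.inr i))))
      (Sum.inr (Sum.inl (appL [] v (Sum.inr (g i)))))
    rw [appR_nil, appL_nil]
    exact hE i

theorem eq_nil_of_interp {v : List Dir} (h1 : (interp v).1 = 0) (h2 : (interp v).2 = 0) :
    v = [] := by
  cases v with
  | nil => rfl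
  | cons c v =>
    cases c
    · have : 1 + (interp v).1 = 0 := h1
      omega
    · have : 1 + (interp v).2 = 0 := h2
      omega

/-- A left-to-right wire and its partner are brought to the front and capped; the rest is a smaller
matching. -/
theorem isMatching_of_injective (k : ℕ) : ∀ (v : List Dir) (f : RW v → LW v),
    (interp v).1 = k → (interp v).2 = k → Function.Injective f → IsMatching M v f := by
  induction k with
  | zero =>
    intro v f h1 h2 _
    obtain rfl := eq_nil_of_interp h1 h2
    exact ⟨Diagram.id [], inferInstance, fun i => i.elim0⟩
  | succ k ih =>
    intro v f h1 h2 hf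
    let r : RW v := ⟨0, by omega⟩
    obtain ⟨v₁, ρ, μ, hp, hl⟩ := exists_perm_left (M := M) v (f r)
    refine hp.isMatching ?_
    obtain ⟨r' | r', hr⟩ := (appR [Dir.left] v₁).surjective (ρ r)
    · exact Fin.elim0 r'
    -- The partner already stands first and is left fixed; only the tail is permuted, to bring the
    -- other wire into second place.
    obtain ⟨v₂, ρ', μ', hp', hr'⟩ := exists_perm_right (M := M) v₁ r'
    refine ((IsPerm.refl [Dir.left]).tensor hp').isMatching ?_
    set ρ₂ := (appR [Dir.left] v₁).symm.trans
      (((Equiv.refl _).sumCongr ρ').trans (appR [Dir.left] ([Dir.right] ++ v₂))) with hρ₂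
    set μ₂ := (appL [Dir.left] ([Dir.right] ++ v₂)).symm.trans
      (((Equiv.refl _).sumCongr μ').trans (appL [Dir.left] v₁)) with hμ₂
    change IsMatching M ([Dir.left, Dir.right] ++ v₂) _
    set f' : RW ([Dir.left, Dir.right] ++ v₂) → LW ([Dir.left, Dir.right] ++ v₂) :=
      fun i => μ₂.symm (μ.symm (f (ρ.symm (ρ₂.symm i)))) with hf'
    have hinj : Function.Injective f' :=
      μ₂.symm.injective.comp (μ.symm.injective.comp (hf.comp
        (ρ.symm.injective.comp ρ₂.symm.injective)))
    have h0 : f' (appR [Dir.left, Dir.right] v₂ (Sum.inl (0 : Fin 1))) =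
        appL [Dir.left, Dir.right] v₂ (Sum.inl (0 : Fin 1)) := by
      have e1 : ρ₂ (ρ r) = appR [Dir.left, Dir.right] v₂ (Sum.inl (0 : Fin 1)) := by
        rw [← hr, hρ₂]
        simp only [Equiv.trans_apply, Equiv.symm_apply_apply, Equiv.sumCongr_apply, Sum.map_inr,
          hr']
        rfl
      have e2 : μ₂ (appL [Dir.left, Dir.right] v₂ (Sum.inl (0 : Fin 1))) =
          appL [Dir.left] v₁ (Sum.inl (0 : Fin 1)) := by
        have e3 : appL [Dir.left, Dir.right] v₂ (Sum.inl (0 : Fin 1)) =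
          appL [Dir.left] ([Dir.right] ++ v₂) (Sum.inl (0 : Fin 1)) := rfl
        rw [e3, hμ₂]
        simp only [Equiv.trans_apply, Equiv.symm_apply_apply, Equiv.sumCongr_apply]
        rfl
      rw [← e1, hf']
      simp only [Equiv.symm_apply_apply]
      rw [Equiv.symm_apply_eq, e2, Equiv.symm_apply_eq, hl]
    -- The capped wire already has a partner, so by injectivity the remaining wires are matched
    -- among themselves.
    have hg : ∀ i, ∃ j, f' (appR [Dir.left, Dir.right] v₂ (Sum.inr i)) =
        appL [Dir.left, Dir.right] v₂ (Sum.inr j) := by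
      intro i
      obtain ⟨j | j, hj⟩ := (appL [Dir.left, Dir.right] v₂).surjective
        (f' (appR [Dir.left, Dir.right] v₂ (Sum.inr i)))
      · obtain rfl : j = (0 : Fin 1) := Subsingleton.elim (α := Fin 1) _ _
        have := (appR [Dir.left, Dir.right] v₂).injective (hinj (h0.trans hj))
        cases this
      · exact ⟨j, hj.symm⟩
    choose g hg using hg
    refine isMatching_cap h0 hg (ih v₂ g ?_ ?_ ?_)
    · have e1 := Fin.equiv_iff_eq.1 ⟨ρ⟩
      have e2 := Fin.equiv_iff_eq.1 ⟨ρ₂⟩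
      have e3 : (interp ([Dir.left] ++ ([Dir.right] ++ v₂))).1 = 0 + (1 + (interp v₂).1) := rfl
      omega
    · have e1 := Fin.equiv_iff_eq.1 ⟨μ⟩
      have e2 := Fin.equiv_iff_eq.1 ⟨μ₂⟩
      have e3 : (interp ([Dir.left] ++ ([Dir.right] ++ v₂))).2 = 1 + (0 + (interp v₂).2) := rfl
      omega
    · intro i i' hi
      have h3 := hinj ((hg i).trans ((congrArg _ (congrArg _ hi)).trans (hg i').symm))
      exact Sum.inr_injective ((appR [Dir.left, Dir.right] v₂).injective h3)

end Diagram

namespace Diagram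

open OpenParityGame

variable {M : ℕ}

/-- Some diagram `v → w` is interpreted, up to renaming of internal positions, by the given owner,
priority and edge data. -/
def Realizable {V : Type*} (v w : List Dir) (own : Set V) (pr : V → Fin (M + 1))
    (E : Entries (interp v) (interp w) ⊕ V → V ⊕ Exits (interp v) (interp w) → Prop) : Prop :=
  ∃ d : Diagram M v w, ∃ κ : d.sem.V ≃ V, (∀ x, x ∈ d.sem.V₀ ↔ κ x ∈ own) ∧
    (∀ x, d.sem.prio x = pr (κ x)) ∧ ∀ s t, d.sem.E s t ↔ E (Sum.map _root_.id κ s) (Sum.map κ _root_.id t)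

/-! ## Bending wires -/

/-- The opposite direction. -/
def dual : Dir → Dir
  | Dir.right => Dir.left
  | Dir.left => Dir.right

def dualR : (c : Dir) → RW [dual c] ≃ LW [c]
  | Dir.right => Equiv.refl (Fin 0)
  | Dir.left => Equiv.refl (Fin 1)

def dualL : (c : Dir) → LW [dual c] ≃ RW [c]
  | Dir.right => Equiv.refl (Fin 1)
  | Dir.left => Equiv.refl (Fin 0)

/-- Moving a block of wires from one end of an interface to the other. -/
def bendEquiv {P A B C A' Q : Type*} (e : A ⊕ B ≃ P) (e' : A' ⊕ C ≃ Q) (δ : A ≃ A') :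
    P ⊕ C ≃ B ⊕ Q where
  toFun := Sum.elim (fun p => Sum.elim (fun a => Sum.inr (e' (Sum.inl (δ a)))) Sum.inl (e.symm p))
    fun c => Sum.inr (e' (Sum.inr c))
  invFun := Sum.elim (fun b => Sum.inl (e (Sum.inr b)))
    fun q => Sum.elim (fun a => Sum.inl (e (Sum.inl (δ.symm a)))) Sum.inr (e'.symm q)
  left_inv := by
    rintro (p | c)
    · obtain ⟨a | b, rfl⟩ := e.surjective p <;> simp
    · simp
  right_inv := by
    rintro (b | q)
    · simp
    · obtain ⟨a | b, rfl⟩ := e'.surjective q <;> simp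

/-- A letter in the codomain and its dual in the domain supply the same kind of end, so bending
merely renames entries and exits. -/
def bendEntries (c : Dir) (v w : List Dir) :
    Entries (interp ([dual c] ++ v)) (interp w) ≃ Entries (interp v) (interp ([c] ++ w)) :=
  bendEquiv (appR [dual c] v) (appL [c] w) (dualR c)

def bendExits (c : Dir) (v w : List Dir) :
    Exits (interp ([dual c] ++ v)) (interp w) ≃ Exits (interp v) (interp ([c] ++ w)) :=
  bendEquiv (appL [dual c] v) (appR [c] w) (dualL c)

theorem bendEntries_dual (c : Dir) (v w : List Dir) (k) :
    bendEntries c v w (Sum.inl (appR [dual c] v (Sum.inl k))) =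
      Sum.inr (appL [c] w (Sum.inl (dualR c k))) := by
  simp [bendEntries, bendEquiv]

theorem bendEntries_inl (c : Dir) (v w : List Dir) (i) :
    bendEntries c v w (Sum.inl (appR [dual c] v (Sum.inr i))) = Sum.inl i := by
  simp [bendEntries, bendEquiv]

theorem bendEntries_inr (c : Dir) (v w : List Dir) (j) :
    bendEntries c v w (Sum.inr j) = Sum.inr (appL [c] w (Sum.inr j)) := rfl

theorem bendExits_dual (c : Dir) (v w : List Dir) (k) :
    bendExits c v w (Sum.inl (appL [dual c] v (Sum.inl k))) =
      Sum.inr (appR [c] w (Sum.inl (dualL c k))) := by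
  simp [bendExits, bendEquiv]

theorem bendExits_inl (c : Dir) (v w : List Dir) (j) :
    bendExits c v w (Sum.inl (appL [dual c] v (Sum.inr j))) = Sum.inl j := by
  simp [bendExits, bendEquiv]

/-- The cup opening a pair of opposite wires in either order. -/
theorem exists_cup (c : Dir) : ∃ C : Diagram M [] ([c] ++ [dual c]), IsEmpty C.sem.V ∧
    (∀ k, C.sem.E (Sum.inl (Sum.inr (appL [c] [dual c] (Sum.inl (dualR c k)))))
      (Sum.inr (Sum.inr (appR [c] [dual c] (Sum.inr k))))) ∧
    ∀ k, C.sem.E (Sum.inl (Sum.inr (appL [c] [dual c] (Sum.inr k))))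
      (Sum.inr (Sum.inr (appR [c] [dual c] (Sum.inl (dualL c k))))) := by
  -- With no position, one entry and one exit, there is only one possible edge; so the edges of the
  -- cup composed with a swap need not be computed.
  have key : ∀ C : Diagram M [] ([c] ++ [dual c]), IsEmpty C.sem.V → ∀ j i,
      C.sem.E (Sum.inl (Sum.inr j)) (Sum.inr (Sum.inr i)) := by
    intro C hC j i
    obtain ⟨t, ht, -⟩ := C.sem.entry_unique (Sum.inr j)
    rcases t with x | k | i'
    · exact hC.elim x
    · exact Fin.elim0 k
    · have : i' = i := by cases c <;> exact Subsingleton.elim (α := Fin 1) _ _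
      rwa [← this]
  have hcup : IsEmpty (Diagram.gen (M := M) Generator.cup).sem.V := inferInstanceAs (IsEmpty Empty)
  obtain ⟨C, hC⟩ : ∃ C : Diagram M [] ([c] ++ [dual c]), IsEmpty C.sem.V := by
    cases c
    · exact ⟨Diagram.gen Generator.cup, hcup⟩
    · have := (swap_spec (M := M) [Dir.right] [Dir.left]).1
      exact ⟨(Diagram.gen Generator.cup).comp (Diagram.swap [Dir.right] [Dir.left]),
        isEmpty_comp (Diagram.gen Generator.cup) (Diagram.swap [Dir.right] [Dir.left])⟩
  exact ⟨C, hC, fun k => key C hC _ _, fun k => key C hC _ _⟩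

theorem appR_cons_dual (c c' : Dir) (v : List Dir) (k) :
    appR ([c] ++ [c']) v (Sum.inl (appR [c] [c'] (Sum.inr k))) =
      appR [c] ([c'] ++ v) (Sum.inr (appR [c'] v (Sum.inl k))) := Fin.ext rfl

theorem appR_cons_fst (c c' : Dir) (v : List Dir) (k) :
    appR ([c] ++ [c']) v (Sum.inl (appR [c] [c'] (Sum.inl k))) =
      appR [c] ([c'] ++ v) (Sum.inl k) := Fin.ext rfl

theorem appR_cons_snd (c c' : Dir) (v : List Dir) (k) :
    appR ([c] ++ [c']) v (Sum.inr k) =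
      appR [c] ([c'] ++ v) (Sum.inr (appR [c'] v (Sum.inr k))) := by
  apply Fin.ext
  simp only [val_appR_inr]
  simp [interp, add_assoc]

theorem appL_cons_dual (c c' : Dir) (v : List Dir) (k) :
    appL ([c] ++ [c']) v (Sum.inl (appL [c] [c'] (Sum.inr k))) =
      appL [c] ([c'] ++ v) (Sum.inr (appL [c'] v (Sum.inl k))) := Fin.ext rfl

theorem appL_cons_fst (c c' : Dir) (v : List Dir) (k) :
    appL ([c] ++ [c']) v (Sum.inl (appL [c] [c'] (Sum.inl k))) =
      appL [c] ([c'] ++ v) (Sum.inl k) := Fin.ext rfl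

theorem appL_cons_snd (c c' : Dir) (v : List Dir) (k) :
    appL ([c] ++ [c']) v (Sum.inr k) =
      appL [c] ([c'] ++ v) (Sum.inr (appL [c'] v (Sum.inr k))) := by
  apply Fin.ext
  simp only [val_appL_inr]
  simp [interp, add_assoc]

theorem eq_of_entry {m n : Obj} {A : OpenParityGame.{u} M m n} {e t t'} (h : A.E (Sum.inl e) t)
    (h' : A.E (Sum.inl e) t') : t = t' :=
  (A.entry_unique e).unique h h'

/-- Bending the first wire of the codomain into the domain. -/
theorem exists_bend {c : Dir} {v w : List Dir} (d : Diagram M ([dual c] ++ v) w) :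
    ∃ D : Diagram M v ([c] ++ w), ∃ ψ : D.sem.V ≃ d.sem.V,
      (∀ x, x ∈ D.sem.V₀ ↔ ψ x ∈ d.sem.V₀) ∧ (∀ x, D.sem.prio x = d.sem.prio (ψ x)) ∧
      ∀ s t, D.sem.E (Sum.map (bendEntries c v w) ψ.symm s) t ↔
        ∃ y, d.sem.E s y ∧ Sum.map ψ.symm (bendExits c v w) y = t := by
  obtain ⟨C, hC, hC1, hC2⟩ := exists_cup (M := M) c
  let X : Diagram M ([] ++ v) (([c] ++ [dual c]) ++ v) := C.tensor (Diagram.id v)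
  let Y : Diagram M ([c] ++ ([dual c] ++ v)) ([c] ++ w) := (Diagram.id [c]).tensor d
  have hX : IsEmpty X.sem.V := isEmpty_tensor C (Diagram.id v)
  obtain ⟨φ, h1, h2, h3, h4⟩ := tensor_spec (Diagram.id (M := M) [c]) d
  let D : Diagram M v ([c] ++ w) := Diagram.comp (v := [c] ++ ([dual c] ++ v)) X Y
  let ψ₀ : Y.sem.V ≃ d.sem.V := φ.trans (Equiv.emptySum _ _)
  have hψ₀ : ∀ x, φ x = Sum.inr (ψ₀ x) := by
    intro x
    rcases hx : φ x with y | y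
    · exact isEmptyElim y
    · simp [ψ₀, hx]
  have hψ₀' : ∀ x, φ.symm (Sum.inr x) = ψ₀.symm x := by
    intro x
    rw [Equiv.symm_apply_eq, hψ₀, Equiv.apply_symm_apply]
  let ψ : D.sem.V ≃ d.sem.V := (Equiv.emptySum X.sem.V Y.sem.V).trans ψ₀
  let K : d.sem.V ⊕ Exits (interp ([dual c] ++ v)) (interp w) →
    (X.sem.V ⊕ Y.sem.V) ⊕ Exits (interp v) (interp ([c] ++ w)) :=
    Sum.map ψ.symm (bendExits c v w)
  -- After leaving `X` to the right, the wire of `c` passes straight to the codomain, while the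
  -- other wires enter `d`.
  let KA : X.sem.V ⊕ Exits (interp v) (interp ([c] ++ ([dual c] ++ v))) →
    (X.sem.V ⊕ Y.sem.V) ⊕ Exits (interp v) (interp ([c] ++ w)) :=
    Sum.elim (fun x => Sum.inl (Sum.inl x)) (Sum.elim (fun j => Sum.inr (Sum.inl j))
      fun i => Sum.elim (fun k => Sum.inr (Sum.inr (appR [c] w (Sum.inl k))))
        (fun i => K (d.sem.entryTarget (Sum.inl i))) ((appR [c] ([dual c] ++ v)).symm i))
  -- After leaving `Y` to the left, the wire of `c` is turned by the cup into the dual wire entering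
  -- `d`; exits of `d` end at their bent position.
  let KB : Y.sem.V ⊕ Exits (interp ([c] ++ ([dual c] ++ v))) (interp ([c] ++ w)) →
    (X.sem.V ⊕ Y.sem.V) ⊕ Exits (interp v) (interp ([c] ++ w)) :=
    Sum.elim (fun x => Sum.inl (Sum.inr x)) (Sum.elim
      (fun j => Sum.elim (fun k => K (d.sem.entryTarget
          (Sum.inl (appR [dual c] v (Sum.inl ((dualR c).symm k))))))
        (fun j => Sum.inr (bendExits c v w (Sum.inl j))) ((appL [c] ([dual c] ++ v)).symm j))
      fun i => Sum.inr (Sum.inr i))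
  have hKA1 : ∀ k, KA (Sum.inr (Sum.inr (appR [c] ([dual c] ++ v) (Sum.inl k)))) =
      Sum.inr (Sum.inr (appR [c] w (Sum.inl k))) := by
    intro k
    simp [KA]
  have hKA2 : ∀ i, KA (Sum.inr (Sum.inr (appR [c] ([dual c] ++ v) (Sum.inr i)))) =
      K (d.sem.entryTarget (Sum.inl i)) := by
    intro k
    simp [KA]
  have hKB1 : ∀ k, KB (Sum.inr (Sum.inl (appL [c] ([dual c] ++ v) (Sum.inl (dualR c k))))) =
      K (d.sem.entryTarget (Sum.inl (appR [dual c] v (Sum.inl k)))) := by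
    intro k
    simp [KB]
  have hKB2 : ∀ j, KB (Sum.inr (Sum.inl (appL [c] ([dual c] ++ v) (Sum.inr j)))) =
      Sum.inr (bendExits c v w (Sum.inl j)) := by
    intro k
    simp [KB]
  have hKB3 : ∀ y, KB (tgtSnd (v₁ := [c]) (w₁ := [c]) φ y) = K y := by
    rintro (x | j | i)
    · exact congrArg (fun x => Sum.inl (Sum.inr x)) (hψ₀' x)
    · exact hKB2 j
    · rfl
  have hent : ∀ e t, (∃ y, d.sem.E (Sum.inl e) y ∧ K y = t) ↔ K (d.sem.entryTarget e) = t := by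
    intro e t
    constructor
    · rintro ⟨y, hy, rfl⟩
      rw [(d.sem.entryTarget_eq_iff e y).2 hy]
    · intro h
      exact ⟨_, (d.sem.entryTarget_eq_iff e _).1 rfl, h⟩
  have hXr : ∀ i, X.sem.E (Sum.inl (Sum.inl i))
      (Sum.inr (Sum.inr (appR [c] ([dual c] ++ v) (Sum.inr (appR [dual c] v (Sum.inr i)))))) := by
    intro i
    have := tensor_E_snd C (id_E_right (M := M) v i)
    simp only [Sum.map_inl, Sum.map_inr, appR_nil, appR_cons_snd] at this
    exact this
  have hXl : ∀ j, X.sem.E (Sum.inl (Sum.inr (appL [c] ([dual c] ++ v)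
      (Sum.inr (appL [dual c] v (Sum.inr j)))))) (Sum.inr (Sum.inl j)) := by
    intro i
    have := tensor_E_snd C (id_E_left (M := M) v i)
    simp only [Sum.map_inl, Sum.map_inr, appL_nil, appL_cons_snd] at this
    exact this
  have hXc1 : ∀ k, X.sem.E (Sum.inl (Sum.inr (appL [c] ([dual c] ++ v) (Sum.inl (dualR c k)))))
      (Sum.inr (Sum.inr (appR [c] ([dual c] ++ v) (Sum.inr (appR [dual c] v (Sum.inl k)))))) := by
    intro k
    have := tensor_E_fst (Diagram.id v) (hC1 k)
    simp only [Sum.map_inr, appL_cons_fst, appR_cons_dual] at this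
    exact this
  have hXc2 : ∀ k, X.sem.E (Sum.inl (Sum.inr (appL [c] ([dual c] ++ v)
      (Sum.inr (appL [dual c] v (Sum.inl k))))))
      (Sum.inr (Sum.inr (appR [c] ([dual c] ++ v) (Sum.inl (dualL c k))))) := by
    intro k
    have := tensor_E_fst (Diagram.id v) (hC2 k)
    simp only [Sum.map_inr, appL_cons_dual, appR_cons_fst] at this
    exact this
  obtain ⟨hr, hl, -, hV⟩ := comp_E_iff (m := interp v) (n := interp ([c] ++ ([dual c] ++ v)))
    (o := interp ([c] ++ w)) X.sem Y.sem KA KB (fun _ => rfl) (fun _ => rfl) (fun _ => rfl)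
    (fun _ => rfl) (by
      intro i t ht
      obtain ⟨k | i, rfl⟩ := (appR [c] ([dual c] ++ v)).surjective i
      · obtain ⟨y, hy, rfl⟩ := (h3 (Sum.inl (Sum.inl k)) t).1 ht
        obtain rfl := eq_of_entry hy (id_E_right [c] k)
        rw [hKA1]
        rfl
      · obtain ⟨y, hy, rfl⟩ := (h4 (Sum.inl (Sum.inl i)) t).1 ht
        rw [hKA2, hKB3, (d.sem.entryTarget_eq_iff _ y).2 hy]) (by
      intro j t ht
      obtain ⟨k | j, rfl⟩ := (appL [c] ([dual c] ++ v)).surjective j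
      · obtain ⟨k, rfl⟩ := (dualR c).surjective k
        obtain rfl := eq_of_entry ht (hXc1 k)
        rw [hKB1, hKA2]
      · rw [hKB2]
        obtain ⟨k | j, rfl⟩ := (appL [dual c] v).surjective j
        · obtain rfl := eq_of_entry ht (hXc2 k)
          rw [hKA1, bendExits_dual]
        · obtain rfl := eq_of_entry ht (hXl j)
          rw [bendExits_inl]
          rfl)
  refine ⟨D, ψ, ?_, ?_, ?_⟩
  · rintro (x | x)
    · exact isEmptyElim x
    · refine (h1 x).trans ?_
      rw [hψ₀]
      rfl
  · rintro (x | x)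
    · exact isEmptyElim x
    · refine (h2 x).trans ?_
      rw [hψ₀]
      rfl
  · change ∀ s t, _ ↔ ∃ y, d.sem.E s y ∧ K y = t
    rintro ((i | j) | x) t
    · obtain ⟨k | i, rfl⟩ := (appR [dual c] v).surjective i
      · rw [Sum.map_inl, bendEntries_dual, hent]
        refine (hl _ t).trans ?_
        constructor
        · rintro ⟨y, hy, rfl⟩
          obtain ⟨y', hy', rfl⟩ := (h3 (Sum.inl (Sum.inr (dualR c k))) y).1 hy
          obtain rfl := eq_of_entry hy' (id_E_left [c] _)
          exact (hKB1 k).symm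
        · intro h
          exact ⟨_, (h3 (Sum.inl (Sum.inr (dualR c k))) _).2 ⟨_, id_E_left [c] _, rfl⟩,
            (hKB1 k).trans h⟩
      · rw [Sum.map_inl, bendEntries_inl, hent]
        refine (hr _ t).trans ?_
        constructor
        · rintro ⟨y, hy, rfl⟩
          obtain rfl := eq_of_entry hy (hXr i)
          exact (hKA2 _).symm
        · intro h
          exact ⟨_, hXr i, (hKA2 _).trans h⟩
    · rw [Sum.map_inl, bendEntries_inr]
      refine (hl _ t).trans ?_
      constructor
      · rintro ⟨y, hy, rfl⟩
        obtain ⟨y', hy', rfl⟩ := (h4 (Sum.inl (Sum.inr j)) y).1 hy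
        exact ⟨y', hy', (hKB3 y').symm⟩
      · rintro ⟨y, hy, rfl⟩
        exact ⟨_, (h4 (Sum.inl (Sum.inr j)) _).2 ⟨y, hy, rfl⟩, hKB3 y⟩
    · refine (hV _ t).trans ?_
      rw [← hψ₀']
      constructor
      · rintro ⟨y, hy, rfl⟩
        obtain ⟨y', hy', rfl⟩ := (h4 (Sum.inr x) y).1 hy
        exact ⟨y', hy', (hKB3 y').symm⟩
      · rintro ⟨y, hy, rfl⟩
        exact ⟨_, (h4 (Sum.inr x) _).2 ⟨y, hy, rfl⟩, hKB3 y⟩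

theorem Realizable.bend {V : Type*} {c : Dir} {v w : List Dir} {own : Set V}
    {pr : V → Fin (M + 1)}
    {E : Entries (interp v) (interp ([c] ++ w)) ⊕ V →
      V ⊕ Exits (interp v) (interp ([c] ++ w)) → Prop}
    (h : Realizable ([dual c] ++ v) w own pr fun s t =>
      E (Sum.map (bendEntries c v w) _root_.id s) (Sum.map _root_.id (bendExits c v w) t)) :
    Realizable v ([c] ++ w) own pr E := by
  obtain ⟨d, κ, h1, h2, h3⟩ := h
  obtain ⟨D, ψ, h1', h2', h3'⟩ := exists_bend d
  refine ⟨D, ψ.trans κ, fun x => (h1' x).trans (h1 _), fun x => (h2' x).trans (h2 _),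
    fun s t => ?_⟩
  obtain ⟨s, rfl⟩ : ∃ s', Sum.map (bendEntries c v w) ψ.symm s' = s :=
    ⟨Sum.map (bendEntries c v w).symm ψ s, by simp [Sum.map_map]⟩
  obtain ⟨t, rfl⟩ : ∃ t', Sum.map ψ.symm (bendExits c v w) t' = t :=
    ⟨Sum.map ψ (bendExits c v w).symm t, by simp [Sum.map_map]⟩
  rw [h3']
  have hinj : Function.Injective (Sum.map ψ.symm (bendExits c v w)) :=
    Function.Injective.sumMap ψ.symm.injective (bendExits c v w).injective
  have h4 : (∃ y, d.sem.E s y ∧ Sum.map ψ.symm (bendExits c v w) y =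
      Sum.map ψ.symm (bendExits c v w) t) ↔ d.sem.E s t := by
    constructor
    · rintro ⟨y, hy, heq⟩
      rwa [← hinj heq]
    · intro h
      exact ⟨t, h, rfl⟩
  rw [h4, h3]
  simp only [Sum.map_map]
  refine iff_of_eq (congrArg₂ E ?_ ?_)
  · rcases s with s | s <;> simp
  · rcases t with t | t <;> simp

end Diagram

namespace Diagram

open OpenParityGame

variable {M : ℕ}

/-! ## Single positions -/

/-- The edges of a game with a single internal position joined to the whole interface. -/
def nodeEdge {I O : Type*} : I ⊕ Unit → Unit ⊕ O → Prop
  | Sum.inl _, Sum.inl _ => True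
  | Sum.inr _, Sum.inr _ => True
  | _, _ => False

/-- Some diagram `v → w` has a single internal position, joined to the whole interface. -/
def NodeRealizable (v w : List Dir) (own : Set Unit) (p : Fin (M + 1)) : Prop :=
  Realizable v w own (fun _ : Unit => p) nodeEdge

theorem nodeRealizable_of_gen {v w : List Dir} (g : Generator M v w) {own : Set Unit}
    {p : Fin (M + 1)} (κ : g.sem.V ≃ Unit) (h1 : ∀ x, x ∈ g.sem.V₀ ↔ κ x ∈ own)
    (h2 : ∀ x, g.sem.prio x = p)
    (h3 : ∀ s t, g.sem.E s t ↔ nodeEdge (Sum.map _root_.id κ s) (Sum.map κ _root_.id t)) :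
    NodeRealizable v w own p :=
  ⟨Diagram.gen g, κ, h1, h2, h3⟩

/-- The edges of a single position do not distinguish between its ports, so renaming the interface
leaves them unchanged. -/
theorem NodeRealizable.bend {c : Dir} {v w : List Dir} {own : Set Unit} {p : Fin (M + 1)}
    (h : NodeRealizable (dual c :: v) w own p) : NodeRealizable v (c :: w) own p := by
  refine Realizable.bend (c := c) (v := v) (w := w) ?_
  have h1 : (fun s t => nodeEdge (Sum.map (bendEntries c v w) _root_.id s)
      (Sum.map _root_.id (bendExits c v w) t)) = nodeEdge := by
    funext s t
    rcases s with s | s <;> rcases t with t | t <;> rfl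
  rw [h1]
  exact h

theorem node_E_iff {own : Set Unit} {p : Fin (M + 1)} {a b : ℕ} (s t) :
    (node own p a b).E s t ↔
      nodeEdge (Sum.map _root_.id (Equiv.refl Unit) s) (Sum.map (Equiv.refl Unit) _root_.id t) := by
  rcases s with s | s <;> rcases t with t | t <;> exact Iff.rfl

theorem nodeRealizable_start : NodeRealizable [] [Dir.right] ∅ (0 : Fin (M + 1)) :=
  nodeRealizable_of_gen Generator.start (Equiv.refl Unit) (fun _ => Iff.rfl) (fun _ => rfl)
    node_E_iff

theorem nodeRealizable_merge :
    NodeRealizable [] [Dir.left, Dir.left, Dir.right] ∅ (0 : Fin (M + 1)) :=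
  NodeRealizable.bend (NodeRealizable.bend (nodeRealizable_of_gen Generator.merge
    (Equiv.refl Unit) (fun _ => Iff.rfl) (fun _ => rfl) node_E_iff))

theorem nodeRealizable_priority (p : Fin (M + 1)) :
    NodeRealizable [] [Dir.left, Dir.right] ∅ p :=
  NodeRealizable.bend (nodeRealizable_of_gen (Generator.priority p)
    (Equiv.refl Unit) (fun _ => Iff.rfl) (fun _ => rfl) node_E_iff)

theorem nodeRealizable_player (own : Prop) :
    NodeRealizable [] [Dir.left, Dir.right, Dir.right] (Set.ofPred fun _ => own)
      (0 : Fin (M + 1)) := by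
  refine NodeRealizable.bend ?_
  by_cases h : own
  · exact nodeRealizable_of_gen Generator.player0 (Equiv.refl Unit)
      (fun _ => ⟨fun _ => h, fun _ => trivial⟩) (fun _ => rfl) node_E_iff
  · exact nodeRealizable_of_gen Generator.player1 (Equiv.refl Unit)
      (fun _ => ⟨fun hx => hx.elim, fun hx => h hx⟩) (fun _ => rfl) node_E_iff

theorem nodeRealizable_lose (own : Prop) :
    NodeRealizable [] [Dir.left] (Set.ofPred fun _ => own) (0 : Fin (M + 1)) := by
  refine NodeRealizable.bend ?_
  by_cases h : own
  · exact nodeRealizable_of_gen Generator.lose0 (Equiv.refl Unit)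
      (fun _ => ⟨fun _ => h, fun _ => trivial⟩) (fun _ => rfl) node_E_iff
  · exact nodeRealizable_of_gen Generator.lose1 (Equiv.refl Unit)
      (fun _ => ⟨fun hx => hx.elim, fun hx => h hx⟩) (fun _ => rfl) node_E_iff

/-! ## Nets -/

/-- Regarding the ports of one position as part of the interface. -/
def absorb {V : Type*} {f : Option V → Type} {P B C : Type*} (e : f none ⊕ B ≃ P) :
    (P ⊕ C) ⊕ (Σ x : V, f (some x)) ≃ (B ⊕ C) ⊕ (Σ x : Option V, f x) where
  toFun
    | Sum.inl (Sum.inl p) => Sum.elim (fun a => Sum.inr ⟨none, a⟩)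
        (fun b => Sum.inl (Sum.inl b)) (e.symm p)
    | Sum.inl (Sum.inr c) => Sum.inl (Sum.inr c)
    | Sum.inr ⟨x, k⟩ => Sum.inr ⟨some x, k⟩
  invFun
    | Sum.inl (Sum.inl b) => Sum.inl (Sum.inl (e (Sum.inr b)))
    | Sum.inl (Sum.inr c) => Sum.inl (Sum.inr c)
    | Sum.inr ⟨none, a⟩ => Sum.inl (Sum.inl (e (Sum.inl a)))
    | Sum.inr ⟨some x, k⟩ => Sum.inr ⟨x, k⟩
  left_inv := by
    rintro ((p | c) | ⟨x, k⟩)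
    · obtain ⟨a | b, rfl⟩ := e.surjective p <;> simp
    · rfl
    · rfl
  right_inv := by
    rintro ((b | c) | ⟨x | x, k⟩) <;> simp

theorem absorb_port {V : Type*} {f : Option V → Type} {P B C : Type*} (e : f none ⊕ B ≃ P) (a) :
    absorb (C := C) e (Sum.inl (Sum.inl (e (Sum.inl a)))) = Sum.inr ⟨none, a⟩ := by
  simp [absorb]

theorem absorb_wire {V : Type*} {f : Option V → Type} {P B C : Type*} (e : f none ⊕ B ≃ P) (b) :
    absorb (C := C) e (Sum.inl (Sum.inl (e (Sum.inr b)))) = Sum.inl (Sum.inl b) := by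
  simp [absorb]

/-- Attaching a single position to the first wires of the domain of a diagram. -/
theorem exists_plug {u v : List Dir} {own : Set Unit} {p : Fin (M + 1)}
    (hN : NodeRealizable [] u own p) (d : Diagram M (u ++ v) []) :
    ∃ D : Diagram M v [], ∃ ψ : D.sem.V ≃ Option d.sem.V,
      (∀ x, x ∈ D.sem.V₀ ↔ (ψ x).elim (() ∈ own) (· ∈ d.sem.V₀)) ∧
      (∀ x, D.sem.prio x = (ψ x).elim p d.sem.prio) ∧
      ∃ K : d.sem.V ⊕ Exits (interp (u ++ v)) (interp []) →
          D.sem.V ⊕ Exits (interp v) (interp []),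
        (∀ x, K (Sum.inl x) = Sum.inl (ψ.symm (some x))) ∧
        (∀ k, K (Sum.inr (Sum.inl (appL u v (Sum.inl k)))) = Sum.inl (ψ.symm none)) ∧
        (∀ j, K (Sum.inr (Sum.inl (appL u v (Sum.inr j)))) = Sum.inr (Sum.inl j)) ∧
        (∀ i t, D.sem.E (Sum.inl (Sum.inl i)) t ↔
          ∃ y, d.sem.E (Sum.inl (Sum.inl (appR u v (Sum.inr i)))) y ∧ K y = t) ∧
        (∀ t, D.sem.E (Sum.inr (ψ.symm none)) t ↔
          ∃ k y, d.sem.E (Sum.inl (Sum.inl (appR u v (Sum.inl k)))) y ∧ K y = t) ∧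
        ∀ x t, D.sem.E (Sum.inr (ψ.symm (some x))) t ↔
          ∃ y, d.sem.E (Sum.inr x) y ∧ K y = t := by
  obtain ⟨N, κ, hN1, hN2, hN3⟩ := hN
  let X : Diagram M ([] ++ v) (u ++ v) := N.tensor (Diagram.id v)
  obtain ⟨φ, h1, h2, h3, -⟩ := tensor_spec N (Diagram.id v)
  let D : Diagram M v [] := Diagram.comp (u := v) (v := u ++ v) X d
  let ξ : X.sem.V ≃ Unit := (φ.trans (Equiv.sumEmpty _ _)).trans κ
  have hφ : ∀ x : X.sem.V, φ x = Sum.inl (κ.symm ()) := by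
    intro x
    rcases hx : φ x with y | y
    · exact congrArg Sum.inl (κ.injective rfl)
    · exact isEmptyElim y
  let x₀ : X.sem.V := ξ.symm ()
  have hx₀ : ∀ x : X.sem.V, x = x₀ := fun x => ξ.injective rfl
  let ψ : D.sem.V ≃ Option d.sem.V :=
    ((ξ.sumCongr (Equiv.refl d.sem.V)).trans (Equiv.sumComm _ _)).trans
      (Equiv.optionEquivSumPUnit _).symm
  -- Exits of `d` in the block `u` lead to the new position `x₀`; those in the block `v` pass
  -- through the identity.
  let KB : d.sem.V ⊕ Exits (interp (u ++ v)) (interp []) →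
      (X.sem.V ⊕ d.sem.V) ⊕ Exits (interp v) (interp []) :=
    Sum.elim (fun x => Sum.inl (Sum.inr x)) (Sum.elim (fun j =>
      Sum.elim (fun _ => Sum.inl (Sum.inl x₀)) (fun j => Sum.inr (Sum.inl j)) ((appL u v).symm j))
      fun i => Sum.inr (Sum.inr i))
  have hK1 : ∀ k, KB (Sum.inr (Sum.inl (appL u v (Sum.inl k)))) = Sum.inl (Sum.inl x₀) := by
    intro k
    simp [KB]
  have hK2 : ∀ j, KB (Sum.inr (Sum.inl (appL u v (Sum.inr j)))) = Sum.inr (Sum.inl j) := by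
    intro j
    simp [KB]
  let KA : X.sem.V ⊕ Exits (interp v) (interp (u ++ v)) →
      (X.sem.V ⊕ d.sem.V) ⊕ Exits (interp v) (interp []) :=
    Sum.elim (fun x => Sum.inl (Sum.inl x)) (Sum.elim (fun j => Sum.inr (Sum.inl j))
      fun i => KB (d.sem.entryTarget (Sum.inl i)))
  have hent : ∀ e t, (∃ y, d.sem.E (Sum.inl e) y ∧ KB y = t) ↔ KB (d.sem.entryTarget e) = t := by
    intro e t
    constructor
    · rintro ⟨y, hy, rfl⟩
      rw [(d.sem.entryTarget_eq_iff e y).2 hy]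
    · intro h
      exact ⟨_, (d.sem.entryTarget_eq_iff e _).1 rfl, h⟩
  have hXr : ∀ i, X.sem.E (Sum.inl (Sum.inl i)) (Sum.inr (Sum.inr (appR u v (Sum.inr i)))) := by
    intro i
    have := tensor_E_snd N (id_E_right (M := M) v i)
    simp only [Sum.map_inl, Sum.map_inr, appR_nil] at this
    exact this
  have hXl : ∀ j, X.sem.E (Sum.inl (Sum.inr (appL u v (Sum.inr j)))) (Sum.inr (Sum.inl j)) := by
    intro j
    have := tensor_E_snd N (id_E_left (M := M) v j)
    simp only [Sum.map_inl, Sum.map_inr, appL_nil] at this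
    exact this
  have hXn : ∀ k, X.sem.E (Sum.inl (Sum.inr (appL u v (Sum.inl k)))) (Sum.inl x₀) := by
    intro k
    refine (h3 (Sum.inl (Sum.inr k)) _).2 ⟨Sum.inl (κ.symm ()), (hN3 _ _).2 trivial, ?_⟩
    exact congrArg Sum.inl (hx₀ _)
  have hX0 : ∀ t, X.sem.E (Sum.inr x₀) t ↔ ∃ k, t = Sum.inr (Sum.inr (appR u v (Sum.inl k))) := by
    intro t
    have h5 : (Sum.inr x₀ : Entries (interp v) (interp (u ++ v)) ⊕ X.sem.V) =
        srcFst (v₁ := []) (v₂ := v) (w₁ := u) (w₂ := v) φ (Sum.inr (κ.symm ())) := congrArg Sum.inr (hx₀ _).symm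
    rw [h5]
    refine (h3 (Sum.inr (κ.symm ())) t).trans ?_
    constructor
    · rintro ⟨y, hy, rfl⟩
      rcases y with y | k | k
      · exact ((hN3 _ _).1 hy).elim
      · exact Fin.elim0 k
      · exact ⟨k, rfl⟩
    · rintro ⟨k, rfl⟩
      exact ⟨Sum.inr (Sum.inr k), (hN3 _ _).2 trivial, rfl⟩
  obtain ⟨hr, -, hVX, hVd⟩ := comp_E_iff (m := interp v) (n := interp (u ++ v))
    (o := interp []) X.sem d.sem KA KB (fun _ => rfl) (fun _ => rfl) (fun _ => rfl)
    (fun _ => rfl) (by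
      intro i t ht
      exact ((hent _ _).1 ⟨t, ht, rfl⟩).symm) (by
      intro j t ht
      obtain ⟨k | j, rfl⟩ := (appL u v).surjective j
      · obtain rfl := eq_of_entry ht (hXn k)
        exact (hK1 k).symm
      · obtain rfl := eq_of_entry ht (hXl j)
        exact (hK2 j).symm)
  refine ⟨D, ψ, ?_, ?_, KB, fun x => rfl, hK1, hK2, ?_, ?_, ?_⟩
  · rintro (x | x)
    · refine (h1 x).trans ?_
      rw [hφ]
      exact hN1 _
    · exact Iff.rfl
  · rintro (x | x)
    · refine (h2 x).trans ?_
      rw [hφ]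
      exact hN2 _
    · rfl
  · intro i t
    refine (hr i t).trans (Iff.trans ?_ (hent _ t).symm)
    constructor
    · rintro ⟨y, hy, rfl⟩
      obtain rfl := eq_of_entry hy (hXr i)
      rfl
    · intro h
      exact ⟨_, hXr i, h⟩
  · intro t
    refine (hVX x₀ t).trans (Iff.trans ?_ (exists_congr fun k => (hent _ t).symm))
    constructor
    · rintro ⟨y, hy, rfl⟩
      obtain ⟨k, rfl⟩ := (hX0 y).1 hy
      exact ⟨k, rfl⟩
    · rintro ⟨k, h⟩
      exact ⟨_, (hX0 _).2 ⟨k, rfl⟩, h⟩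
  · exact fun x t => hVd x t

/-- Input and output ports swap roles at the boundary: outputs of the position `none` are entries of
the smaller net, its inputs are exits. Plugging the position back in restores the original edges. -/
theorem realizable_net_option {V : Type*} {u : Option V → List Dir} {own : Set (Option V)}
    {pr : Option V → Fin (M + 1)} {v : List Dir}
    (hnode : NodeRealizable [] (u none) (Set.ofPred fun _ => none ∈ own) (pr none))
    (φ : Entries (interp v) (interp []) ⊕ (Σ x, RW (u x)) ≃
      Exits (interp v) (interp []) ⊕ (Σ x, LW (u x)))
    (h : Realizable (u none ++ v) [] (Set.ofPred fun x => some x ∈ own) (fun x => pr (some x))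
      (netEdge (out := fun x => RW (u (some x))) (inn := fun x => LW (u (some x)))
        ((absorb (f := fun x => RW (u x)) (appR (u none) v)).trans
          (φ.trans (absorb (f := fun x => LW (u x)) (appL (u none) v)).symm)))) :
    Realizable v [] own pr (netEdge φ) := by
  obtain ⟨d, κ, h1, h2, h3⟩ := h
  obtain ⟨D, ψ, g1, g2, K, k1, k2, k3, e1, e2, e3⟩ := exists_plug hnode d
  set α := absorb (f := fun x => RW (u x)) (C := LW []) (appR (u none) v) with hα
  set β := absorb (f := fun x => LW (u x)) (C := RW []) (appL (u none) v) with hβ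
  let χ : D.sem.V ≃ Option V := ψ.trans (Equiv.optionCongr κ)
  have hχ0 : χ.symm none = ψ.symm none := rfl
  have hχ1 : ∀ x, χ.symm (some x) = ψ.symm (some (κ.symm x)) := fun x => rfl
  -- targets of the ports before and after absorbing the position
  have hK : ∀ q, K (Sum.elim Sum.inr (fun y => Sum.inl (κ.symm y.1)) q) =
      Sum.elim Sum.inr (fun y => Sum.inl (χ.symm y.1)) (β q) := by
    rintro ((q | q) | ⟨x, k⟩)
    · obtain ⟨k | j, rfl⟩ := (appL (u none) v).surjective q
      · rw [hβ, absorb_port]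
        exact k2 k
      · rw [hβ, absorb_wire]
        exact k3 j
    · exact Fin.elim0 q
    · exact k1 _
  have hd : ∀ s y, d.sem.E s y ↔ ∃ p, Sum.map _root_.id (fun y => κ.symm y.1) p = s ∧
      Sum.elim Sum.inr (fun y => Sum.inl (κ.symm y.1)) (β.symm (φ (α p))) = y := by
    intro s y
    rw [h3]
    refine exists_congr fun p => and_congr ?_ ?_
    · rcases p with p | p <;> rcases s with s | s <;> simp [Equiv.symm_apply_eq]
    · change Sum.elim Sum.inr (Sum.inl ∘ Sigma.fst) (β.symm (φ (α p))) = _ ↔ _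
      generalize β.symm (φ (α p)) = q
      rcases q with q | q <;> rcases y with y | y <;> simp [Equiv.symm_apply_eq]
  have hdK : ∀ s t, (∃ y, d.sem.E s y ∧ K y = t) ↔
      ∃ p, Sum.map _root_.id (fun y => κ.symm y.1) p = s ∧
        Sum.elim Sum.inr (fun y => Sum.inl (χ.symm y.1)) (φ (α p)) = t := by
    intro s t
    simp only [hd]
    constructor
    · rintro ⟨_, ⟨p, hp, rfl⟩, rfl⟩
      exact ⟨p, hp, by rw [hK, Equiv.apply_symm_apply]⟩
    · rintro ⟨p, hp, rfl⟩
      exact ⟨_, ⟨p, hp, rfl⟩, by rw [hK, Equiv.apply_symm_apply]⟩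
  have key : ∀ s t, D.sem.E s t ↔ ∃ p, Sum.map _root_.id (fun y => χ.symm y.1) p = s ∧
      Sum.elim Sum.inr (fun y => Sum.inl (χ.symm y.1)) (φ p) = t := by
    intro s t
    rcases s with (i | j) | x
    · rw [e1, hdK]
      constructor
      · rintro ⟨p | p, hp, rfl⟩ <;> cases hp
        exact ⟨_, rfl, by rw [hα, absorb_wire]⟩
      · rintro ⟨p | p, hp, rfl⟩ <;> cases hp
        exact ⟨_, rfl, by rw [hα, absorb_wire]⟩
    · exact Fin.elim0 j
    · obtain ⟨x, rfl⟩ := χ.symm.surjective x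
      rcases x with _ | x
      · rw [hχ0, e2]
        simp only [hdK]
        constructor
        · rintro ⟨k, p | p, hp, rfl⟩ <;> cases hp
          exact ⟨Sum.inr ⟨none, k⟩, rfl, by rw [hα, absorb_port]⟩
        · rintro ⟨p | ⟨x, k⟩, hp, rfl⟩
          · cases hp
          · obtain rfl : x = none := χ.symm.injective (Sum.inr_injective hp)
            exact ⟨k, _, rfl, by rw [hα, absorb_port]⟩
      · rw [hχ1, e3, hdK]
        constructor
        · rintro ⟨p | ⟨y, k⟩, hp, rfl⟩
          · cases hp
          · obtain rfl : y = x := κ.symm.injective (Sum.inr_injective hp)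
            exact ⟨Sum.inr ⟨some y, k⟩, rfl, rfl⟩
        · rintro ⟨p | ⟨y, k⟩, hp, rfl⟩
          · cases hp
          · obtain rfl : y = some x := χ.symm.injective (Sum.inr_injective hp)
            exact ⟨Sum.inr ⟨x, k⟩, rfl, rfl⟩
  refine ⟨D, χ, fun x => ?_, fun x => ?_, fun s t => ?_⟩
  · rw [g1]
    change _ ↔ (ψ x).map κ ∈ own
    rcases ψ x with _ | y
    · exact Iff.rfl
    · exact h1 y
  · rw [g2]
    change _ = pr ((ψ x).map κ)
    rcases ψ x with _ | y
    · rfl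
    · exact h2 y
  · rw [key]
    refine exists_congr fun p => and_congr ?_ ?_
    · rcases p with p | p <;> rcases s with s | s <;> simp [Equiv.symm_apply_eq]
    · generalize φ p = q
      rcases q with q | q <;> rcases t with t | t <;> simp [Equiv.symm_apply_eq]

/-- Without positions and codomain, only the wires of `v` remain, and `φ` matches them. -/
theorem realizable_net_empty {V : Type*} [IsEmpty V] {u : V → List Dir} {own : Set V}
    {pr : V → Fin (M + 1)} {v : List Dir}
    (φ : Entries (interp v) (interp []) ⊕ (Σ x, RW (u x)) ≃
      Exits (interp v) (interp []) ⊕ (Σ x, LW (u x))) :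
    Realizable v [] own pr (netEdge φ) := by
  have : IsEmpty (Fin (interp []).2) := inferInstanceAs (IsEmpty (Fin 0))
  have : IsEmpty (Fin (interp []).1) := inferInstanceAs (IsEmpty (Fin 0))
  let f : RW v ≃ LW v := ((Equiv.sumEmpty _ _).symm.trans (Equiv.sumEmpty _ _).symm).trans
    (φ.trans ((Equiv.sumEmpty _ _).trans (Equiv.sumEmpty _ _)))
  have hf : ∀ i, φ (Sum.inl (Sum.inl i)) = Sum.inl (Sum.inl (f i)) := by
    intro i
    rcases hq : φ (Sum.inl (Sum.inl i)) with (j | j) | j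
    · simp [f, hq]
    · exact isEmptyElim j
    · exact isEmptyElim j.1
  obtain ⟨X, hX, hE⟩ := isMatching_of_injective (M := M) _ v f rfl
    (Fin.equiv_iff_eq.1 ⟨f⟩).symm f.injective
  refine ⟨X, Equiv.equivOfIsEmpty _ _, fun x => isEmptyElim x, fun x => isEmptyElim x, ?_⟩
  rintro ((i | j) | x) t
  · constructor
    · intro h
      obtain rfl := eq_of_entry h (hE i)
      exact ⟨Sum.inl (Sum.inl i), rfl, by rw [hf]; rfl⟩
    · rintro ⟨p | p, hp, ht⟩
      · cases hp
        rw [hf] at ht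
        rcases t with x | t
        · exact isEmptyElim x
        · have := Sum.inr_injective ht
          change _ = t at this
          rw [← this]
          exact hE i
      · exact isEmptyElim p.1
  · exact isEmptyElim j
  · exact isEmptyElim x

theorem Realizable.of_equiv {V W : Type*} {v w : List Dir} (e : V ≃ W) {own : Set V}
    {pr : V → Fin (M + 1)} {E} (h : Realizable v w own pr E) {own' : Set W}
    {pr' : W → Fin (M + 1)} {E'} (h1 : ∀ x, x ∈ own ↔ e x ∈ own') (h2 : ∀ x, pr x = pr' (e x))
    (h3 : ∀ s t, E s t ↔ E' (Sum.map _root_.id e s) (Sum.map e _root_.id t)) :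
    Realizable v w own' pr' E' := by
  obtain ⟨d, κ, k1, k2, k3⟩ := h
  refine ⟨d, κ.trans e, fun x => (k1 x).trans (h1 _), fun x => (k2 x).trans (h2 _), fun s t => ?_⟩
  rw [k3, h3]
  simp [Sum.map_map]

/-- Nets on a type all of whose elements are elementary positions can be realized. -/
def NetsRealizable (M : ℕ) (V : Type u) : Prop :=
  ∀ (u : V → List Dir) (own : Set V) (pr : V → Fin (M + 1)),
    (∀ x, NodeRealizable [] (u x) (Set.ofPred fun _ => x ∈ own) (pr x)) →
    ∀ (v : List Dir) (φ : Entries (interp v) (interp []) ⊕ (Σ x, RW (u x)) ≃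
      Exits (interp v) (interp []) ⊕ (Σ x, LW (u x))), Realizable v [] own pr (netEdge φ)

theorem netsRealizable_of_finite (V : Type u) [Finite V] : NetsRealizable M V := by
  refine Finite.induction_empty_option (P := fun V => NetsRealizable M V) ?_ ?_ ?_ V
  · intro V W e h u own pr hnode v φ
    let α := (Equiv.refl (Entries (interp v) (interp []))).sumCongr
      (Equiv.sigmaCongrLeft (β := fun x => RW (u x)) e)
    let β := (Equiv.refl (Exits (interp v) (interp []))).sumCongr
      (Equiv.sigmaCongrLeft (β := fun x => LW (u x)) e)
    refine (h (fun x => u (e x)) (Set.ofPred fun x => e x ∈ own) (fun x => pr (e x))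
      (fun x => hnode (e x)) v (α.trans (φ.trans β.symm))).of_equiv e (fun _ => Iff.rfl)
      (fun _ => rfl) fun s t => ?_
    refine α.exists_congr fun p => and_congr ?_ ?_
    · rcases p with p | ⟨x, k⟩ <;> rcases s with s | s <;> simp [α]
    · simp only [Equiv.trans_apply]
      generalize φ (α p) = q
      obtain ⟨q, rfl⟩ := β.surjective q
      rw [Equiv.symm_apply_apply]
      rcases q with q | ⟨x, k⟩ <;> rcases t with t | t <;> simp [β]
  · exact fun u own pr _ v φ => realizable_net_empty φ
  · intro V _ h u own pr hnode v φ
    exact realizable_net_option (hnode none) φ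
      (h _ _ _ (fun x => hnode (some x)) _ _)

/-- The codomain is bent away letter by letter; the domain is generalised because it grows in the
process. -/
theorem realizable_net {V : Type u} [Finite V] {u : V → List Dir} {own : Set V}
    {pr : V → Fin (M + 1)}
    (hnode : ∀ x, NodeRealizable [] (u x) (Set.ofPred fun _ => x ∈ own) (pr x)) (w : List Dir) :
    ∀ (v : List Dir) (φ : Entries (interp v) (interp w) ⊕ (Σ x, RW (u x)) ≃
      Exits (interp v) (interp w) ⊕ (Σ x, LW (u x))), Realizable v w own pr (netEdge φ) := by
  induction w with
  | nil => exact fun v φ => netsRealizable_of_finite V u own pr hnode v φ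
  | cons c w ih =>
    intro v φ
    let α := (bendEntries c v w).sumCongr (Equiv.refl (Σ x, RW (u x)))
    let β := (bendExits c v w).sumCongr (Equiv.refl (Σ x, LW (u x)))
    refine Realizable.bend (c := c) (v := v) (w := w) ?_
    convert ih ([dual c] ++ v) (α.trans (φ.trans β.symm)) using 1
    funext s t
    refine propext (Iff.symm ?_)
    refine α.exists_congr fun p => and_congr ?_ ?_
    · rcases p with p | ⟨x, k⟩ <;> rcases s with s | s <;> simp [α]
    · simp only [Equiv.trans_apply]
      generalize φ (α p) = q
      obtain ⟨q, rfl⟩ := β.surjective q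
      rw [Equiv.symm_apply_apply]
      rcases q with q | ⟨x, k⟩ <;> rcases t with t | t <;> simp [β]

/-! ## Universality -/

/-- The interface of an elementary position. -/
def nodeWord {m n : Obj} {A : OpenParityGame.{u} M m n} : XNode A → List Dir
  | XNode.start _ => [Dir.right]
  | XNode.merge _ _ => [Dir.left, Dir.left, Dir.right]
  | XNode.prio _ => [Dir.left, Dir.right]
  | XNode.player _ _ => [Dir.left, Dir.right, Dir.right]
  | XNode.lose _ => [Dir.left]

/-- Any bijection would do, as an elementary position treats its ports alike. -/
def outEquiv {m n : Obj} {A : OpenParityGame.{u} M m n} : (x : XNode A) → RW (nodeWord x) ≃ x.Out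
  | XNode.start _ => finOneEquiv
  | XNode.merge _ _ => finOneEquiv
  | XNode.prio _ => finOneEquiv
  | XNode.player _ _ => finTwoEquiv
  | XNode.lose _ => Equiv.equivOfIsEmpty (Fin 0) Empty

def inEquiv {m n : Obj} {A : OpenParityGame.{u} M m n} : (x : XNode A) → LW (nodeWord x) ≃ x.In
  | XNode.start _ => Equiv.equivOfIsEmpty (Fin 0) Empty
  | XNode.merge _ _ => finTwoEquiv
  | XNode.prio _ => finOneEquiv
  | XNode.player _ _ => finOneEquiv
  | XNode.lose _ => finOneEquiv

theorem nodeRealizable_xnode {m n : Obj} {A : OpenParityGame.{u} M m n} (x : XNode A) :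
    NodeRealizable [] (nodeWord x) (Set.ofPred fun _ => x.IsZero) x.prioOf := by
  rcases x with x | ⟨x, j⟩ | x | ⟨x, j⟩ | x
  · exact nodeRealizable_start
  · exact nodeRealizable_merge
  · exact nodeRealizable_priority _
  · exact nodeRealizable_player _
  · exact nodeRealizable_lose _

theorem netEdge_congr_ports {I O V : Type*} {out inn out' inn' : V → Type}
    (φ : I ⊕ (Σ x, out x) ≃ O ⊕ (Σ x, inn x)) (eo : ∀ x, out' x ≃ out x)
    (ei : ∀ x, inn' x ≃ inn x) (s t) :
    netEdge (((Equiv.refl I).sumCongr (Equiv.sigmaCongrRight eo)).trans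
      (φ.trans ((Equiv.refl O).sumCongr (Equiv.sigmaCongrRight ei)).symm)) s t ↔
      netEdge φ s t := by
  refine ((Equiv.refl I).sumCongr (Equiv.sigmaCongrRight eo)).exists_congr fun p =>
    and_congr ?_ ?_
  · rcases p with p | p <;> exact Iff.rfl
  · simp only [Equiv.trans_apply]
    generalize φ _ = q
    rcases q with q | q <;> exact Iff.rfl

theorem exists_iso_expansion {v w : List Dir} (A : OpenParityGame.{u} M (interp v) (interp w)) :
    ∃ d : Diagram M v w, Iso d.sem A.expansion := by
  have h := realizable_net (own := Set.ofPred fun y : XNode A => y.IsZero) nodeRealizable_xnode w v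
    (((Equiv.refl _).sumCongr (Equiv.sigmaCongrRight outEquiv)).trans
      ((XNode.srcEquiv.symm.trans XNode.tgtEquiv).trans
        ((Equiv.refl _).sumCongr (Equiv.sigmaCongrRight inEquiv)).symm))
  obtain ⟨d, κ, h1, h2, h3⟩ := h
  exact ⟨d, κ, h1, h2, fun s t => (h3 s t).trans (netEdge_congr_ports _ _ _ _ _)⟩

end Diagram

end ParityGames

theorem mainTheorem3 (M : ℕ) (hM : 2 ≤ M) (m n : Obj) (A : OpenParityGame.{u} M m n)
    (v w : List Dir) (hv : interp v = m) (hw : interp w = n) :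
    ∃ d : Diagram M v w, OpenParityGame.Equivalent (d.sem.cast hv hw) A := by
  -- Once the objects are literally interpretations of words, the transport in the statement is the
  -- identity by definition.
  subst hv hw
  obtain ⟨d, hd⟩ := Diagram.exists_iso_expansion A
  exact ⟨d, hd.equivalent.trans (OpenParityGame.expansion_equivalent A)⟩
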